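/- Let $d\in\{2,3\}$, $Y=(0,1]^d$, and let $D$ (the union of the inclusions) be a nonempty open set with $\overline D\subset(0,1)^d$ and boundary of class $C^{1,\gamma}$ for some $\gamma\in(0,1]$. Let $L^2_0(Y)$ be the space of complex square integrable functions on $Y$ with mean zero, with inner product $(\cdot,\cdot)$, and let $\mathcal H=\{h\in H^1(Y):\int_Y h\,dx=0\}$, a Hilbert space under $\langle u,v\rangle=\int_Y\nabla u\cdot\overline{\nabla v}\,dx$. Let $(-\Delta_N)^{-1}:L^2_0(Y)\to\mathcal H$ be defined by $\langle(-\Delta_N)^{-1}f,v\rangle=(f,v)$ for all $v\in\mathcal H$. Let $W_1\subset\mathcal H$ be the closure of the functions in $\mathcal H$ vanishing in a neighbourhood of $\overline D$, let $W_2=\{\tilde u-(\int_D\tilde u\,dx)1_Y:\tilde u\in H^1_0(D)\text{ extended by }0\}$, and $W_3=(W_1\oplus W_2)^\perp$. Let $T$ be the operator with $\langle Tu,v\rangle=\frac12\int_{Y\setminus D}\nabla u\cdot\overline{\nabla v}\,dx-\frac12\int_D\nabla u\cdot\overline{\nabla v}\,dx$; the eigenvalues $\mu$ of $T$ on $W_3$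 are the Neumann electrostatic resonances of $D$, and $P_\mu$ denotes the orthogonal projection of $\mathcal H$ onto the corresponding eigenspace in $W_3$. Let $P_1$ be the sum of the orthogonal projections onto $W_1$ and onto the eigenspace in $W_3$ of $\mu=\frac12$, and let $P_2$ be the orthogonal projection onto $W_2$. For $z\in\mathbb C$ put, with sums over the resonances in $(-\frac12,\frac12)$ converging strongly, $$A(z)=\Big(zP_1+P_2+z\sum_{-\frac12<\mu<\frac12}\big[(\tfrac12+\mu)+z(\tfrac12-\mu)\big]^{-1}P_\mu\Big)(-\Delta_N)^{-1},$$ an operator on $L^2_0(Y)$, and $R(\zeta,z)=(A(z)-\zeta)^{-1}$. Suppose that $-\frac12<\mu^*<\frac12$ and that every Neumann electrostatic resonance $\mu$ of $D$ satisfies $\mu\ge\mu^*$. Let $\beta_0\in\sigma(A(0))$ and let $\Gamma$ be a positively oriented closed piecewise $C^1$ contour in $\mathbb C$ which has $\beta_0$ in its interior and all other points of $\sigma(A(0))$ in its exterior; it is enough that $\Gamma$ winds zero times or once around each point off $\Gamma$, the interior being the set of points of winding number one. Put $$\hat d=\inf_{\zeta\in\Gamma}\operatorname{dist}(\zeta,\sigma(A(0))),\qquad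 z^*=\frac{\mu^*+\frac12}{\mu^*-\frac12},\qquad r^*=\frac{\pi^2\hat d\,|z^*|}{\frac{1}{1/2-\mu^*}+\pi^2\hat d},$$ $$P(z)=\frac{-1}{2\pi i}\oint_\Gamma R(\zeta,z)\,d\zeta,\qquad M'(z)=P(z)L^2_0(Y).$$ Then: 1. If $|z|<r^*$, then $\Gamma$ lies in the resolvent sets of $A(0)$ and of $A(z)$. Hence $\sigma(A(z))$ is the union of the part $\Sigma'(z)$ inside $\Gamma$ and the part $\Sigma''(z)$ exterior to $\Gamma$. $P(z)$ is a projection commuting with $A(z)$; the spectra of the restrictions of $A(z)$ to $M'(z)$ and to $\ker P(z)$ are $\Sigma'(z)$ and $\Sigma''(z)$, respectively. $M'(z)$ is finite dimensional, and $\Sigma'(z)$ consists of finitely many eigenvalues of $A(z)$. As $z\to0$ these converge to $\beta_0$: for every $\varepsilon>0$ there is $\delta>0$ such that $|\beta-\beta_0|<\varepsilon$ for all $\beta\in\Sigma'(z)$ whenever $|z|<\delta$ and $|z|<r^*$. 2. $z\mapsto P(z)$ is holomorphic, in operator norm, for $|z|<r^*$. 3. $M'(z)$ and $M'(0)$ are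 isomorphic for $|z|<r^*$ (by a bounded linear map with bounded inverse). 4. For each real $z$ with $|z|<r^*$ let $\beta(z)$ be an eigenvalue of $A(z)$ inside $\Gamma$ with an eigenvector $\varphi(z)$ of norm $1$ in $L^2_0(Y)$. Then $$\beta(z)=\beta_0+\sum_{n=1}^\infty z^n\beta^n(z),\qquad \beta^n(z)=-\frac1{2\pi i}\Big(\oint_\Gamma(\zeta-\beta_0)\,R(\zeta,0)\,\big(-\mathcal N(\zeta,z)\big)^n\,d\zeta\;\varphi(z),\varphi(z)\Big),$$ where $$\mathcal N(\zeta,z)=\Big(P_1+\sum_{-\frac12<\mu<\frac12}\big[(\tfrac12+\mu)+z(\tfrac12-\mu)\big]^{-1}P_\mu\Big)(-\Delta_N)^{-1}R(\zeta,0),$$ and the series converges uniformly on $\{z\in\mathbb R:|z|<r^*\}$. -/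

import Mathlib

open MeasureTheory Set Topology Filter
open scoped ENNReal NNReal ContDiff InnerProductSpace

noncomputable section

namespace NeumannCrystal

/-- Points of `ℝ^d`. -/
abbrev Pt (d : ℕ) : Type := EuclideanSpace ℝ (Fin d)

/-- The open unit cell `(0,1)^d` (equal to `Y = (0,1]^d` up to a null set). -/
def cell (d : ℕ) : Set (Pt d) := {x | ∀ i, 0 < x i ∧ x i < 1}

/-- Lebesgue measure on the unit cell. -/
def cellMeasure (d : ℕ) : Measure (Pt d) := volume.restrict (cell d)

/-- `L²(Y)`, complex valued. -/
abbrev L2 (d : ℕ) : Type := Lp ℂ 2 (cellMeasure d)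

/-- `L²(Y)^d`, complex vector fields. -/
abbrev L2Vec (d : ℕ) : Type := Lp (EuclideanSpace ℂ (Fin d)) 2 (cellMeasure d)

/-- `g` is the weak gradient of `u` on the unit cell. -/
def IsWeakGradient {d : ℕ} (u : Pt d → ℂ) (g : Pt d → EuclideanSpace ℂ (Fin d)) : Prop :=
  ∀ φ : Pt d → ℝ, ContDiff ℝ ∞ φ → HasCompactSupport φ → tsupport φ ⊆ cell d → ∀ j : Fin d,
    ∫ x, (fderiv ℝ φ x (EuclideanSpace.single j 1)) • u x ∂(cellMeasure d)
      = - ∫ x, φ x • g x j ∂(cellMeasure d)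

lemma cell_eq (d : ℕ) : cell d = ⋂ i, {x : Pt d | 0 < x i ∧ x i < 1} := by
  ext x; simp [cell]

lemma isOpen_cell (d : ℕ) : IsOpen (cell d) := by
  rw [cell_eq]
  refine isOpen_iInter_of_finite fun i => ?_
  have h : Continuous fun x : Pt d => x i := by fun_prop
  exact (isOpen_lt continuous_const h).inter (isOpen_lt h continuous_const)

lemma measurableSet_cell (d : ℕ) : MeasurableSet (cell d) := (isOpen_cell d).measurableSet

lemma cell_preimage (d : ℕ) :
    WithLp.toLp 2 ⁻¹' (cell d) = Set.univ.pi (fun _ : Fin d => Ioo (0 : ℝ) 1) := by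
  ext x; simp [cell]

lemma map_cellMeasure (d : ℕ) :
    Measure.map (WithLp.toLp 2) (Measure.pi fun _ : Fin d => volume.restrict (Ioo (0 : ℝ) 1))
      = cellMeasure d := by
  rw [← Measure.restrict_pi_pi, ← cell_preimage, ← volume_pi, cellMeasure]
  exact ((PiLp.volume_preserving_toLp (Fin d)).restrict_preimage (measurableSet_cell d)).map_eq

lemma measurePreserving_cell (d : ℕ) :
    MeasurePreserving (WithLp.toLp 2)
      (Measure.pi fun _ : Fin d => volume.restrict (Ioo (0 : ℝ) 1)) (cellMeasure d) :=
  ⟨(PiLp.volume_preserving_toLp (Fin d)).measurable, map_cellMeasure d⟩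

lemma volume_cell (d : ℕ) : cellMeasure d univ = 1 := by
  rw [← map_cellMeasure, Measure.map_apply (PiLp.volume_preserving_toLp (Fin d)).measurable
    MeasurableSet.univ, preimage_univ, Measure.pi_univ]
  simp

instance (d : ℕ) : IsProbabilityMeasure (cellMeasure d) := ⟨volume_cell d⟩

lemma integral_cell_prod (d : ℕ) (f : Fin d → ℝ → ℂ) :
    ∫ x, ∏ i, f i (x i) ∂(cellMeasure d) = ∏ i, ∫ t in (0 : ℝ)..1, f i t := by
  have := (measurePreserving_cell d).integral_comp
    (MeasurableEquiv.toLp 2 (Fin d → ℝ)).measurableEmbedding (fun x : Pt d => ∏ i, f i (x i))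
  rw [← this]
  simp only
  rw [integral_fintype_prod_eq_prod (𝕜 := ℂ) (fun i t => f i t)]
  refine Finset.prod_congr rfl fun i _ => ?_
  rw [intervalIntegral.integral_of_le zero_le_one, integral_Ioc_eq_integral_Ioo]

/-- A continuous function which is bounded on the cell is in `L²(Y)`. -/
lemma memLp_of_bdd {d : ℕ} {ψ : Pt d → ℂ} (hψ : Continuous ψ) {C : ℝ}
    (hC : ∀ x ∈ cell d, ‖ψ x‖ ≤ C) : MemLp ψ 2 (cellMeasure d) := by
  refine MemLp.of_bound hψ.aestronglyMeasurable C ?_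
  exact (ae_restrict_iff' (measurableSet_cell d)).2 (Eventually.of_forall hC)


/-! ### One-dimensional trigonometric functions -/

/-- Normalised cosines on `(0,1)`. -/
def cosN (k : ℕ) (t : ℝ) : ℝ := (if k = 0 then 1 else √2) * Real.cos (k * Real.pi * t)

/-- Normalised sines on `(0,1)`. -/
def sinN (k : ℕ) (t : ℝ) : ℝ := √2 * Real.sin (k * Real.pi * t)

lemma integral_cos_int (k : ℤ) (hk : k ≠ 0) :
    ∫ t in (0 : ℝ)..1, Real.cos (k * Real.pi * t) = 0 := by
  have hk' : (k * Real.pi : ℝ) ≠ 0 := mul_ne_zero (by exact_mod_cast hk) Real.pi_ne_zero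
  rw [intervalIntegral.integral_comp_mul_left (fun t => Real.cos t) hk', integral_cos]
  simp [Real.sin_int_mul_pi]

lemma integral_cos_diff (k l : ℕ) :
    ∫ t in (0 : ℝ)..1, Real.cos ((k - l : ℤ) * Real.pi * t) = if k = l then 1 else 0 := by
  split_ifs with h
  · subst h; simp
  · exact integral_cos_int _ (by omega)

lemma integral_cos_sum (k l : ℕ) :
    ∫ t in (0 : ℝ)..1, Real.cos ((k + l : ℤ) * Real.pi * t)
      = if k = 0 ∧ l = 0 then 1 else 0 := by
  split_ifs with h
  · obtain ⟨rfl, rfl⟩ := h; simp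
  · exact integral_cos_int _ (by omega)

lemma integral_cosN (k l : ℕ) :
    ∫ t in (0 : ℝ)..1, cosN k t * cosN l t = if k = l then 1 else 0 := by
  have h2 : √2 * √2 = 2 := Real.mul_self_sqrt (by norm_num)
  have key : ∀ t, cosN k t * cosN l t = ((if k = 0 then 1 else √2) * (if l = 0 then 1 else √2) / 2)
      * (Real.cos ((k - l : ℤ) * Real.pi * t) + Real.cos ((k + l : ℤ) * Real.pi * t)) := by
    intro t
    have e1 : ((k - l : ℤ) * Real.pi * t : ℝ) = k * Real.pi * t - l * Real.pi * t := by
      push_cast; ring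
    have e2 : ((k + l : ℤ) * Real.pi * t : ℝ) = k * Real.pi * t + l * Real.pi * t := by
      push_cast; ring
    rw [e1, e2, Real.cos_sub, Real.cos_add, cosN, cosN]; ring
  simp_rw [key]
  rw [intervalIntegral.integral_const_mul, intervalIntegral.integral_add
    (Continuous.intervalIntegrable (by fun_prop) _ _)
    (Continuous.intervalIntegrable (by fun_prop) _ _), integral_cos_diff, integral_cos_sum]
  by_cases hkl : k = l
  · subst hkl
    by_cases hk : k = 0
    · simp [hk]; norm_num
    · simp [hk, h2]
  · have : ¬ (k = 0 ∧ l = 0) := by omega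
    simp [hkl, this]

lemma integral_sinN (k l : ℕ) (hk : k ≠ 0) :
    ∫ t in (0 : ℝ)..1, sinN k t * sinN l t = if k = l then 1 else 0 := by
  have h2 : √2 * √2 = 2 := Real.mul_self_sqrt (by norm_num)
  have key : ∀ t, sinN k t * sinN l t =
      (Real.cos ((k - l : ℤ) * Real.pi * t) - Real.cos ((k + l : ℤ) * Real.pi * t)) := by
    intro t
    have e1 : ((k - l : ℤ) * Real.pi * t : ℝ) = k * Real.pi * t - l * Real.pi * t := by
      push_cast; ring
    have e2 : ((k + l : ℤ) * Real.pi * t : ℝ) = k * Real.pi * t + l * Real.pi * t := by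
      push_cast; ring
    rw [e1, e2, Real.cos_sub, Real.cos_add, sinN, sinN]
    linear_combination (Real.sin (k * Real.pi * t) * Real.sin (l * Real.pi * t)) * h2
  simp_rw [key]
  rw [intervalIntegral.integral_sub
    (Continuous.intervalIntegrable (by fun_prop) _ _)
    (Continuous.intervalIntegrable (by fun_prop) _ _), integral_cos_diff, integral_cos_sum]
  simp [hk]

lemma contDiff_cosN (k : ℕ) : ContDiff ℝ ∞ (cosN k) := by unfold cosN; fun_prop
lemma contDiff_sinN (k : ℕ) : ContDiff ℝ ∞ (sinN k) := by unfold sinN; fun_prop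

lemma deriv_sinN (k : ℕ) (t : ℝ) : deriv (sinN k) t = k * Real.pi * cosN k t := by
  have : HasDerivAt (sinN k) (√2 * (Real.cos (k * Real.pi * t) * (k * Real.pi * 1))) t :=
    (((hasDerivAt_id t).const_mul (k * Real.pi)).sin).const_mul _
  rw [this.deriv, cosN]
  split_ifs with h
  · simp [h]
  · ring

lemma abs_sinN_le (k : ℕ) {t : ℝ} (ht : 0 < t ∧ t < 1) :
    |sinN k t| ≤ (√2 * (k * Real.pi)) * t ∧ |sinN k t| ≤ (√2 * (k * Real.pi)) * (1 - t) := by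
  have hk : (0 : ℝ) ≤ k * Real.pi := by positivity
  have h (s : ℝ) (hs : 0 ≤ s) : |Real.sin (k * Real.pi * s)| ≤ k * Real.pi * s := by
    refine Real.abs_sin_le_abs.trans ?_
    rw [abs_of_nonneg (by positivity)]
  have hs : |Real.sin (k * Real.pi * t)| = |Real.sin (k * Real.pi * (1 - t))| := by
    have : k * Real.pi * (1 - t) = k * Real.pi - k * Real.pi * t := by ring
    rw [this, Real.sin_nat_mul_pi_sub]
    simp [abs_mul]
  constructor
  · rw [sinN, abs_mul, abs_of_nonneg (Real.sqrt_nonneg _), mul_assoc (√2) (k * Real.pi) t]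
    exact mul_le_mul_of_nonneg_left (h t ht.1.le) (Real.sqrt_nonneg _)
  · rw [sinN, abs_mul, abs_of_nonneg (Real.sqrt_nonneg _), hs,
      mul_assoc (√2) (k * Real.pi) (1 - t)]
    exact mul_le_mul_of_nonneg_left (h _ (by linarith)) (Real.sqrt_nonneg _)

/-! ### Products of functions of one variable -/

/-- The function `x ↦ ∏ᵢ fᵢ(xᵢ)`. -/
def tensor {d : ℕ} (f : Fin d → ℝ → ℝ) (x : Pt d) : ℝ := ∏ i, f i (x i)

lemma contDiff_tensor {d : ℕ} {f : Fin d → ℝ → ℝ} (hf : ∀ i, ContDiff ℝ ∞ (f i)) :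
    ContDiff ℝ ∞ (tensor f) := by
  unfold tensor
  refine contDiff_prod fun i _ => (hf i).comp ?_
  fun_prop

lemma fderiv_tensor {d : ℕ} {f : Fin d → ℝ → ℝ} (hf : ∀ i, ContDiff ℝ ∞ (f i)) (j : Fin d)
    (x : Pt d) : fderiv ℝ (tensor f) x (EuclideanSpace.single j 1)
      = tensor (Function.update f j (deriv (f j))) x := by
  have h1 : HasFDerivAt (tensor f) (fderiv ℝ (tensor f) x) x :=
    ((contDiff_tensor hf).differentiable (by simp) x).hasFDerivAt
  have h2 : HasDerivAt (fun t : ℝ => x + t • (EuclideanSpace.single j (1 : ℝ)))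
      (EuclideanSpace.single j (1 : ℝ)) 0 := by
    simpa using ((hasDerivAt_id (0 : ℝ)).smul_const (EuclideanSpace.single j (1 : ℝ))).const_add x
  have h3 := HasFDerivAt.comp_hasDerivAt (0 : ℝ) (l := tensor f)
    (f := fun t : ℝ => x + t • (EuclideanSpace.single j (1 : ℝ))) (by simpa using h1) h2
  have h4 : (tensor f ∘ fun t : ℝ => x + t • (EuclideanSpace.single j (1 : ℝ)))
      = fun t => f j (x j + t) * ∏ i ∈ Finset.univ.erase j, f i (x i) := by
    funext t
    simp only [Function.comp, tensor]
    rw [← Finset.mul_prod_erase _ _ (Finset.mem_univ j)]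
    congr 1
    · simp
    · refine Finset.prod_congr rfl fun i hi => ?_
      simp [(Finset.ne_of_mem_erase hi)]
  have h5 : HasDerivAt (fun t => f j (x j + t) * ∏ i ∈ Finset.univ.erase j, f i (x i))
      (deriv (f j) (x j) * ∏ i ∈ Finset.univ.erase j, f i (x i)) 0 := by
    refine HasDerivAt.mul_const ?_ _
    have h6 : HasDerivAt (f j) (deriv (f j) (x j + 0)) (x j + 0) :=
      ((hf j).differentiable (by simp) _).hasDerivAt
    simpa using h6.comp_const_add (x j) 0
  rw [h4] at h3
  rw [h3.unique h5, tensor, ← Finset.mul_prod_erase _ _ (Finset.mem_univ j)]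
  congr 1
  · simp
  · refine Finset.prod_congr rfl fun i hi => ?_
    simp [(Finset.ne_of_mem_erase hi)]


/-! ### Cut-offs: testing the weak gradient against products vanishing on two faces only -/

/-- A smooth cut-off of `(0,1)`. -/
def cut (k : ℕ) (t : ℝ) : ℝ :=
  Real.smoothTransition (k * t - 1) * Real.smoothTransition (k * (1 - t) - 1)

lemma contDiff_cut (k : ℕ) : ContDiff ℝ ∞ (cut k) := by
  unfold cut
  exact (Real.smoothTransition.contDiff.comp (by fun_prop)).mul
    (Real.smoothTransition.contDiff.comp (by fun_prop))

lemma cut_nonneg (k : ℕ) (t : ℝ) : 0 ≤ cut k t :=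
  mul_nonneg (Real.smoothTransition.nonneg _) (Real.smoothTransition.nonneg _)

lemma cut_le_one (k : ℕ) (t : ℝ) : cut k t ≤ 1 :=
  mul_le_one₀ (Real.smoothTransition.le_one _) (Real.smoothTransition.nonneg _)
    (Real.smoothTransition.le_one _)

lemma abs_cut_le_one (k : ℕ) (t : ℝ) : |cut k t| ≤ 1 := by
  rw [abs_of_nonneg (cut_nonneg k t)]; exact cut_le_one k t

lemma cut_support (k : ℕ) {t : ℝ} (h : cut k t ≠ 0) : 1 ≤ k * t ∧ 1 ≤ k * (1 - t) := by
  constructor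
  · by_contra hlt
    exact h (by rw [cut, Real.smoothTransition.zero_of_nonpos (by linarith), zero_mul])
  · by_contra hlt
    exact h (by rw [cut, Real.smoothTransition.zero_of_nonpos (x := k * (1 - t) - 1)
      (by linarith), mul_zero])

lemma exists_deriv_smoothTransition_bound :
    ∃ M : ℝ, 0 ≤ M ∧ ∀ s, |deriv Real.smoothTransition s| ≤ M ∧
      (1 < s → deriv Real.smoothTransition s = 0) := by
  have hc : Continuous (deriv Real.smoothTransition) :=
    (Real.smoothTransition.contDiff (n := 1)).continuous_deriv le_rfl
  have h1 : ∀ s : ℝ, 1 < s → deriv Real.smoothTransition s = 0 := by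
    intro s hs
    have : Real.smoothTransition =ᶠ[𝓝 s] fun _ => 1 :=
      (eventually_gt_nhds hs).mono fun r hr => Real.smoothTransition.one_of_one_le hr.le
    rw [this.deriv_eq, deriv_const]
  have h0 : ∀ s : ℝ, s < 0 → deriv Real.smoothTransition s = 0 := by
    intro s hs
    have : Real.smoothTransition =ᶠ[𝓝 s] fun _ => 0 :=
      (eventually_lt_nhds hs).mono fun r hr => Real.smoothTransition.zero_of_nonpos hr.le
    rw [this.deriv_eq, deriv_const]
  obtain ⟨M, hM⟩ := (isCompact_Icc (a := (0 : ℝ)) (b := 1)).exists_bound_of_continuousOn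
    hc.continuousOn
  have hM0 : 0 ≤ M := (norm_nonneg _).trans (hM 0 (by simp))
  refine ⟨M, hM0, fun s => ⟨?_, h1 s⟩⟩
  by_cases hs : s ∈ Icc (0 : ℝ) 1
  · exact hM s hs
  · rw [mem_Icc, not_and_or, not_le, not_le] at hs
    rcases hs with hs | hs
    · rw [h0 s hs]; simpa
    · rw [h1 s hs]; simpa

lemma deriv_cut (k : ℕ) (t : ℝ) : deriv (cut k) t =
    k * deriv Real.smoothTransition (k * t - 1) * Real.smoothTransition (k * (1 - t) - 1)
    - Real.smoothTransition (k * t - 1) * (k * deriv Real.smoothTransition (k * (1 - t) - 1)) := by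
  have hS : ∀ s, HasDerivAt Real.smoothTransition (deriv Real.smoothTransition s) s := fun s =>
    ((Real.smoothTransition.contDiff (n := 1)).differentiable (by simp) s).hasDerivAt
  have a1 : HasDerivAt (fun t : ℝ => k * t - 1) (k : ℝ) t := by
    simpa using ((hasDerivAt_id t).const_mul (k : ℝ)).sub_const 1
  have a2 : HasDerivAt (fun t : ℝ => k * (1 - t) - 1) (-(k : ℝ)) t := by
    simpa using (((hasDerivAt_id t).const_sub 1).const_mul (k : ℝ)).sub_const 1
  have := ((hS _).comp t a1).mul ((hS _).comp t a2)
  have h2 : cut k = (Real.smoothTransition ∘ fun t : ℝ => k * t - 1) *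
      (Real.smoothTransition ∘ fun t : ℝ => k * (1 - t) - 1) := by
    funext t; rfl
  rw [h2, this.deriv]
  simp only [Function.comp]
  ring

lemma cut_eventually {t : ℝ} (ht : 0 < t ∧ t < 1) :
    ∀ᶠ k : ℕ in atTop, cut k t = 1 ∧ deriv (cut k) t = 0 := by
  obtain ⟨M, -, hM⟩ := exists_deriv_smoothTransition_bound
  have e1 : ∀ᶠ k : ℕ in atTop, 2 < (k : ℝ) * t :=
    (tendsto_natCast_atTop_atTop.atTop_mul_const ht.1).eventually_gt_atTop 2
  have e2 : ∀ᶠ k : ℕ in atTop, 2 < (k : ℝ) * (1 - t) :=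
    (tendsto_natCast_atTop_atTop.atTop_mul_const (by linarith [ht.2])).eventually_gt_atTop 2
  filter_upwards [e1, e2] with k h1 h2
  constructor
  · rw [cut, Real.smoothTransition.one_of_one_le (by linarith),
      Real.smoothTransition.one_of_one_le (by linarith), mul_one]
  · rw [deriv_cut, (hM _).2 (by linarith), (hM _).2 (by linarith)]; simp

lemma exists_cut_deriv_bound : ∃ M : ℝ, 0 ≤ M ∧ ∀ (k : ℕ) (t a C : ℝ), 0 < t ∧ t < 1 → 0 ≤ C →
    |a| ≤ C * t → |a| ≤ C * (1 - t) → |deriv (cut k) t * a| ≤ C * M := by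
  obtain ⟨M, hM0, hM⟩ := exists_deriv_smoothTransition_bound
  refine ⟨4 * M, by positivity, fun k t a C ht hC h1 h2 => ?_⟩
  have key : ∀ s : ℝ, 0 < s → |a| ≤ C * s →
      k * |deriv Real.smoothTransition (k * s - 1)| * |a| ≤ C * (2 * M) := by
    intro s hs ha
    by_cases hks : 1 < k * s - 1
    · rw [(hM _).2 hks]; simp; positivity
    · push Not at hks
      have : (k * s) * |deriv Real.smoothTransition (k * s - 1)| ≤ 2 * M :=
        mul_le_mul (by linarith) (hM _).1 (abs_nonneg _) (by norm_num)
      calc k * |deriv Real.smoothTransition (k * s - 1)| * |a|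
          ≤ k * |deriv Real.smoothTransition (k * s - 1)| * (C * s) := by gcongr
        _ = C * ((k * s) * |deriv Real.smoothTransition (k * s - 1)|) := by ring
        _ ≤ C * (2 * M) := by gcongr
  have hS : ∀ s, |Real.smoothTransition s| ≤ 1 := fun s => by
    rw [abs_of_nonneg (Real.smoothTransition.nonneg _)]; exact Real.smoothTransition.le_one _
  have k1 := key t ht.1 h1
  have k2 := key (1 - t) (by linarith [ht.2]) h2
  rw [deriv_cut, sub_mul]
  refine (abs_sub _ _).trans ?_
  have b1 : |↑k * deriv Real.smoothTransition (↑k * t - 1) *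
      Real.smoothTransition (↑k * (1 - t) - 1) * a| ≤ C * (2 * M) := by
    refine le_trans ?_ k1
    rw [abs_mul, abs_mul, abs_mul, Nat.abs_cast]
    exact mul_le_mul_of_nonneg_right (mul_le_of_le_one_right (by positivity) (hS _))
      (abs_nonneg _)
  have b2 : |Real.smoothTransition (↑k * t - 1) *
      (↑k * deriv Real.smoothTransition (↑k * (1 - t) - 1)) * a| ≤ C * (2 * M) := by
    refine le_trans ?_ k2
    rw [abs_mul, abs_mul, abs_mul, Nat.abs_cast]
    exact mul_le_mul_of_nonneg_right (mul_le_of_le_one_left (by positivity) (hS _))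
      (abs_nonneg _)
  linarith

lemma tensor_cut_support {d : ℕ} (f : Fin d → ℝ → ℝ) (k : ℕ) (hk : 2 < k) :
    HasCompactSupport (tensor fun i t => cut k t * f i t) ∧
      tsupport (tensor fun i t => cut k t * f i t) ⊆ cell d := by
  have hk0 : (0 : ℝ) < k := by exact_mod_cast (by omega : 0 < k)
  set K : Set (Pt d) := {x | ∀ i, 1 / (k : ℝ) ≤ x i ∧ x i ≤ 1 - 1 / (k : ℝ)} with hK
  have hcl : K = WithLp.toLp 2 '' (Set.univ.pi fun _ : Fin d => Icc (1 / (k : ℝ)) (1 - 1 / k)) := by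
    ext x
    constructor
    · intro hx
      exact ⟨WithLp.ofLp x, fun i _ => hx i, rfl⟩
    · rintro ⟨y, hy, rfl⟩ i
      exact hy i (mem_univ i)
  have hcomp : IsCompact K := by
    rw [hcl]
    exact (isCompact_univ_pi fun _ => isCompact_Icc).image (PiLp.continuous_toLp 2 _)
  have hsupp : Function.support (tensor fun i t => cut k t * f i t) ⊆ K := by
    intro x hx i
    have : cut k (x i) ≠ 0 := by
      intro h0
      exact hx (Finset.prod_eq_zero (Finset.mem_univ i) (by simp [h0]))
    obtain ⟨h1, h2⟩ := cut_support k this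
    refine ⟨?_, ?_⟩
    · rw [div_le_iff₀ hk0]; linarith
    · have : 1 / (k : ℝ) ≤ 1 - x i := by rw [div_le_iff₀ hk0]; linarith
      linarith
  refine ⟨HasCompactSupport.of_support_subset_isCompact hcomp hsupp, ?_⟩
  refine (closure_minimal hsupp hcomp.isClosed).trans fun x hx i => ?_
  have : 0 < 1 / (k : ℝ) := by positivity
  exact ⟨this.trans_le (hx i).1, (hx i).2.trans_lt (by linarith)⟩

lemma abs_tensor_le {d : ℕ} {f : Fin d → ℝ → ℝ} {B : ℝ} {x : Pt d}
    (h : ∀ i, |f i (x i)| ≤ B) : |tensor f x| ≤ B ^ d := by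
  rw [tensor, Finset.abs_prod]
  refine (Finset.prod_le_prod (fun i _ => abs_nonneg _) fun i _ => h i).trans ?_
  simp

lemma integrable_L2 {d : ℕ} {F : Type*} [NormedAddCommGroup F] (u : Lp F 2 (cellMeasure d)) :
    Integrable u (cellMeasure d) := (Lp.memLp u).integrable (by norm_num)

lemma integrable_L2Vec_coord {d : ℕ} (g : L2Vec d) (j : Fin d) :
    Integrable (fun x => g x j) (cellMeasure d) := by
  refine (integrable_L2 g).mono ?_ (Eventually.of_forall fun x => PiLp.norm_apply_le (g x) j)
  exact (EuclideanSpace.proj (𝕜 := ℂ) j).continuous.comp_aestronglyMeasurable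
    (Lp.aestronglyMeasurable g)

lemma tendsto_integral_tensor {d : ℕ} (F : ℕ → Fin d → ℝ → ℝ) (f : Fin d → ℝ → ℝ)
    (hF : ∀ k i, Continuous (F k i)) {B : ℝ}
    (hB : ∀ᶠ k in atTop, ∀ i t, 0 < t ∧ t < 1 → |F k i t| ≤ B)
    (hlim : ∀ i t, 0 < t ∧ t < 1 → ∀ᶠ k in atTop, F k i t = f i t)
    {w : Pt d → ℂ} (hw : Integrable w (cellMeasure d)) :
    Tendsto (fun k => ∫ x, tensor (F k) x • w x ∂(cellMeasure d)) atTop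
      (𝓝 (∫ x, tensor f x • w x ∂(cellMeasure d))) := by
  refine tendsto_integral_filter_of_dominated_convergence (fun x => B ^ d * ‖w x‖) ?_ ?_ ?_ ?_
  · refine Eventually.of_forall fun k =>
      AEStronglyMeasurable.smul (f := tensor (F k)) ?_ hw.aestronglyMeasurable
    refine Continuous.aestronglyMeasurable ?_
    unfold tensor
    exact continuous_finsetProd _ fun i _ => (hF k i).comp (by fun_prop)
  · filter_upwards [hB] with k hk
    refine (ae_restrict_iff' (measurableSet_cell d)).2 (Eventually.of_forall fun x hx => ?_)
    rw [norm_smul]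
    gcongr
    exact abs_tensor_le fun i => hk i _ (hx i)
  · exact hw.norm.const_mul _
  · refine (ae_restrict_iff' (measurableSet_cell d)).2 (Eventually.of_forall fun x hx => ?_)
    refine tendsto_const_nhds.congr' ?_
    filter_upwards [eventually_all.2 fun i => hlim i (x i) (hx i)] with k hk
    simp only [tensor, hk]

lemma IsWeakGradient.apply_tensor {d : ℕ} {u : L2 d} {g : L2Vec d} (h : IsWeakGradient u g)
    {f : Fin d → ℝ → ℝ} (hf : ∀ i, ContDiff ℝ ∞ (f i)) (j : Fin d) {C : ℝ} (hC : 0 ≤ C)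
    (hfj : ∀ t, 0 < t ∧ t < 1 → |f j t| ≤ C * t ∧ |f j t| ≤ C * (1 - t)) :
    ∫ x, tensor (Function.update f j (deriv (f j))) x • u x ∂(cellMeasure d)
      = - ∫ x, tensor f x • g x j ∂(cellMeasure d) := by
  obtain ⟨M, hM0, hM⟩ := exists_cut_deriv_bound
  have hdj : Continuous (deriv (f j)) := (hf j).continuous_deriv (by simp)
  have hbd : ∀ p : ℝ → ℝ, Continuous p → ∃ B : ℝ, ∀ t, 0 < t ∧ t < 1 → |p t| ≤ B := by
    intro p hp
    obtain ⟨B, hB⟩ := (isCompact_Icc (a := (0 : ℝ)) (b := 1)).exists_bound_of_continuousOn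
      hp.continuousOn
    exact ⟨B, fun t ht => hB t ⟨ht.1.le, ht.2.le⟩⟩
  choose B hB using fun i => hbd (f i) (hf i).continuous
  obtain ⟨B', hB'⟩ := hbd _ hdj
  have hB0 : ∀ i, 0 ≤ B i := fun i => (abs_nonneg _).trans (hB i (1 / 2) (by norm_num))
  have hB0' : 0 ≤ B' := (abs_nonneg _).trans (hB' (1 / 2) (by norm_num))
  have hsum : ∀ i, B i ≤ ∑ i, B i := fun i =>
    Finset.single_le_sum (f := B) (fun i _ => hB0 i) (Finset.mem_univ i)
  set F : ℕ → Fin d → ℝ → ℝ := fun k i t => cut k t * f i t with hFdef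
  have hFs : ∀ k i, ContDiff ℝ ∞ (F k i) := fun k i => (contDiff_cut k).mul (hf i)
  have hderiv : ∀ k t, deriv (F k j) t = deriv (cut k) t * f j t + cut k t * deriv (f j) t := by
    intro k t
    exact (((contDiff_cut k).differentiable (by simp) t).hasDerivAt.mul
      ((hf j).differentiable (by simp) t).hasDerivAt).deriv
  have hFb : ∀ k i t, 0 < t ∧ t < 1 → |F k i t| ≤ ∑ i, B i := by
    intro k i t ht
    simp only [hFdef, abs_mul]
    calc |cut k t| * |f i t| ≤ 1 * B i :=
          mul_le_mul (abs_cut_le_one k t) (hB i t ht) (abs_nonneg _) zero_le_one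
      _ ≤ _ := by rw [one_mul]; exact hsum i
  have lim1 : Tendsto (fun k => ∫ x, tensor (F k) x • g x j ∂(cellMeasure d)) atTop
      (𝓝 (∫ x, tensor f x • g x j ∂(cellMeasure d))) := by
    refine tendsto_integral_tensor F f (fun k i => (hFs k i).continuous) (B := ∑ i, B i)
      (Eventually.of_forall fun k i t ht => hFb k i t ht) ?_ (integrable_L2Vec_coord g j)
    intro i t ht
    filter_upwards [cut_eventually ht] with k hk
    simp [hFdef, hk.1]
  have lim2 : Tendsto (fun k => ∫ x, tensor
        (Function.update (F k) j (deriv (F k j))) x • u x ∂(cellMeasure d)) atTop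
      (𝓝 (∫ x, tensor (Function.update f j (deriv (f j))) x • u x
        ∂(cellMeasure d))) := by
    refine tendsto_integral_tensor _ _ ?_ (B := ∑ i, B i + (C * M + B')) ?_ ?_ (integrable_L2 u)
    · intro k i
      by_cases hij : i = j
      · subst hij; simpa using (hFs k i).continuous_deriv (by simp)
      · simpa [hij] using (hFs k i).continuous
    · refine Eventually.of_forall fun k i t ht => ?_
      have hS : 0 ≤ ∑ i, B i := Finset.sum_nonneg fun i _ => hB0 i
      by_cases hij : i = j
      · subst hij
        simp only [Function.update_self, hderiv]
        refine (abs_add_le _ _).trans ?_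
        have b1 := hM k t (f i t) C ht hC (hfj t ht).1 (hfj t ht).2
        have b2 : |cut k t * deriv (f i) t| ≤ B' := by
          rw [abs_mul]
          calc |cut k t| * |deriv (f i) t| ≤ 1 * B' :=
                mul_le_mul (abs_cut_le_one k t) (hB' t ht) (abs_nonneg _) zero_le_one
            _ = B' := one_mul _
        linarith
      · simp only [Function.update_of_ne hij]
        have := hFb k i t ht
        have : 0 ≤ C * M := by positivity
        linarith
    · intro i t ht
      filter_upwards [cut_eventually ht] with k hk
      by_cases hij : i = j
      · subst hij; simp [hderiv, hk.1, hk.2]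
      · simp [hij, hFdef, hk.1]
  refine tendsto_nhds_unique (lim2.congr' ?_) lim1.neg
  filter_upwards [eventually_gt_atTop 2] with k hk
  have := h (tensor (F k)) (contDiff_tensor (hFs k))
    (tensor_cut_support f k hk).1 (tensor_cut_support f k hk).2 j
  rw [← this]
  refine integral_congr_ae (Eventually.of_forall fun x => ?_)
  simp only [fderiv_tensor (hFs k)]


/-! ### The cosine basis of `L²(Y)` and the Poincaré inequality -/

lemma memLp_tensor {d : ℕ} {f : Fin d → ℝ → ℝ} (hf : ∀ i, Continuous (f i)) :
    MemLp (fun x => (tensor f x : ℂ)) 2 (cellMeasure d) := by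
  have hbd : ∀ i, ∃ B : ℝ, ∀ t ∈ Icc (0 : ℝ) 1, ‖f i t‖ ≤ B := fun i =>
    (isCompact_Icc (a := (0 : ℝ)) (b := 1)).exists_bound_of_continuousOn (hf i).continuousOn
  choose B hB using hbd
  have hB0 : ∀ i, 0 ≤ B i := fun i => (norm_nonneg _).trans (hB i 0 (by simp))
  have hc : Continuous (tensor f) := by
    unfold tensor
    exact continuous_finsetProd _ fun i _ => (hf i).comp (by fun_prop)
  refine memLp_of_bdd (Complex.continuous_ofReal.comp hc) (C := (∑ i, B i) ^ d) fun x hx => ?_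
  rw [Complex.norm_real]
  refine abs_tensor_le fun i => (hB i (x i) ⟨(hx i).1.le, (hx i).2.le⟩).trans ?_
  exact Finset.single_le_sum (f := B) (fun i _ => hB0 i) (Finset.mem_univ i)

lemma integral_tensor_mul {d : ℕ} (f h : Fin d → ℝ → ℝ) :
    ∫ x, ((tensor f x : ℂ) * (tensor h x : ℂ)) ∂(cellMeasure d)
      = ((∏ i, ∫ t in (0 : ℝ)..1, f i t * h i t : ℝ) : ℂ) := by
  have := integral_cell_prod d (fun i t => ((f i t * h i t : ℝ) : ℂ))
  simp_rw [intervalIntegral.integral_ofReal] at this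
  rw [Complex.ofReal_prod, ← this]
  refine integral_congr_ae (Eventually.of_forall fun x => ?_)
  simp only [tensor]
  push_cast
  rw [Finset.prod_mul_distrib]

/-- Normalised products of cosines. -/
def cosFam {d : ℕ} (n : Fin d → ℕ) : Fin d → ℝ → ℝ := fun i => cosN (n i)

/-- Normalised products of cosines with a sine in direction `j`. -/
def sinFam {d : ℕ} (j : Fin d) (n : Fin d → ℕ) : Fin d → ℝ → ℝ :=
  Function.update (cosFam n) j (sinN (n j))

lemma contDiff_cosFam {d : ℕ} (n : Fin d → ℕ) (i : Fin d) : ContDiff ℝ ∞ (cosFam n i) :=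
  contDiff_cosN _

lemma contDiff_sinFam {d : ℕ} (j : Fin d) (n : Fin d → ℕ) (i : Fin d) :
    ContDiff ℝ ∞ (sinFam j n i) := by
  unfold sinFam
  by_cases h : i = j
  · subst h; simpa using contDiff_sinN _
  · simpa [h] using contDiff_cosFam n i

/-- The cosine products as elements of `L²(Y)`. -/
def cosL2 {d : ℕ} (n : Fin d → ℕ) : L2 d :=
  (memLp_tensor fun i => (contDiff_cosFam n i).continuous).toLp _

lemma inner_cosL2 {d : ℕ} (n : Fin d → ℕ) (u : L2 d) :
    ⟪cosL2 n, u⟫_ℂ = ∫ x, tensor (cosFam n) x • u x ∂(cellMeasure d) := by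
  rw [L2.inner_def]
  refine integral_congr_ae ?_
  filter_upwards [(memLp_tensor fun i => (contDiff_cosFam n i).continuous).coeFn_toLp] with x hx
  rw [cosL2, hx]
  simp [mul_comm]

lemma orthonormal_cosL2 (d : ℕ) : Orthonormal ℂ (cosL2 (d := d)) := by
  rw [orthonormal_iff_ite]
  intro n m
  have h : ⟪cosL2 n, cosL2 m⟫_ℂ
      = ∫ x, ((tensor (cosFam n) x : ℂ) * (tensor (cosFam m) x : ℂ)) ∂(cellMeasure d) := by
    rw [inner_cosL2]
    refine integral_congr_ae ?_
    filter_upwards [(memLp_tensor fun i => (contDiff_cosFam m i).continuous).coeFn_toLp] with x hx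
    rw [cosL2, hx]
    simp
  rw [h, integral_tensor_mul]
  simp only [cosFam, integral_cosN]
  by_cases hnm : n = m
  · subst hnm; simp
  · obtain ⟨i, hi⟩ := Function.ne_iff.1 hnm
    rw [if_neg hnm, Finset.prod_eq_zero (Finset.mem_univ i) (by simp [hi])]
    simp

/-- The field with only the `j`-th component non-zero, given by a sine-cosine product. -/
def sinField {d : ℕ} (j : Fin d) (n : Fin d → ℕ) (x : Pt d) : EuclideanSpace ℂ (Fin d) :=
  EuclideanSpace.single j (tensor (sinFam j n) x : ℂ)

lemma memLp_sinField {d : ℕ} (j : Fin d) (n : Fin d → ℕ) :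
    MemLp (sinField j n) 2 (cellMeasure d) := by
  have h := memLp_tensor fun i => (contDiff_sinFam j n i).continuous
  refine h.of_le ?_ (Eventually.of_forall fun x => by simp [sinField])
  refine Continuous.aestronglyMeasurable ?_
  have hc : Continuous (tensor (sinFam j n)) := (contDiff_tensor (contDiff_sinFam j n)).continuous
  have he : sinField j n = fun x => (tensor (sinFam j n) x : ℂ) • EuclideanSpace.single j (1 : ℂ) := by
    funext x; ext i; simp [sinField]
  rw [he]
  fun_prop

/-- The sine-cosine fields as elements of `L²(Y)^d`. -/
def sinL2 {d : ℕ} (j : Fin d) (n : Fin d → ℕ) : L2Vec d := (memLp_sinField j n).toLp _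

lemma inner_sinL2 {d : ℕ} (j : Fin d) (n : Fin d → ℕ) (g : L2Vec d) :
    ⟪sinL2 j n, g⟫_ℂ = ∫ x, tensor (sinFam j n) x • g x j ∂(cellMeasure d) := by
  rw [L2.inner_def]
  refine integral_congr_ae ?_
  filter_upwards [(memLp_sinField j n).coeFn_toLp] with x hx
  rw [sinL2, hx, sinField, EuclideanSpace.inner_single_left]
  simp

lemma inner_sinL2_sinL2 {d : ℕ} (j l : Fin d) (n m : Fin d → ℕ) (hj : n j ≠ 0) :
    ⟪sinL2 j n, sinL2 l m⟫_ℂ = if j = l ∧ n = m then 1 else 0 := by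
  have h : ⟪sinL2 j n, sinL2 l m⟫_ℂ = ∫ x, (tensor (sinFam j n) x : ℂ) *
      (if j = l then (tensor (sinFam l m) x : ℂ) else 0) ∂(cellMeasure d) := by
    rw [inner_sinL2]
    refine integral_congr_ae ?_
    filter_upwards [(memLp_sinField l m).coeFn_toLp] with x hx
    rw [sinL2, hx, sinField]
    simp
  rw [h]
  by_cases hjl : j = l
  · subst hjl
    simp only [if_true, true_and]
    rw [integral_tensor_mul]
    have hi : ∀ i, ∫ t in (0 : ℝ)..1, sinFam j n i t * sinFam j m i t
        = if n i = m i then 1 else 0 := by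
      intro i
      by_cases hij : i = j
      · subst hij; simp [sinFam, integral_sinN _ _ hj]
      · simp [sinFam, hij, cosFam, integral_cosN]
    simp only [hi]
    by_cases hnm : n = m
    · subst hnm; simp
    · obtain ⟨i, hi⟩ := Function.ne_iff.1 hnm
      rw [if_neg hnm, Finset.prod_eq_zero (Finset.mem_univ i) (by simp [hi])]
      simp
  · simp [hjl]

/-- Integration by parts against the cosine basis. -/
lemma IsWeakGradient.inner_cos {d : ℕ} {u : L2 d} {g : L2Vec d} (h : IsWeakGradient u g)
    (j : Fin d) (n : Fin d → ℕ) :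
    (n j * Real.pi : ℂ) * ⟪cosL2 n, u⟫_ℂ = - ⟪sinL2 j n, g⟫_ℂ := by
  have key := h.apply_tensor (contDiff_sinFam j n) j (C := √2 * (n j * Real.pi)) (by positivity)
    (by intro t ht; simpa [sinFam] using abs_sinN_le (n j) ht)
  rw [inner_sinL2, ← key, inner_cosL2, ← integral_const_mul]
  refine integral_congr_ae (Eventually.of_forall fun x => ?_)
  have : tensor (Function.update (sinFam j n) j (deriv (sinFam j n j))) x
      = (n j * Real.pi) * tensor (cosFam n) x := by
    rw [tensor, ← Finset.mul_prod_erase _ _ (Finset.mem_univ j), tensor,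
      ← Finset.mul_prod_erase _ _ (Finset.mem_univ j), ← mul_assoc]
    congr 1
    · simp [sinFam, deriv_sinN, cosFam]
    · refine Finset.prod_congr rfl fun i hi => ?_
      simp [Finset.ne_of_mem_erase hi, sinFam]
  simp only [this]
  simp [mul_assoc]

/-- Unnormalised products of cosines, as continuous functions. -/
def cosC {d : ℕ} (n : Fin d → ℕ) : C(Pt d, ℝ) where
  toFun x := ∏ i, Real.cos (n i * Real.pi * x i)
  continuous_toFun := by fun_prop

/-- The algebra spanned by the products of cosines. -/
def cosAlg (d : ℕ) : Subalgebra ℝ C(Pt d, ℝ) :=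
  (Submodule.span ℝ (range (cosC (d := d)))).toSubalgebra
    (by
      refine Submodule.subset_span ⟨0, ?_⟩
      ext x; simp [cosC])
    (by
      intro a b ha hb
      have hab := Submodule.mul_mem_mul ha hb
      rw [Submodule.span_mul_span] at hab
      refine Submodule.span_le.2 ?_ hab
      rintro _ ⟨_, ⟨n, rfl⟩, _, ⟨m, rfl⟩, rfl⟩
      have : cosC n * cosC m = ∑ s ∈ (Finset.univ : Finset (Fin d)).powerset,
          (1 / 2 : ℝ) ^ d • cosC (fun i => if i ∈ s then n i + m i else (n i - m i) + (m i - n i)) := by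
        ext x
        simp only [ContinuousMap.mul_apply, ContinuousMap.coe_sum, Finset.sum_apply,
          ContinuousMap.coe_smul, Pi.smul_apply, smul_eq_mul, ← Finset.mul_sum]
        have h1 : ∀ i, Real.cos (n i * Real.pi * x i) * Real.cos (m i * Real.pi * x i)
            = (1 / 2) * (Real.cos ((n i + m i : ℕ) * Real.pi * x i)
              + Real.cos ((n i - m i + (m i - n i) : ℕ) * Real.pi * x i)) := by
          intro i
          have h2 : Real.cos ((n i - m i + (m i - n i) : ℕ) * Real.pi * x i)
              = Real.cos (n i * Real.pi * x i - m i * Real.pi * x i) := by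
            rcases le_total (n i) (m i) with hle | hle
            · rw [Nat.sub_eq_zero_of_le hle, zero_add, Nat.cast_sub hle, ← Real.cos_neg]
              congr 1; ring
            · rw [Nat.sub_eq_zero_of_le hle, add_zero, Nat.cast_sub hle]
              congr 1; ring
          have h3 : ((n i + m i : ℕ) * Real.pi * x i : ℝ)
              = n i * Real.pi * x i + m i * Real.pi * x i := by push_cast; ring
          rw [h2, h3, Real.cos_sub, Real.cos_add]; ring
        simp only [cosC, ContinuousMap.coe_mk]
        rw [← Finset.prod_mul_distrib]
        simp only [h1]
        rw [Finset.prod_mul_distrib, Finset.prod_add]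
        congr 1
        · simp
        · refine Finset.sum_congr rfl fun s _ => ?_
          rw [← Finset.prod_mul_prod_compl s (fun i => Real.cos
            ((if i ∈ s then n i + m i else (n i - m i) + (m i - n i) : ℕ) * Real.pi * x i))]
          rw [← Finset.compl_eq_univ_sdiff]
          congr 1
          · exact Finset.prod_congr rfl fun i hi => by rw [if_pos hi]
          · exact Finset.prod_congr rfl fun i hi => by rw [if_neg (Finset.mem_compl.1 hi)]
      change cosC n * cosC m ∈ _
      rw [this]
      exact Submodule.sum_mem _ fun s _ => Submodule.smul_mem _ _ (Submodule.subset_span ⟨_, rfl⟩))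

lemma cosAlg_separatesPoints (d : ℕ) {x y : Pt d} (hx : ∀ i, x i ∈ Icc (0 : ℝ) 1)
    (hy : ∀ i, y i ∈ Icc (0 : ℝ) 1) (hxy : x ≠ y) : ∃ f ∈ cosAlg d, f x ≠ f y := by
  have : ∃ i, x i ≠ y i := by
    by_contra h
    push Not at h
    exact hxy (by ext i; exact h i)
  obtain ⟨i, hi⟩ := this
  refine ⟨cosC (Pi.single i 1), Submodule.subset_span ⟨_, rfl⟩, ?_⟩
  have h : ∀ z : Pt d, cosC (Pi.single i 1) z = Real.cos (Real.pi * z i) := by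
    intro z
    simp only [cosC, ContinuousMap.coe_mk]
    rw [Finset.prod_eq_single i]
    · simp
    · intro b _ hb; simp [hb]
    · simp
  rw [h, h]
  intro hc
  have hpi := Real.pi_pos
  have := Real.injOn_cos ⟨by nlinarith [(hx i).1], by nlinarith [(hx i).2]⟩
    ⟨by nlinarith [(hy i).1], by nlinarith [(hy i).2]⟩ hc
  exact hi (mul_left_cancel₀ hpi.ne' this)

lemma exists_cosAlg_near (d : ℕ) (φ : C(Pt d, ℝ)) {ε : ℝ} (hε : 0 < ε) :
    ∃ f ∈ cosAlg d, ∀ x ∈ cell d, |f x - φ x| < ε := by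
  set K : Set (Pt d) := {x | ∀ i, x i ∈ Icc (0 : ℝ) 1} with hK
  have hcl : K = WithLp.toLp 2 '' (Set.univ.pi fun _ : Fin d => Icc (0 : ℝ) 1) := by
    ext x
    constructor
    · intro hx
      exact ⟨WithLp.ofLp x, fun i _ => hx i, rfl⟩
    · rintro ⟨y, hy, rfl⟩ i
      exact hy i (mem_univ i)
  have hcomp : IsCompact K := by
    rw [hcl]
    exact (isCompact_univ_pi fun _ => isCompact_Icc).image (PiLp.continuous_toLp 2 _)
  have : CompactSpace K := isCompact_iff_compactSpace.1 hcomp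
  let ρ : C(Pt d, ℝ) →ₐ[ℝ] C(K, ℝ) :=
    ContinuousMap.compRightAlgHom ℝ ℝ ⟨Subtype.val, continuous_subtype_val⟩
  have hsep : ((cosAlg d).map ρ).SeparatesPoints := by
    intro x y hxy
    obtain ⟨f, hf, hne⟩ := cosAlg_separatesPoints d x.2 y.2 (Subtype.coe_ne_coe.2 hxy)
    exact ⟨ρ f, ⟨ρ f, ⟨f, hf, rfl⟩, rfl⟩, hne⟩
  obtain ⟨⟨g, hg⟩, hnear⟩ := ContinuousMap.exists_mem_subalgebra_near_continuousMap_of_separatesPoints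
    _ hsep (ρ φ) ε hε
  obtain ⟨f, hf, rfl⟩ := hg
  refine ⟨f, hf, fun x hx => ?_⟩
  have hxK : x ∈ K := fun i => ⟨(hx i).1.le, (hx i).2.le⟩
  exact lt_of_le_of_lt ((ρ f - ρ φ).norm_coe_le_norm ⟨x, hxK⟩) hnear

lemma cos_complete (d : ℕ) : (Submodule.span ℂ (range (cosL2 (d := d))))ᗮ = ⊥ := by
  rw [eq_bot_iff]
  intro w hw
  rw [Submodule.mem_orthogonal] at hw
  have h0 : ∀ n : Fin d → ℕ, ∫ x, cosC n x • w x ∂(cellMeasure d) = 0 := by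
    intro n
    have h1 := hw (cosL2 n) (Submodule.subset_span ⟨n, rfl⟩)
    rw [inner_cosL2] at h1
    have h2 : ∀ x, tensor (cosFam n) x • w x
        = ((∏ i, (if n i = 0 then 1 else √2) : ℝ) : ℂ) * (cosC n x • w x) := by
      intro x
      simp only [tensor, cosFam, cosN, cosC, ContinuousMap.coe_mk, Finset.prod_mul_distrib]
      simp [mul_assoc]
    simp_rw [h2] at h1
    rw [integral_const_mul] at h1
    refine (mul_eq_zero.1 h1).resolve_left ?_
    refine Complex.ofReal_ne_zero.2 ?_
    exact Finset.prod_ne_zero_iff.2 fun i _ => by split_ifs <;> simp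
  have hint : ∀ f : C(Pt d, ℝ), (∃ C, ∀ x ∈ cell d, |f x| ≤ C) →
      Integrable (fun x => f x • w x) (cellMeasure d) := by
    rintro f ⟨C, hC⟩
    refine (integrable_L2 w).bdd_smul C (f.continuous.aestronglyMeasurable) ?_
    exact (ae_restrict_iff' (measurableSet_cell d)).2 (Eventually.of_forall hC)
  have hbd : ∀ f : C(Pt d, ℝ), ∃ C, ∀ x ∈ cell d, |f x| ≤ C := by
    intro f
    have hcomp : IsCompact (WithLp.toLp 2 '' (Set.univ.pi fun _ : Fin d => Icc (0 : ℝ) 1)) :=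
      (isCompact_univ_pi fun _ => isCompact_Icc).image (PiLp.continuous_toLp 2 _)
    obtain ⟨C, hC⟩ := hcomp.exists_bound_of_continuousOn f.continuous.continuousOn
    exact ⟨C, fun x hx => hC x ⟨WithLp.ofLp x, fun i _ => ⟨(hx i).1.le, (hx i).2.le⟩, rfl⟩⟩
  have h1 : ∀ f ∈ cosAlg d, ∫ x, f x • w x ∂(cellMeasure d) = 0 := by
    intro f hf
    refine Submodule.span_induction (p := fun f _ => ∫ x, f x • w x ∂(cellMeasure d) = 0)
      ?_ ?_ ?_ ?_ hf
    · rintro _ ⟨n, rfl⟩; exact h0 n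
    · simp
    · intro a b _ _ ha hb
      simp only [ContinuousMap.add_apply, add_smul]
      rw [integral_add (hint a (hbd a)) (hint b (hbd b)), ha, hb, add_zero]
    · intro c a _ ha
      simp only [ContinuousMap.smul_apply, smul_assoc]
      rw [integral_smul, ha, smul_zero]
  have h2 : ∀ φ : C(Pt d, ℝ), ∫ x, φ x • w x ∂(cellMeasure d) = 0 := by
    intro φ
    have hW : 0 ≤ ∫ x, ‖w x‖ ∂(cellMeasure d) := integral_nonneg fun _ => norm_nonneg _
    refine norm_le_zero_iff.1 (le_of_forall_pos_le_add fun ε hε => ?_)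
    obtain ⟨f, hf, hnear⟩ := exists_cosAlg_near d φ
      (ε := ε / (∫ x, ‖w x‖ ∂(cellMeasure d) + 1)) (by positivity)
    have e : ∫ x, φ x • w x ∂(cellMeasure d) = ∫ x, (φ x • w x - f x • w x) ∂(cellMeasure d) := by
      rw [integral_sub (hint φ (hbd φ)) (hint f (hbd f)), h1 f hf, sub_zero]
    rw [e, zero_add]
    calc ‖∫ x, (φ x • w x - f x • w x) ∂(cellMeasure d)‖
        ≤ ∫ x, (ε / (∫ x, ‖w x‖ ∂(cellMeasure d) + 1)) * ‖w x‖ ∂(cellMeasure d) := by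
          refine norm_integral_le_of_norm_le ((integrable_L2 w).norm.const_mul _) ?_
          refine (ae_restrict_iff' (measurableSet_cell d)).2 (Eventually.of_forall fun x hx => ?_)
          rw [← sub_smul, norm_smul]
          gcongr
          rw [Real.norm_eq_abs, abs_sub_comm]
          exact (hnear x hx).le
      _ = ε * ((∫ x, ‖w x‖ ∂(cellMeasure d)) / (∫ x, ‖w x‖ ∂(cellMeasure d) + 1)) := by
          rw [integral_const_mul]; ring
      _ ≤ ε := by
          refine mul_le_of_le_one_right hε.le ?_
          rw [div_le_one (by positivity)]; linarith
  have h3 : ∀ᵐ x ∂(cellMeasure d), x ∈ (univ : Set (Pt d)) → w x = 0 := by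
    refine isOpen_univ.ae_eq_zero_of_integral_contDiff_smul_eq_zero
      ((integrable_L2 w).locallyIntegrable.locallyIntegrableOn _) ?_
    intro g hg _ _
    exact h2 ⟨g, hg.continuous⟩
  rw [Submodule.mem_bot, Lp.eq_zero_iff_ae_eq_zero]
  filter_upwards [h3] with x hx using hx (mem_univ x)

/-- The cosine Hilbert basis of `L²(Y)`. -/
def cosBasis (d : ℕ) : HilbertBasis (Fin d → ℕ) ℂ (L2 d) :=
  HilbertBasis.mkOfOrthogonalEqBot (orthonormal_cosL2 d) (cos_complete d)

/-- Poincaré's inequality on the unit cell, for functions of mean zero. -/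
theorem poincare {d : ℕ} {u : L2 d} {g : L2Vec d} (h : IsWeakGradient u g)
    (hu : ∫ x, u x ∂(cellMeasure d) = 0) : ‖u‖ ≤ Real.pi⁻¹ * ‖g‖ := by
  have hpi := Real.pi_pos
  have hzero : ⟪cosL2 (0 : Fin d → ℕ), u⟫_ℂ = 0 := by
    rw [inner_cosL2]
    simpa [tensor, cosFam, cosN] using hu
  have hex : ∀ n : {n : Fin d → ℕ // n ≠ 0}, ∃ j, n.1 j ≠ 0 := fun n => Function.ne_iff.1 n.2
  choose J hJ using hex
  have horth : Orthonormal ℂ fun n : {n : Fin d → ℕ // n ≠ 0} => sinL2 (J n) n.1 := by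
    rw [orthonormal_iff_ite]
    intro n m
    rw [inner_sinL2_sinL2 _ _ _ _ (hJ n)]
    by_cases hnm : n = m
    · subst hnm; simp
    · rw [if_neg hnm, if_neg]
      exact fun hh => hnm (Subtype.ext hh.2)
  have hterm : ∀ n : {n : Fin d → ℕ // n ≠ 0},
      ‖⟪cosL2 n.1, u⟫_ℂ‖ ^ 2 ≤ (Real.pi⁻¹) ^ 2 * ‖⟪sinL2 (J n) n.1, g⟫_ℂ‖ ^ 2 := by
    intro n
    have e := congrArg norm (h.inner_cos (J n) n.1)
    rw [norm_neg, norm_mul, norm_mul, Complex.norm_natCast, Complex.norm_real, Real.norm_eq_abs,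
      abs_of_pos hpi] at e
    rw [← e, ← mul_pow]
    have h1 : (1 : ℝ) ≤ n.1 (J n) := by exact_mod_cast Nat.one_le_iff_ne_zero.2 (hJ n)
    have h2 : Real.pi⁻¹ * (n.1 (J n) * Real.pi * ‖⟪cosL2 n.1, u⟫_ℂ‖)
        = n.1 (J n) * ‖⟪cosL2 n.1, u⟫_ℂ‖ := by field_simp
    rw [h2]
    gcongr
    exact le_mul_of_one_le_left (norm_nonneg _) h1
  have hs := (cosBasis d).hasSum_inner_mul_inner u u
  have hb : ⇑(cosBasis d) = cosL2 := HilbertBasis.coe_mkOfOrthogonalEqBot _ _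
  have hs' : HasSum (fun n : Fin d → ℕ => ‖⟪cosL2 n, u⟫_ℂ‖ ^ 2) (‖u‖ ^ 2) := by
    rw [← Complex.hasSum_ofReal]
    have e2 : ⟪u, u⟫_ℂ = ((‖u‖ ^ 2 : ℝ) : ℂ) := by
      rw [inner_self_eq_norm_sq_to_K]; norm_cast
    rw [← e2]
    have e3 : (fun n : Fin d → ℕ => ((‖⟪cosL2 n, u⟫_ℂ‖ ^ 2 : ℝ) : ℂ))
        = fun n => ⟪u, cosBasis d n⟫_ℂ * ⟪cosBasis d n, u⟫_ℂ := by
      funext n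
      rw [hb, ← inner_conj_symm u (cosL2 n), Complex.conj_mul']
      norm_cast
    rw [e3]
    exact hs
  have hle : ‖u‖ ^ 2 ≤ (Real.pi⁻¹ * ‖g‖) ^ 2 := by
    refine hasSum_le_of_sum_le hs' fun s => ?_
    have h1 : ∑ n ∈ s, ‖⟪cosL2 n, u⟫_ℂ‖ ^ 2
        = ∑ n ∈ s.subtype (fun n => n ≠ 0), ‖⟪cosL2 n.1, u⟫_ℂ‖ ^ 2 := by
      rw [Finset.sum_subtype_eq_sum_filter (s := s) (p := fun n => n ≠ 0)
        (f := fun n => ‖⟪cosL2 n, u⟫_ℂ‖ ^ 2), Finset.sum_filter]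
      refine Finset.sum_congr rfl fun n _ => ?_
      by_cases hn : n = 0
      · subst hn; simp [hzero]
      · simp [hn]
    rw [h1, mul_pow]
    calc ∑ n ∈ s.subtype (fun n => n ≠ 0), ‖⟪cosL2 n.1, u⟫_ℂ‖ ^ 2
        ≤ ∑ n ∈ s.subtype (fun n => n ≠ 0), (Real.pi⁻¹) ^ 2 * ‖⟪sinL2 (J n) n.1, g⟫_ℂ‖ ^ 2 :=
          Finset.sum_le_sum fun n _ => hterm n
      _ = (Real.pi⁻¹) ^ 2 * ∑ n ∈ s.subtype (fun n => n ≠ 0), ‖⟪sinL2 (J n) n.1, g⟫_ℂ‖ ^ 2 := by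
          rw [Finset.mul_sum]
      _ ≤ (Real.pi⁻¹) ^ 2 * ‖g‖ ^ 2 := by
          gcongr
          exact horth.sum_inner_products_le g
  exact le_of_sq_le_sq hle (by positivity)


/-! ### The spaces `L²₀(Y)` and `𝓗` -/

/-- `L²₀(Y)`: square integrable functions of mean zero. -/
def meanZero (d : ℕ) : Submodule ℂ (L2 d) where
  carrier := {u | ∫ x, u x ∂(cellMeasure d) = 0}
  zero_mem' := by
    rw [mem_ofPred_eq, integral_congr_ae (Lp.coeFn_zero ℂ 2 (cellMeasure d))]
    simp
  add_mem' := by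
    intro u v hu hv
    rw [mem_ofPred_eq] at *
    rw [integral_congr_ae (Lp.coeFn_add u v)]
    simp only [Pi.add_apply]
    rw [integral_add (integrable_L2 u) (integrable_L2 v), hu, hv, add_zero]
  smul_mem' := by
    intro c u hu
    rw [mem_ofPred_eq] at *
    rw [integral_congr_ae (Lp.coeFn_smul c u)]
    simp only [Pi.smul_apply]
    rw [integral_smul, hu, smul_zero]

lemma mem_meanZero {d : ℕ} {u : L2 d} : u ∈ meanZero d ↔ ∫ x, u x ∂(cellMeasure d) = 0 := Iff.rfl

lemma isClosed_meanZero (d : ℕ) : IsClosed (meanZero d : Set (L2 d)) := by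
  have h : (meanZero d : Set (L2 d)) = {u | ⟪cosL2 (0 : Fin d → ℕ), u⟫_ℂ = 0} := by
    ext u
    rw [SetLike.mem_coe, mem_meanZero, mem_ofPred_eq, inner_cosL2]
    simp [tensor, cosFam, cosN]
  rw [h]
  exact isClosed_eq (by fun_prop) continuous_const

/-- The Hilbert space `L²₀(Y)`. -/
abbrev L20 (d : ℕ) : Type := meanZero d

instance (d : ℕ) : CompleteSpace (L20 d) := (isClosed_meanZero d).completeSpace_coe

lemma integrable_smul_of_test {d : ℕ} {F : Type*} [NormedAddCommGroup F] [NormedSpace ℝ F]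
    {φ : Pt d → ℝ} (hc : Continuous φ) (hs : HasCompactSupport φ) {w : Pt d → F}
    (hw : Integrable w (cellMeasure d)) : Integrable (fun x => φ x • w x) (cellMeasure d) := by
  obtain ⟨C, hC⟩ := hs.exists_bound_of_continuous hc
  exact hw.bdd_smul C hc.aestronglyMeasurable (Eventually.of_forall hC)

lemma continuous_fderiv_apply {d : ℕ} {φ : Pt d → ℝ} (hφ : ContDiff ℝ ∞ φ) (v : Pt d) :
    Continuous fun x => fderiv ℝ φ x v := (hφ.continuous_fderiv (by simp)).clm_apply continuous_const

lemma IsWeakGradient.add {d : ℕ} {u v : L2 d} {g h : L2Vec d} (hu : IsWeakGradient u g)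
    (hv : IsWeakGradient v h) : IsWeakGradient (u + v : L2 d) (g + h : L2Vec d) := by
  intro φ h1 h2 h3 j
  have hd := continuous_fderiv_apply h1 (EuclideanSpace.single j (1 : ℝ))
  have hds : HasCompactSupport fun x => fderiv ℝ φ x (EuclideanSpace.single j (1 : ℝ)) :=
    h2.fderiv_apply (𝕜 := ℝ) _
  have e1 : ∫ x, (fderiv ℝ φ x (EuclideanSpace.single j 1)) • (u + v : L2 d) x ∂(cellMeasure d)
      = ∫ x, ((fderiv ℝ φ x (EuclideanSpace.single j 1)) • u x
        + (fderiv ℝ φ x (EuclideanSpace.single j 1)) • v x) ∂(cellMeasure d) := by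
    refine integral_congr_ae ?_
    filter_upwards [Lp.coeFn_add u v] with x hx
    rw [hx, Pi.add_apply, smul_add]
  have e2 : ∫ x, φ x • (g + h : L2Vec d) x j ∂(cellMeasure d)
      = ∫ x, (φ x • g x j + φ x • h x j) ∂(cellMeasure d) := by
    refine integral_congr_ae ?_
    filter_upwards [Lp.coeFn_add g h] with x hx
    rw [hx, Pi.add_apply, PiLp.add_apply, smul_add]
  rw [e1, e2, integral_add (integrable_smul_of_test hd hds (integrable_L2 u))
    (integrable_smul_of_test hd hds (integrable_L2 v)),
    integral_add (integrable_smul_of_test h1.continuous h2 (integrable_L2Vec_coord g j))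
    (integrable_smul_of_test h1.continuous h2 (integrable_L2Vec_coord h j)),
    hu φ h1 h2 h3 j, hv φ h1 h2 h3 j, neg_add]

lemma IsWeakGradient.smul {d : ℕ} {u : L2 d} {g : L2Vec d} (hu : IsWeakGradient u g) (c : ℂ) :
    IsWeakGradient (c • u : L2 d) (c • g : L2Vec d) := by
  intro φ h1 h2 h3 j
  have e1 : ∫ x, (fderiv ℝ φ x (EuclideanSpace.single j 1)) • (c • u : L2 d) x ∂(cellMeasure d)
      = ∫ x, c • ((fderiv ℝ φ x (EuclideanSpace.single j 1)) • u x) ∂(cellMeasure d) := by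
    refine integral_congr_ae ?_
    filter_upwards [Lp.coeFn_smul c u] with x hx
    rw [hx, Pi.smul_apply, smul_comm]
  have e2 : ∫ x, φ x • (c • g : L2Vec d) x j ∂(cellMeasure d)
      = ∫ x, c • (φ x • g x j) ∂(cellMeasure d) := by
    refine integral_congr_ae ?_
    filter_upwards [Lp.coeFn_smul c g] with x hx
    rw [hx, Pi.smul_apply, PiLp.smul_apply, smul_comm]
  rw [e1, e2, integral_smul, integral_smul, hu φ h1 h2 h3 j, smul_neg]

lemma isWeakGradient_zero (d : ℕ) : IsWeakGradient (0 : L2 d) (0 : L2Vec d) := by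
  intro φ h1 h2 h3 j
  have e1 : ∫ x, (fderiv ℝ φ x (EuclideanSpace.single j 1)) • (0 : L2 d) x ∂(cellMeasure d) = 0 := by
    refine integral_eq_zero_of_ae ?_
    filter_upwards [Lp.coeFn_zero ℂ 2 (cellMeasure d)] with x hx
    rw [hx]; simp
  have e2 : ∫ x, φ x • (0 : L2Vec d) x j ∂(cellMeasure d) = 0 := by
    refine integral_eq_zero_of_ae ?_
    filter_upwards [Lp.coeFn_zero (EuclideanSpace ℂ (Fin d)) 2 (cellMeasure d)] with x hx
    rw [hx]; simp
  rw [e1, e2, neg_zero]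

lemma IsWeakGradient.unique {d : ℕ} {u : L2 d} {g h : L2Vec d} (hg : IsWeakGradient u g)
    (hh : IsWeakGradient u h) : g = h := by
  have hj : ∀ j : Fin d, ∀ᵐ x ∂(volume : Measure (Pt d)), x ∈ cell d → g x j - h x j = 0 := by
    intro j
    have hgi := integrable_L2Vec_coord g j
    have hhi := integrable_L2Vec_coord h j
    refine (isOpen_cell d).ae_eq_zero_of_integral_contDiff_smul_eq_zero ?_ ?_
    · have : IntegrableOn (fun x => g x j - h x j) (cell d) volume := hgi.sub hhi
      exact this.locallyIntegrableOn
    · intro φ h1 h2 h3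
      have hsup : Function.support (fun x => φ x • (g x j - h x j)) ⊆ cell d := by
        intro x hx
        refine h3 (subset_tsupport _ ?_)
        intro h0
        exact hx (by simp [h0])
      rw [← setIntegral_eq_integral_of_forall_compl_eq_zero (s := cell d)
        (fun x hx => by by_contra h0; exact hx (hsup h0))]
      change ∫ x, φ x • (g x j - h x j) ∂(cellMeasure d) = 0
      simp_rw [smul_sub]
      rw [integral_sub (integrable_smul_of_test h1.continuous h2 hgi)
        (integrable_smul_of_test h1.continuous h2 hhi), sub_eq_zero, ← neg_inj,
        ← hg φ h1 h2 h3 j, ← hh φ h1 h2 h3 j]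
  refine Lp.ext ((ae_restrict_iff' (measurableSet_cell d)).2 ?_)
  filter_upwards [ae_all_iff.2 hj] with x hx hxc
  ext j
  exact sub_eq_zero.1 (hx j hxc)

lemma tendsto_integral_smul {d : ℕ} {F : Type*} [NormedAddCommGroup F] [NormedSpace ℝ F]
    {φ : Pt d → ℝ} (hc : Continuous φ) (hs : HasCompactSupport φ) (L : F →L[ℝ] ℂ)
    {w : ℕ → Lp F 2 (cellMeasure d)} {w₀ : Lp F 2 (cellMeasure d)}
    (hw : Tendsto w atTop (𝓝 w₀)) :
    Tendsto (fun k => ∫ x, φ x • L (w k x) ∂(cellMeasure d)) atTop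
      (𝓝 (∫ x, φ x • L (w₀ x) ∂(cellMeasure d))) := by
  obtain ⟨C, hC⟩ := hs.exists_bound_of_continuous hc
  have hC0 : 0 ≤ C := (norm_nonneg _).trans (hC 0)
  have hint : ∀ v : Lp F 2 (cellMeasure d), Integrable (fun x => φ x • L (v x)) (cellMeasure d) :=
    fun v => integrable_smul_of_test hc hs (L.integrable_comp (integrable_L2 v))
  rw [tendsto_iff_norm_sub_tendsto_zero]
  have hlim : Tendsto (fun k => (C * ‖L‖) * ‖w k - w₀‖) atTop (𝓝 0) := by
    simpa using (tendsto_iff_norm_sub_tendsto_zero.1 hw).const_mul (C * ‖L‖)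
  refine squeeze_zero (fun _ => norm_nonneg _) (fun k => ?_) hlim
  rw [← integral_sub (hint _) (hint _)]
  calc ‖∫ x, (φ x • L (w k x) - φ x • L (w₀ x)) ∂(cellMeasure d)‖
      ≤ ∫ x, (C * ‖L‖) * ‖(w k - w₀ : Lp F 2 (cellMeasure d)) x‖ ∂(cellMeasure d) := by
        refine norm_integral_le_of_norm_le ((integrable_L2 _).norm.const_mul _) ?_
        filter_upwards [Lp.coeFn_sub (w k) w₀] with x hx
        rw [hx, Pi.sub_apply, ← smul_sub, ← map_sub, norm_smul, mul_assoc]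
        exact mul_le_mul (hC x) (L.le_opNorm _) (norm_nonneg _) hC0
    _ ≤ (C * ‖L‖) * ‖w k - w₀‖ := by
        rw [integral_const_mul]
        refine mul_le_mul_of_nonneg_left ?_ (by positivity)
        have h1 := eLpNorm_le_eLpNorm_of_exponent_le (p := 1) (q := 2) (μ := cellMeasure d)
          (by norm_num) (Lp.aestronglyMeasurable (w k - w₀))
        rw [Lp.norm_def, integral_norm_eq_lintegral_enorm (Lp.aestronglyMeasurable _),
          ← eLpNorm_one_eq_lintegral_enorm]
        exact ENNReal.toReal_mono (Lp.eLpNorm_ne_top _) h1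

lemma IsWeakGradient.of_tendsto {d : ℕ} {u : ℕ → L2 d} {g : ℕ → L2Vec d} {u₀ : L2 d} {g₀ : L2Vec d}
    (h : ∀ k, IsWeakGradient (u k) (g k)) (hu : Tendsto u atTop (𝓝 u₀))
    (hg : Tendsto g atTop (𝓝 g₀)) : IsWeakGradient u₀ g₀ := by
  intro φ h1 h2 h3 j
  have hd := continuous_fderiv_apply h1 (EuclideanSpace.single j (1 : ℝ))
  have hds : HasCompactSupport fun x => fderiv ℝ φ x (EuclideanSpace.single j (1 : ℝ)) :=
    h2.fderiv_apply (𝕜 := ℝ) _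
  have t1 := tendsto_integral_smul hd hds (ContinuousLinearMap.id ℝ ℂ) hu
  have t2 := tendsto_integral_smul h1.continuous h2
    ((EuclideanSpace.proj (𝕜 := ℂ) j : EuclideanSpace ℂ (Fin d) →L[ℂ] ℂ).restrictScalars ℝ) hg
  refine tendsto_nhds_unique t1 (t2.neg.congr fun k => ?_)
  exact (h k φ h1 h2 h3 j).symm

/-- The mean-zero functions in `H¹(Y)`. -/
def sobolevMeanZero (d : ℕ) : Submodule ℂ (L2 d) where
  carrier := {u | u ∈ meanZero d ∧ ∃ g : L2Vec d, IsWeakGradient u g}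
  zero_mem' := ⟨zero_mem _, 0, isWeakGradient_zero d⟩
  add_mem' := by
    rintro u v ⟨hu, g, hg⟩ ⟨hv, h, hh⟩
    exact ⟨add_mem hu hv, g + h, hg.add hh⟩
  smul_mem' := by
    rintro c u ⟨hu, g, hg⟩
    exact ⟨Submodule.smul_mem _ c hu, c • g, hg.smul c⟩

/-- The space `𝓗 = {h ∈ H¹(Y) : ∫_Y h = 0}`; it carries the energy inner product, see below. -/
def EnergySpace (d : ℕ) : Type := sobolevMeanZero d

namespace EnergySpace

variable {d : ℕ}

instance : AddCommGroup (EnergySpace d) := inferInstanceAs (AddCommGroup (sobolevMeanZero d))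

instance : Module ℂ (EnergySpace d) := inferInstanceAs (Module ℂ (sobolevMeanZero d))

/-- The underlying `L²` function. -/
def toL2 : EnergySpace d →ₗ[ℂ] L2 d := (sobolevMeanZero d).subtype

lemma toL2_injective : Function.Injective (toL2 (d := d)) := Subtype.val_injective

lemma toL2_mem (u : EnergySpace d) : toL2 u ∈ meanZero d := (Subtype.property u).1

/-- The weak gradient. -/
def grad : EnergySpace d →ₗ[ℂ] L2Vec d where
  toFun u := (Subtype.property u).2.choose
  map_add' u v := (Subtype.property (u + v)).2.choose_spec.unique
    ((Subtype.property u).2.choose_spec.add (Subtype.property v).2.choose_spec)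
  map_smul' c u := (Subtype.property (c • u)).2.choose_spec.unique
    ((Subtype.property u).2.choose_spec.smul c)

lemma isWeakGradient_grad (u : EnergySpace d) : IsWeakGradient (toL2 u) (grad u) :=
  (Subtype.property u).2.choose_spec

lemma norm_toL2_le (u : EnergySpace d) : ‖toL2 u‖ ≤ Real.pi⁻¹ * ‖grad u‖ :=
  poincare (isWeakGradient_grad u) (toL2_mem u)

lemma grad_injective : Function.Injective (grad (d := d)) := by
  rw [injective_iff_map_eq_zero]
  intro u hu
  have h := norm_toL2_le u
  rw [hu, norm_zero, mul_zero] at h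
  exact toL2_injective (by rw [norm_le_zero_iff.1 h, map_zero])

/-- The energy norm `‖∇u‖_{L²(Y)}`. -/
instance : NormedAddCommGroup (EnergySpace d) :=
  NormedAddCommGroup.induced (EnergySpace d) (L2Vec d) grad grad_injective

lemma norm_def (u : EnergySpace d) : ‖u‖ = ‖grad u‖ := rfl

/-- The energy inner product `∫_Y ∇v · conj (∇u)`, linear in the second argument. -/
instance : InnerProductSpace ℂ (EnergySpace d) where
  norm_smul_le c u := by rw [norm_def, map_smul, norm_smul, norm_def]
  inner u v := ⟪grad u, grad v⟫_ℂ
  norm_sq_eq_re_inner u := by rw [norm_def]; exact norm_sq_eq_re_inner (grad u)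
  conj_inner_symm u v := inner_conj_symm _ _
  add_left u v w := by rw [map_add, inner_add_left]
  smul_left u v c := by rw [map_smul, inner_smul_left]

lemma inner_def (u v : EnergySpace d) : ⟪u, v⟫_ℂ = ⟪grad u, grad v⟫_ℂ := rfl

instance : CompleteSpace (EnergySpace d) := by
  refine Metric.complete_of_cauchySeq_tendsto fun u hu => ?_
  have hlip : ∀ v w : EnergySpace d, dist (grad v) (grad w) = dist v w := fun v w => by
    rw [dist_eq_norm, dist_eq_norm, norm_def, map_sub]
  have hlip2 : ∀ v w : EnergySpace d, dist (toL2 v) (toL2 w) ≤ Real.pi⁻¹ * dist v w := fun v w => by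
    rw [dist_eq_norm, dist_eq_norm, norm_def, ← map_sub]; exact norm_toL2_le _
  have hg : CauchySeq fun k => grad (u k) :=
    (LipschitzWith.of_dist_le_mul (K := 1) (fun v w => by simp [hlip])).cauchySeq_comp hu
  have hf : CauchySeq fun k => toL2 (u k) :=
    (LipschitzWith.of_dist_le_mul (K := ⟨Real.pi⁻¹, by positivity⟩)
      (fun v w => hlip2 v w)).cauchySeq_comp hu
  obtain ⟨g₀, hg₀⟩ := cauchySeq_tendsto_of_complete hg
  obtain ⟨u₀, hu₀⟩ := cauchySeq_tendsto_of_complete hf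
  have hw : IsWeakGradient u₀ g₀ :=
    IsWeakGradient.of_tendsto (fun k => isWeakGradient_grad (u k)) hu₀ hg₀
  have hm : u₀ ∈ meanZero d :=
    (isClosed_meanZero d).mem_of_tendsto hu₀ (Eventually.of_forall fun k => toL2_mem (u k))
  let U : EnergySpace d := ⟨u₀, hm, g₀, hw⟩
  have hU : grad U = g₀ := (isWeakGradient_grad U).unique hw
  refine ⟨U, ?_⟩
  rw [tendsto_iff_dist_tendsto_zero]
  simp_rw [← hlip, hU]
  exact tendsto_iff_dist_tendsto_zero.1 hg₀

/-- The gradient as a bounded operator. -/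
def gradL : EnergySpace d →L[ℂ] L2Vec d :=
  LinearMap.mkContinuous grad 1 (fun u => by rw [one_mul, norm_def])

/-- The embedding `𝓗 → L²₀(Y)`. -/
def toL20 : EnergySpace d →L[ℂ] L20 d :=
  LinearMap.mkContinuous (LinearMap.codRestrict (meanZero d) toL2 toL2_mem) Real.pi⁻¹
    (fun u => norm_toL2_le u)

end EnergySpace

/-! ### The inclusions -/

/-- `∂D` is of class `C^{1,γ}` for some `γ ∈ (0,1]`: near each boundary point, `D` is the set of
points below the graph, in some direction `ν`, of a `C^{1,γ}` function of the variables orthogonal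
to `ν`. -/
def HasHolderC1Boundary {d : ℕ} (D : Set (Pt d)) : Prop :=
  ∃ γ : ℝ≥0, 0 < γ ∧ γ ≤ 1 ∧ ∀ p ∈ frontier D, ∃ ν : Pt d, ‖ν‖ = 1 ∧ ∃ ψ : Pt d → ℝ,
    ContDiff ℝ 1 ψ ∧ (∃ C : ℝ≥0, HolderWith C γ (fderiv ℝ ψ)) ∧
    (∀ (x : Pt d) (t : ℝ), ψ (x + t • ν) = ψ x) ∧
    ∃ r > 0, ∀ x ∈ Metric.ball p r, x ∈ D ↔ ⟪ν, x⟫_ℝ < ψ x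

/-- The union `D` of the inclusions in the unit cell: a nonempty open set, compactly contained in
the open cell, with `C^{1,γ}` boundary. (Such a set has finitely many components, the single
inclusions, whose closures are disjoint.) -/
structure IsInclusionDomain {d : ℕ} (D : Set (Pt d)) : Prop where
  isOpen : IsOpen D
  nonempty : D.Nonempty
  closure_subset : closure D ⊆ cell d
  boundary : HasHolderC1Boundary D

/-! ### The decomposition `𝓗 = W₁ ⊕ W₂ ⊕ W₃` and the electrostatic resonances -/

section Resonances

open EnergySpace

variable {d : ℕ} (D : Set (Pt d))

/-- The functions in `𝓗` with support away from `D`. -/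
def awayFrom : Submodule ℂ (EnergySpace d) where
  carrier := {u | ∃ U : Set (Pt d), IsOpen U ∧ closure D ⊆ U ∧
    ∀ᵐ x ∂(cellMeasure d), x ∈ U → toL2 u x = 0}
  zero_mem' := by
    refine ⟨univ, isOpen_univ, subset_univ _, ?_⟩
    rw [map_zero]
    filter_upwards [Lp.coeFn_zero ℂ 2 (cellMeasure d)] with x hx _
    rw [hx]; rfl
  add_mem' := by
    rintro u v ⟨U, hU, hDU, hu⟩ ⟨V, hV, hDV, hv⟩
    refine ⟨U ∩ V, hU.inter hV, subset_inter hDU hDV, ?_⟩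
    rw [map_add]
    filter_upwards [hu, hv, Lp.coeFn_add (toL2 u) (toL2 v)] with x h1 h2 h3 hx
    rw [h3, Pi.add_apply, h1 hx.1, h2 hx.2, add_zero]
  smul_mem' := by
    rintro c u ⟨U, hU, hDU, hu⟩
    refine ⟨U, hU, hDU, ?_⟩
    rw [map_smul]
    filter_upwards [hu, Lp.coeFn_smul c (toL2 u)] with x h1 h3 hx
    rw [h3, Pi.smul_apply, h1 hx, smul_zero]

/-- `W₁`, the closure in `𝓗` of the functions with support away from `D`. -/
def W1 : Submodule ℂ (EnergySpace d) := (awayFrom D).topologicalClosure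

/-- The functions `φ - (∫_D φ) 1_Y` with `φ ∈ C_c^∞(D)`, extended by zero. -/
def testMinusMean : Submodule ℂ (EnergySpace d) where
  carrier := {u | ∃ φ : Pt d → ℂ, ContDiff ℝ ∞ φ ∧ HasCompactSupport φ ∧ tsupport φ ⊆ D ∧
    toL2 u =ᵐ[cellMeasure d] fun x => φ x - ∫ y in D, φ y}
  zero_mem' := by
    refine ⟨0, contDiff_const, HasCompactSupport.zero, by simp, ?_⟩
    rw [map_zero]
    filter_upwards [Lp.coeFn_zero ℂ 2 (cellMeasure d)] with x hx
    rw [hx]; simp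
  add_mem' := by
    rintro u v ⟨φ, h1, h2, h3, h4⟩ ⟨ψ, k1, k2, k3, k4⟩
    refine ⟨φ + ψ, h1.add k1, h2.add k2,
      (tsupport_add φ ψ).trans (union_subset h3 k3), ?_⟩
    rw [map_add]
    filter_upwards [h4, k4, Lp.coeFn_add (toL2 u) (toL2 v)] with x e1 e2 e3
    rw [e3, Pi.add_apply, e1, e2]
    simp only [Pi.add_apply]
    rw [integral_add (h1.continuous.integrable_of_hasCompactSupport h2).integrableOn
      (k1.continuous.integrable_of_hasCompactSupport k2).integrableOn]
    ring
  smul_mem' := by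
    rintro c u ⟨φ, h1, h2, h3, h4⟩
    refine ⟨c • φ, h1.const_smul c, h2.smul_left (f := fun _ => c),
      (tsupport_smul_subset_right (fun _ => c) φ).trans h3, ?_⟩
    rw [map_smul]
    filter_upwards [h4, Lp.coeFn_smul c (toL2 u)] with x e1 e2
    rw [e2, Pi.smul_apply, e1]
    simp only [Pi.smul_apply]
    rw [integral_smul, smul_sub]

/-- `W₂ = {ũ - (∫_D ũ) 1_Y : ũ ∈ H¹₀(D) extended by zero}`. Since `H¹₀(D)` is the closure of
`C_c^∞(D)` and `ũ ↦ ũ - (∫_D ũ) 1_Y` preserves gradients, this is the closure in `𝓗` of the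
functions arising from `C_c^∞(D)`. -/
def W2 : Submodule ℂ (EnergySpace d) := (testMinusMean D).topologicalClosure

/-- `W₃ = (W₁ ⊕ W₂)^⊥`. -/
def W3 : Submodule ℂ (EnergySpace d) := (W1 D ⊔ W2 D)ᗮ

instance : CompleteSpace (W1 D) := Submodule.topologicalClosure.completeSpace _

instance : CompleteSpace (W2 D) := Submodule.topologicalClosure.completeSpace _

/-- The restriction of the gradient to a set `s ⊆ Y`. -/
def gradOn (s : Set (Pt d)) :
    EnergySpace d →L[ℂ] Lp (EuclideanSpace ℂ (Fin d)) 2 ((cellMeasure d).restrict s) :=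
  LpToLpRestrictCLM (Pt d) (EuclideanSpace ℂ (Fin d)) ℂ (cellMeasure d) 2 s ∘L gradL

/-- The bounded operator on `𝓗` given by the form `∫_s ∇u · conj ∇v`. -/
def energyOn (s : Set (Pt d)) : EnergySpace d →L[ℂ] EnergySpace d :=
  ContinuousLinearMap.adjoint (gradOn s) ∘L gradOn s

lemma inner_energyOn (s : Set (Pt d)) (u v : EnergySpace d) :
    ⟪v, energyOn s u⟫_ℂ = ∫ x in s, ⟪grad v x, grad u x⟫_ℂ ∂(cellMeasure d) := by
  rw [energyOn, ContinuousLinearMap.comp_apply, ContinuousLinearMap.adjoint_inner_right,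
    L2.inner_def]
  refine integral_congr_ae ?_
  filter_upwards [LpToLpRestrictCLM_coeFn (μ := cellMeasure d) (p := 2) ℂ s (grad u),
    LpToLpRestrictCLM_coeFn (μ := cellMeasure d) (p := 2) ℂ s (grad v)] with x h1 h2
  change ⟪LpToLpRestrictCLM _ _ ℂ _ 2 s (grad v) x, LpToLpRestrictCLM _ _ ℂ _ 2 s (grad u) x⟫_ℂ = _
  rw [h1, h2]

/-- The operator `T` with
`⟨Tu, v⟩ = ½ ∫_{Y∖D} ∇u · conj ∇v - ½ ∫_D ∇u · conj ∇v`. It maps `W₃` into itself. -/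
def T : EnergySpace d →L[ℂ] EnergySpace d :=
  (1 / 2 : ℂ) • energyOn Dᶜ - (1 / 2 : ℂ) • energyOn D

/-- The eigenspace of `T` on `W₃` for the real number `μ`. -/
def resonanceSpace (μ : ℝ) : Submodule ℂ (EnergySpace d) :=
  W3 D ⊓ (T D - (μ : ℂ) • ContinuousLinearMap.id ℂ (EnergySpace d)).ker

instance (μ : ℝ) : CompleteSpace (resonanceSpace D μ) := by
  refine IsClosed.completeSpace_coe (hs := ?_)
  exact (Submodule.isClosed_orthogonal _).inter (ContinuousLinearMap.isClosed_ker _)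

/-- The Neumann electrostatic resonances: the eigenvalues of `T` on `W₃`. -/
def resonances : Set ℝ := {μ | resonanceSpace D μ ≠ ⊥}

/-- The resonances different from `±1/2`. -/
abbrev innerResonances : Type := {μ : ℝ // μ ∈ resonances D ∧ -(1 / 2) < μ ∧ μ < 1 / 2}

/-- `P₁`: the sum of the orthogonal projections onto `W₁` and onto the resonance space of `1/2`. -/
def P1 : EnergySpace d →L[ℂ] EnergySpace d :=
  (W1 D).starProjection + (resonanceSpace D (1 / 2)).starProjection

/-- `P₂`: the orthogonal projection onto `W₂`. -/
def P2 : EnergySpace d →L[ℂ] EnergySpace d := (W2 D).starProjection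

end Resonances

open Classical in
/-- The sum of a family of bounded operators in the strong operator topology
(`0` if it does not converge to a bounded operator). -/
def strongSum {ι E : Type*} [NormedAddCommGroup E] [NormedSpace ℂ E] (f : ι → E →L[ℂ] E) :
    E →L[ℂ] E :=
  if h : ∃ L : E →L[ℂ] E, ∀ u, HasSum (fun i => f i u) (L u) then h.choose else 0

section Operators

open EnergySpace

variable {d : ℕ} (D : Set (Pt d))

/-- `∑_{-1/2 < μ < 1/2} [(1/2 + μ) + z (1/2 - μ)]⁻¹ P_μ`. -/
def resonanceSum (z : ℂ) : EnergySpace d →L[ℂ] EnergySpace d :=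
  strongSum fun μ : innerResonances D =>
    ((1 / 2 + (μ : ℝ) : ℂ) + z * (1 / 2 - (μ : ℝ) : ℂ))⁻¹ • (resonanceSpace D μ).starProjection

/-- `(-Δ_N)⁻¹ : L²₀(Y) → 𝓗`, the solution operator of `⟨w, v⟩ = (f, v)` for all `v ∈ 𝓗`. -/
def invNegLaplacian (d : ℕ) : L20 d →L[ℂ] EnergySpace d := ContinuousLinearMap.adjoint toL20

lemma inner_invNegLaplacian (f : L20 d) (v : EnergySpace d) :
    ⟪v, invNegLaplacian d f⟫_ℂ = ⟪toL20 v, f⟫_ℂ :=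
  ContinuousLinearMap.adjoint_inner_right _ _ _

/-- The operator family
`A(z) = (z P₁ + P₂ + z ∑ [(1/2 + μ) + z (1/2 - μ)]⁻¹ P_μ) (-Δ_N)⁻¹` on `L²₀(Y)`. -/
def opA (z : ℂ) : L20 d →L[ℂ] L20 d :=
  toL20 ∘L (z • P1 D + P2 D + z • resonanceSum D z) ∘L invNegLaplacian d

/-- The resolvent `R(ζ, z) = (A(z) - ζ)⁻¹`. -/
def opR (ζ z : ℂ) : L20 d →L[ℂ] L20 d := Ring.inverse (opA D z - ζ • (1 : L20 d →L[ℂ] L20 d))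

/-- `𝒩(ζ, z) = (P₁ + ∑ [(1/2 + μ) + z (1/2 - μ)]⁻¹ P_μ) (-Δ_N)⁻¹ R(ζ, 0)`. -/
def opN (ζ z : ℂ) : L20 d →L[ℂ] L20 d :=
  toL20 ∘L (P1 D + resonanceSum D z) ∘L invNegLaplacian d ∘L opR D ζ 0

end Operators

/-! ### Contours -/

/-- The trace of a curve parametrised by `[0,1]`. -/
def contourTrace (Γ : ℝ → ℂ) : Set ℂ := Γ '' Icc 0 1

/-- `∮_Γ F(ζ) dζ`. -/
def contourIntegral {E : Type*} [NormedAddCommGroup E] [NormedSpace ℂ E] (Γ : ℝ → ℂ) (F : ℂ → E) :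
    E := ∫ t in (0 : ℝ)..1, deriv Γ t • F (Γ t)

/-- The winding number of `Γ` about `w`. -/
def windingNumber (Γ : ℝ → ℂ) (w : ℂ) : ℂ :=
  (2 * Real.pi * Complex.I)⁻¹ * contourIntegral Γ fun ζ => (ζ - w)⁻¹

/-- A closed contour: a closed, piecewise `C¹` curve which winds either zero times or once around
each point off the curve. Every positively oriented simple closed piecewise `C¹` curve is one. -/
structure IsClosedContour (Γ : ℝ → ℂ) : Prop where
  closed : Γ 0 = Γ 1
  continuousOn : ContinuousOn Γ (Icc 0 1)
  piecewise : ∃ s : Finset ℝ, ∀ a b : ℝ, 0 ≤ a → a < b → b ≤ 1 → (∀ t ∈ s, t ∉ Ioo a b) →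
    ContDiffOn ℝ 1 Γ (Icc a b)
  winding : ∀ w ∉ contourTrace Γ, windingNumber Γ w = 0 ∨ windingNumber Γ w = 1

/-- The points enclosed by `Γ`. -/
def contourInside (Γ : ℝ → ℂ) : Set ℂ := {w | w ∉ contourTrace Γ ∧ windingNumber Γ w = 1}

/-- The points exterior to `Γ`. -/
def contourOutside (Γ : ℝ → ℂ) : Set ℂ := {w | w ∉ contourTrace Γ ∧ windingNumber Γ w = 0}

/-! ### Spectral separation -/

/-- The spectrum of the restriction of `L` to an invariant closed subspace `V`. -/
def spectrumOn {E : Type*} [NormedAddCommGroup E] [NormedSpace ℂ E] (L : E →L[ℂ] E)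
    (V : Submodule ℂ E) : Set ℂ :=
  {ζ | ¬ Set.BijOn (fun x => L x - ζ • x) (V : Set E) (V : Set E)}

section Separation

variable {d : ℕ} (D : Set (Pt d)) (Γ : ℝ → ℂ)

/-- `d̂`, the distance between `Γ` and `σ(A(0))`. -/
def dHat : ℝ := sInf ((fun ζ => Metric.infDist ζ (spectrum ℂ (opA D 0))) '' contourTrace Γ)

/-- `z* = (μ* + 1/2) / (μ* - 1/2)`. -/
def zStar (μs : ℝ) : ℝ := (μs + 1 / 2) / (μs - 1 / 2)

/-- `r* = π² d̂ |z*| / (1 / (1/2 - μ*) + π² d̂)`. -/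
def rStar (μs : ℝ) : ℝ :=
  Real.pi ^ 2 * dHat D Γ * |zStar μs| / (1 / (1 / 2 - μs) + Real.pi ^ 2 * dHat D Γ)

/-- `Σ'(z)`, the part of the spectrum of `A(z)` inside `Γ`. -/
def sigmaIn (z : ℂ) : Set ℂ := spectrum ℂ (opA D z) ∩ contourInside Γ

/-- `Σ''(z)`, the part of the spectrum of `A(z)` exterior to `Γ`. -/
def sigmaOut (z : ℂ) : Set ℂ := spectrum ℂ (opA D z) ∩ contourOutside Γ

/-- `P(z) = -(1 / 2πi) ∮_Γ R(ζ, z) dζ`. -/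
def specProj (z : ℂ) : L20 d →L[ℂ] L20 d :=
  (-(2 * Real.pi * Complex.I)⁻¹ : ℂ) • contourIntegral Γ fun ζ => opR D ζ z

/-- `M'(z) = P(z) L²₀(Y)`. -/
def specSpace (z : ℂ) : Submodule ℂ (L20 d) := (specProj D Γ z).range

/-- The coefficient `βⁿ(z) = -(1 / 2πi) (∮_Γ (ζ - β₀) R(ζ, 0) (-𝒩(ζ, z))ⁿ dζ φ, φ)` belonging to
the eigenfunction `φ`; the inner product is linear in its second argument. -/
def seriesCoeff (β₀ : ℂ) (n : ℕ) (z : ℂ) (φ : L20 d) : ℂ :=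
  -(2 * Real.pi * Complex.I)⁻¹ *
    ⟪φ, (contourIntegral Γ fun ζ => (ζ - β₀) • (opR D ζ 0 * (-opN D ζ z) ^ n)) φ⟫_ℂ

end Separation

end NeumannCrystal

end

open NeumannCrystal

namespace NeumannCrystal

/-! ### Contour integrals -/

/-! Write `i` for the embedding of the energy space into `L²₀(Y)`; its adjoint is `(-Δ_N)⁻¹`. Then
`A(z) = A(0) + z V(z)` with `V(z) = i E(z) i†` and `E(z) = P₁ + ∑ [(1/2 + μ) + z (1/2 - μ)]⁻¹ P_μ`.
Everything follows from one bound: on the contour and for `|z| < r*`, the norm of `z V(z) R(ζ, 0)`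
is at most some `q < 1` that does not depend on `z` or `ζ`.

Three estimates give it. The operator `E(z)` is diagonal with respect to orthogonal subspaces, so
its norm is at most the largest coefficient, `1 / ((1/2 - μ*) (|z*| - |z|))` (`norm_energyPart_le`).
Since `A(0)` is self-adjoint, `R(ζ, 0)` has norm at most `1 / d̂` on the contour
(`norm_inverse_sub_le_of_isStarNormal`). Since `W₂` is orthogonal to everything on which `E(z)`
lives, `V(z) = B† E(z) B` with `B = (1 - P₂) i†`, and Poincaré's inequality bounds `B` by `1/π`. The
radius `r*` is where the product of these bounds reaches 1, which alone would only give a constant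
tending to 1 at the boundary of the disc. The constant stays away from 1 because `‖B‖ < 1/π`
strictly (`norm_offW2_lt`): a maximiser would vanish on `D` and be a combination of the functions
`cos (π x_j)`, hence be zero.

The Neumann series now keeps the contour in the resolvent set and makes `P(z)` holomorphic. For real
`z` the operator `A(z)` is compact and self-adjoint, and `P(z)` multiplies an eigenvector by the
winding number of the contour about its eigenvalue, which is 0 or 1; so `P(z)² = P(z)`, and the
identity theorem carries this to complex `z` (`IsSmallPerturbation.isIdempotentElem`). The origin is
exterior to the contour because `A(0)` has infinite rank
(`zero_mem_contourOutside_of_infinite_rank`); hence `P(z)` is compact and its range finite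
dimensional. The rank of a continuous family of finite rank projections on a connected set is
constant, which gives the isomorphism.

For the series, `(A(z) - β₀) P(z)` is the contour integral of `(ζ - β₀) R(ζ, z)` up to the factor
`-1/(2πi)`. Inserting the Neumann series and pairing with the eigenvector `φ(z)` gives `β(z) - β₀`;
the term of order zero is `(A(0) - β₀) P(0) = 0`, and the remainder is geometric with ratio `q`
(`IsSmallPerturbation.exists_norm_series_sub_le`). -/

lemma intervalIntegrable_deriv_of_piecewise {Γ : ℝ → ℂ} (s : Finset ℝ) {a b : ℝ} (hab : a ≤ b)
    (h : ∀ a' b' : ℝ, a ≤ a' → a' < b' → b' ≤ b → (∀ t ∈ s, t ∉ Ioo a' b') →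
      ContDiffOn ℝ 1 Γ (Icc a' b')) :
    IntervalIntegrable (deriv Γ) volume a b := by
  induction s using Finset.induction_on generalizing a b with
  | empty =>
    rcases hab.eq_or_lt with rfl | hlt
    · exact IntervalIntegrable.refl
    have hc := (h a b le_rfl hlt le_rfl (by simp)).continuousOn_derivWithin
      (uniqueDiffOn_Icc hlt) le_rfl
    have hi := ContinuousOn.intervalIntegrable_of_Icc (μ := volume) hlt.le hc
    -- The endpoints are dropped because `deriv` and `derivWithin` are only known to agree in the
    -- open interval.
    rw [intervalIntegrable_iff_integrableOn_Ioo_of_le hlt.le] at hi ⊢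
    refine hi.congr_fun (fun x hx => ?_) measurableSet_Ioo
    exact derivWithin_of_mem_nhds (Icc_mem_nhds hx.1 hx.2)
  | insert p s _ ih =>
    -- A break point inside the interval splits it into two intervals whose remaining break points
    -- lie in `s`.
    by_cases hp : p ∈ Ioo a b
    · refine (ih hp.1.le fun a' b' h1 h2 h3 h4 => ?_).trans
        (ih hp.2.le fun a' b' h1 h2 h3 h4 => ?_)
      · refine h a' b' h1 h2 (h3.trans hp.2.le) fun t ht => ?_
        rcases Finset.mem_insert.1 ht with rfl | ht
        · exact fun hh => absurd hh.2 (not_lt.2 h3)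
        · exact h4 t ht
      · refine h a' b' (hp.1.le.trans h1) h2 h3 fun t ht => ?_
        rcases Finset.mem_insert.1 ht with rfl | ht
        · exact fun hh => absurd hh.1 (not_lt.2 h1)
        · exact h4 t ht
    · refine ih hab fun a' b' h1 h2 h3 h4 => h a' b' h1 h2 h3 fun t ht => ?_
      rcases Finset.mem_insert.1 ht with rfl | ht
      · exact fun hh => hp ⟨h1.trans_lt hh.1, hh.2.trans_le h3⟩
      · exact h4 t ht

section Contour

variable {Γ : ℝ → ℂ} {E : Type*} [NormedAddCommGroup E] [NormedSpace ℂ E]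

lemma IsClosedContour.intervalIntegrable_deriv (hΓ : IsClosedContour Γ) :
    IntervalIntegrable (deriv Γ) volume 0 1 := by
  obtain ⟨s, hs⟩ := hΓ.piecewise
  exact intervalIntegrable_deriv_of_piecewise s zero_le_one hs

lemma IsClosedContour.integral_deriv (hΓ : IsClosedContour Γ) :
    ∫ t in (0 : ℝ)..1, deriv Γ t = 0 := by
  obtain ⟨s, hs⟩ := hΓ.piecewise
  have h01 : uIcc (0 : ℝ) 1 = Icc 0 1 := uIcc_of_le zero_le_one
  rw [integral_eq_of_hasDerivAt_off_countable Γ (deriv Γ) s.countable_toSet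
    (by rw [h01]; exact hΓ.continuousOn) ?_ hΓ.intervalIntegrable_deriv, hΓ.closed, sub_self]
  rw [min_eq_left zero_le_one, max_eq_right zero_le_one]
  rintro t ⟨ht, hts⟩
  -- Off the finite set of corners there is an interval around `t` free of corners, on which `Γ` is
  -- `C¹`.
  have hn : (Ioo (0 : ℝ) 1 ∩ (s : Set ℝ)ᶜ) ∈ 𝓝 t :=
    inter_mem (isOpen_Ioo.mem_nhds ht) (s.finite_toSet.isClosed.isOpen_compl.mem_nhds hts)
  obtain ⟨a, b, hab, hsub⟩ := mem_nhds_iff_exists_Ioo_subset.1 hn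
  have hlt : a < b := hab.1.trans hab.2
  have h2 := (Ioo_subset_Ioo_iff hlt).1 fun x hx => (hsub hx).1
  have hc := hs a b h2.1 hlt h2.2 fun r hr hrab => (hsub hrab).2 hr
  exact ((hc.differentiableOn (by simp)).differentiableAt
    (Icc_mem_nhds hab.1 hab.2)).hasDerivAt

lemma mem_contourTrace {t : ℝ} (ht : t ∈ Icc (0 : ℝ) 1) : Γ t ∈ contourTrace Γ :=
  mem_image_of_mem Γ ht

lemma nonempty_contourTrace (Γ : ℝ → ℂ) : (contourTrace Γ).Nonempty :=
  ⟨Γ 0, mem_contourTrace (by simp)⟩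

lemma IsClosedContour.isCompact_trace (hΓ : IsClosedContour Γ) : IsCompact (contourTrace Γ) :=
  isCompact_Icc.image_of_continuousOn hΓ.continuousOn

lemma contourIntegral_congr {F G : ℂ → E} (h : EqOn F G (contourTrace Γ)) :
    contourIntegral Γ F = contourIntegral Γ G := by
  refine intervalIntegral.integral_congr fun t ht => ?_
  rw [uIcc_of_le zero_le_one] at ht
  simp only [h (mem_contourTrace ht)]

lemma IsClosedContour.intervalIntegrable_smul (hΓ : IsClosedContour Γ) {F : ℂ → E}
    (hF : ContinuousOn F (contourTrace Γ)) :
    IntervalIntegrable (fun t => deriv Γ t • F (Γ t)) volume 0 1 := by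
  refine hΓ.intervalIntegrable_deriv.smul_continuousOn ?_
  rw [uIcc_of_le zero_le_one]
  exact hF.comp hΓ.continuousOn fun t ht => mem_contourTrace ht

lemma IsClosedContour.contourIntegral_add (hΓ : IsClosedContour Γ) {F G : ℂ → E}
    (hF : ContinuousOn F (contourTrace Γ)) (hG : ContinuousOn G (contourTrace Γ)) :
    contourIntegral Γ (fun ζ => F ζ + G ζ) = contourIntegral Γ F + contourIntegral Γ G := by
  simp only [contourIntegral, smul_add]
  exact intervalIntegral.integral_add (hΓ.intervalIntegrable_smul hF)
    (hΓ.intervalIntegrable_smul hG)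

lemma contourIntegral_smul (c : ℂ) (F : ℂ → E) :
    contourIntegral Γ (fun ζ => c • F ζ) = c • contourIntegral Γ F := by
  simp only [contourIntegral, smul_comm _ c]
  exact intervalIntegral.integral_smul _ _

lemma IsClosedContour.contourIntegral_sum (hΓ : IsClosedContour Γ) {ι : Type*} (s : Finset ι)
    {F : ι → ℂ → E} (hF : ∀ i ∈ s, ContinuousOn (F i) (contourTrace Γ)) :
    contourIntegral Γ (fun ζ => ∑ i ∈ s, F i ζ) = ∑ i ∈ s, contourIntegral Γ (F i) := by
  simp only [contourIntegral, Finset.smul_sum]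
  exact intervalIntegral.integral_finsetSum fun i hi => hΓ.intervalIntegrable_smul (hF i hi)

lemma IsClosedContour.map_contourIntegral [CompleteSpace E] {F' : Type*} [NormedAddCommGroup F']
    [NormedSpace ℂ F'] [CompleteSpace F'] (hΓ : IsClosedContour Γ) (L : E →L[ℂ] F') {F : ℂ → E}
    (hF : ContinuousOn F (contourTrace Γ)) :
    L (contourIntegral Γ F) = contourIntegral Γ fun ζ => L (F ζ) := by
  rw [contourIntegral, ← L.intervalIntegral_comp_comm (hΓ.intervalIntegrable_smul hF)]
  simp [contourIntegral]

lemma contourIntegral_smul_const [CompleteSpace E] (f : ℂ → ℂ) (x : E) :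
    contourIntegral Γ (fun ζ => f ζ • x) = contourIntegral Γ f • x := by
  simp only [contourIntegral, ← smul_assoc]
  exact intervalIntegral.integral_smul_const _ _

lemma IsClosedContour.norm_contourIntegral_le (hΓ : IsClosedContour Γ) {F : ℂ → E} {C : ℝ}
    (hC : ∀ ζ ∈ contourTrace Γ, ‖F ζ‖ ≤ C) :
    ‖contourIntegral Γ F‖ ≤ (∫ t in (0 : ℝ)..1, ‖deriv Γ t‖) * C := by
  rw [contourIntegral, ← intervalIntegral.integral_mul_const]
  refine intervalIntegral.norm_integral_le_of_norm_le zero_le_one ?_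
    (hΓ.intervalIntegrable_deriv.norm.mul_const C)
  refine Eventually.of_forall fun t ht => ?_
  rw [norm_smul]
  exact mul_le_mul_of_nonneg_left (hC _ (mem_contourTrace (Ioc_subset_Icc_self ht)))
    (norm_nonneg _)

lemma IsClosedContour.contourIntegral_const [CompleteSpace E] (hΓ : IsClosedContour Γ) (x : E) :
    contourIntegral Γ (fun _ => x) = 0 := by
  rw [contourIntegral, intervalIntegral.integral_smul_const, hΓ.integral_deriv, zero_smul]

/-- Dominated convergence: with `δ` the distance from `w` to the curve, all `v` within `δ/2` of `w`
stay at distance at least `δ/2` from the curve, so the integrand is dominated by `|Γ'| · 2/δ`. -/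
lemma IsClosedContour.continuousOn_windingNumber (hΓ : IsClosedContour Γ) :
    ContinuousOn (windingNumber Γ) (contourTrace Γ)ᶜ := by
  intro w hw
  refine ContinuousAt.continuousWithinAt (ContinuousAt.const_mul ?_ _)
  have hcl := hΓ.isCompact_trace.isClosed
  have hδ : 0 < Metric.infDist w (contourTrace Γ) :=
    (hcl.notMem_iff_infDist_pos (nonempty_contourTrace Γ)).1 hw
  set δ := Metric.infDist w (contourTrace Γ)
  have hne : ∀ ζ ∈ contourTrace Γ, ∀ v ∈ Metric.ball w (δ / 2), δ / 2 ≤ ‖ζ - v‖ := by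
    intro ζ hζ v hv
    have h1 : δ ≤ dist w ζ := Metric.infDist_le_dist_of_mem hζ
    have h2 := dist_triangle w v ζ
    rw [Metric.mem_ball, dist_comm] at hv
    rw [← dist_eq_norm, dist_comm]
    linarith
  have hball : Metric.ball w (δ / 2) ∈ 𝓝 w := Metric.ball_mem_nhds _ (by positivity)
  refine intervalIntegral.continuousAt_of_dominated_interval
    (bound := fun t => ‖deriv Γ t‖ * (δ / 2)⁻¹) ?_ ?_ ?_ ?_
  · filter_upwards [hball] with v hv
    refine (hΓ.intervalIntegrable_smul
      (F := fun ζ => (ζ - v)⁻¹) ?_).aestronglyMeasurable_restrict_uIoc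
    refine ContinuousOn.inv₀ (by fun_prop) fun ζ hζ h0 => ?_
    have := hne ζ hζ v hv
    rw [h0, norm_zero] at this
    linarith
  · filter_upwards [hball] with v hv
    refine Eventually.of_forall fun t ht => ?_
    rw [uIoc_of_le zero_le_one] at ht
    rw [norm_smul, norm_inv]
    gcongr
    exact hne _ (mem_contourTrace (Ioc_subset_Icc_self ht)) v hv
  · exact hΓ.intervalIntegrable_deriv.norm.mul_const _
  · refine Eventually.of_forall fun t ht => ?_
    rw [uIoc_of_le zero_le_one] at ht
    have hne0 : Γ t - w ≠ 0 := fun h0 => ?_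
    · have hc : ContinuousAt (fun v : ℂ => (Γ t - v)⁻¹) w := ContinuousAt.inv₀ (by fun_prop) hne0
      exact hc.const_smul (deriv Γ t)
    have := hne _ (mem_contourTrace (Ioc_subset_Icc_self ht)) w
      (Metric.mem_ball_self (by positivity))
    rw [h0, norm_zero] at this
    linarith

/-- A segment from a point inside a contour to a point outside meets the contour. -/
lemma IsClosedContour.exists_mem_segment (hΓ : IsClosedContour Γ) {v w : ℂ}
    (hv : v ∈ contourInside Γ) (hw : w ∈ contourOutside Γ) :
    ∃ ζ ∈ contourTrace Γ, ζ ∈ segment ℝ v w := by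
  by_contra hcon
  push Not at hcon
  have hsub : segment ℝ v w ⊆ (contourTrace Γ)ᶜ := fun ζ hζ hζΓ => hcon ζ hζΓ hζ
  have hfin : ({0, 1} : Set ℂ).Finite := by simp
  -- If the segment avoided the curve, the winding number would be a continuous function on a
  -- connected set with values in a discrete one, hence constant.
  have hm : MapsTo (windingNumber Γ) (segment ℝ v w) {0, 1} := fun ζ hζ => by
    simpa using hΓ.winding ζ (hsub hζ)
  have := (convex_segment v w).isPreconnected.constant_of_mapsTo
    hfin.isDiscrete (hΓ.continuousOn_windingNumber.mono hsub) hm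
      (left_mem_segment ℝ v w) (right_mem_segment ℝ v w)
  rw [hv.2, hw.2] at this
  exact one_ne_zero this

end Contour

/-! ### Riesz projections -/

section Preliminaries

lemma commute_inverse {A : Type*} [Ring A] {b x : A} (h : Commute b x) :
    Commute b (Ring.inverse x) := by
  by_cases hx : IsUnit x
  · obtain ⟨u, rfl⟩ := hx
    rw [Ring.inverse_unit]
    exact h.units_inv_right
  · rw [Ring.inverse_non_unit _ hx]
    exact Commute.zero_right b

variable {A : Type*} [NormedRing A] [NormedAlgebra ℂ A] {a : A}
  {E : Type*} [NormedAddCommGroup E] [NormedSpace ℂ E]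

lemma mem_resolventSet_iff_isUnit_sub {ζ : ℂ} :
    ζ ∈ resolventSet ℂ a ↔ IsUnit (a - ζ • (1 : A)) := by
  rw [spectrum.mem_resolventSet_iff, ← IsUnit.neg_iff, neg_sub, Algebra.algebraMap_eq_smul_one]

lemma commute_inverse_sub {b : A} (h : Commute b a) (ζ : ℂ) :
    Commute b (Ring.inverse (a - ζ • (1 : A))) :=
  commute_inverse (h.sub_right ((Commute.one_right b).smul_right ζ))

lemma bijOn_of_inverse {V : Submodule ℂ E} {S Q : E →L[ℂ] E} (hSV : ∀ x ∈ V, S x ∈ V)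
    (hQV : ∀ x ∈ V, Q x ∈ V) (h1 : ∀ x ∈ V, S (Q x) = x) (h2 : ∀ x ∈ V, Q (S x) = x) :
    BijOn S V V :=
  InvOn.bijOn (f' := Q) ⟨fun x hx => h2 x hx, fun x hx => h1 x hx⟩ hSV hQV

lemma range_invariant {P S : E →L[ℂ] E} (h : Commute S P) : ∀ x ∈ P.range, S x ∈ P.range := by
  rintro _ ⟨y, rfl⟩
  exact ⟨S y, (DFunLike.congr_fun h.eq y).symm⟩

lemma ker_invariant {P S : E →L[ℂ] E} (h : Commute S P) : ∀ x ∈ P.ker, S x ∈ P.ker := by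
  intro x hx
  have h1 := DFunLike.congr_fun h.eq x
  simp only [mul_apply_eq_comp] at h1
  rw [LinearMap.mem_ker] at hx ⊢
  erw [← h1]
  simpa using congrArg S hx

lemma apply_of_mem_range {P : E →L[ℂ] E} (hP : IsIdempotentElem P) {x : E} (hx : x ∈ P.range) :
    P x = x := by
  obtain ⟨y, rfl⟩ := hx
  exact DFunLike.congr_fun hP.eq y

/-- A compact projection has finite dimensional range. -/
lemma finiteDimensional_range_of_isCompactOperator {P : E →L[ℂ] E} (hP : IsIdempotentElem P)
    (hc : IsCompactOperator P) : FiniteDimensional ℂ P.range := by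
  have hmem : ∀ x ∈ P.range, P x ∈ P.range := range_invariant (Commute.refl P)
  have hcl : IsClosed (P.range : Set E) := by
    have : (P.range : Set E) = {x | P x = x} := by
      ext x
      exact ⟨fun hx => apply_of_mem_range hP hx, fun hx => ⟨x, hx⟩⟩
    rw [this]
    exact isClosed_eq P.continuous continuous_id
  have h1 : IsCompactOperator ((P : E →ₗ[ℂ] E).restrict hmem) := hc.restrict hmem hcl
  have h2 : ⇑((P : E →ₗ[ℂ] E).restrict hmem) = id := by
    ext x
    exact apply_of_mem_range hP x.2
  rw [h2] at h1
  -- On its closed range `P` is both compact and the identity, so zero has a compact neighbourhood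
  -- there; translates of it serve every point, and Riesz's theorem applies.
  have hloc : LocallyCompactSpace P.range := by
    obtain ⟨K, hK, hK0⟩ := h1
    have : WeaklyLocallyCompactSpace P.range := by
      refine ⟨fun x => ⟨(fun y => x + y) '' K, hK.image (by fun_prop), ?_⟩⟩
      have : (fun y => x + y) '' K ∈ 𝓝 (x + 0) := by
        have := (Homeomorph.addLeft x).isOpenMap.image_mem_nhds (x := 0) hK0
        simpa using this
      simpa using this
    infer_instance
  exact FiniteDimensional.of_locallyCompactSpace ℂ

end Preliminaries

section Riesz

variable {Γ : ℝ → ℂ} {A : Type*} [NormedRing A] [NormedAlgebra ℂ A] [CompleteSpace A] {a : A}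

/-- The Riesz projection `-(1 / 2πi) ∮_Γ (a - ζ)⁻¹ dζ`. -/
noncomputable def rieszProj (Γ : ℝ → ℂ) (a : A) : A :=
  (-(2 * Real.pi * Complex.I)⁻¹ : ℂ) • contourIntegral Γ fun ζ => Ring.inverse (a - ζ • (1 : A))

/-- The weighted integral `-(1 / 2πi) ∮_Γ (ζ - w)⁻¹ (a - ζ)⁻¹ dζ`. -/
noncomputable def rieszAux (Γ : ℝ → ℂ) (a : A) (w : ℂ) : A :=
  (-(2 * Real.pi * Complex.I)⁻¹ : ℂ) •
    contourIntegral Γ fun ζ => (ζ - w)⁻¹ • Ring.inverse (a - ζ • (1 : A))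

lemma continuousOn_inverse_sub (h : contourTrace Γ ⊆ resolventSet ℂ a) :
    ContinuousOn (fun ζ : ℂ => Ring.inverse (a - ζ • (1 : A))) (contourTrace Γ) := by
  intro ζ hζ
  obtain ⟨u, hu⟩ := mem_resolventSet_iff_isUnit_sub.1 (h hζ)
  have h1 := NormedRing.inverse_continuousAt u
  rw [hu] at h1
  exact (ContinuousAt.comp (f := fun ζ : ℂ => a - ζ • (1 : A)) h1 (by fun_prop)).continuousWithinAt

lemma continuousOn_inv_sub {w : ℂ} (hw : w ∉ contourTrace Γ) :
    ContinuousOn (fun ζ : ℂ => (ζ - w)⁻¹) (contourTrace Γ) :=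
  ContinuousOn.inv₀ (by fun_prop) fun ζ hζ h0 => hw (by rwa [← sub_eq_zero.1 h0])

lemma contourIntegral_mul_left (hΓ : IsClosedContour Γ) (b : A) {F : ℂ → A}
    (hF : ContinuousOn F (contourTrace Γ)) :
    b * contourIntegral Γ F = contourIntegral Γ fun ζ => b * F ζ :=
  hΓ.map_contourIntegral (ContinuousLinearMap.mul ℂ A b) hF

lemma contourIntegral_mul_right (hΓ : IsClosedContour Γ) (b : A) {F : ℂ → A}
    (hF : ContinuousOn F (contourTrace Γ)) :
    contourIntegral Γ F * b = contourIntegral Γ fun ζ => F ζ * b :=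
  hΓ.map_contourIntegral ((ContinuousLinearMap.mul ℂ A).flip b) hF

lemma commute_contourIntegral (hΓ : IsClosedContour Γ) {b : A} {F : ℂ → A}
    (hF : ContinuousOn F (contourTrace Γ)) (h : ∀ ζ, Commute b (F ζ)) :
    Commute b (contourIntegral Γ F) := by
  rw [Commute, SemiconjBy, contourIntegral_mul_left hΓ b hF, contourIntegral_mul_right hΓ b hF]
  simp only [(h _).eq]

lemma commute_rieszProj (hΓ : IsClosedContour Γ) (h : contourTrace Γ ⊆ resolventSet ℂ a) {b : A}
    (hb : Commute b a) : Commute b (rieszProj Γ a) :=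
  (commute_contourIntegral hΓ (continuousOn_inverse_sub h)
    fun ζ => commute_inverse_sub hb ζ).smul_right _

lemma continuousOn_smul_inverse_sub (h : contourTrace Γ ⊆ resolventSet ℂ a) {w : ℂ}
    (hw : w ∉ contourTrace Γ) :
    ContinuousOn (fun ζ : ℂ => (ζ - w)⁻¹ • Ring.inverse (a - ζ • (1 : A))) (contourTrace Γ) :=
  (continuousOn_inv_sub hw).smul (continuousOn_inverse_sub h)

lemma commute_rieszAux (hΓ : IsClosedContour Γ) (h : contourTrace Γ ⊆ resolventSet ℂ a) {b : A}
    (hb : Commute b a) {w : ℂ} (hw : w ∉ contourTrace Γ) : Commute b (rieszAux Γ a w) :=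
  (commute_contourIntegral hΓ (continuousOn_smul_inverse_sub h hw)
    fun ζ => (commute_inverse_sub hb ζ).smul_right _).smul_right _

/-- Divide `(a - w) (a - ζ)⁻¹ = 1 + (ζ - w) (a - ζ)⁻¹` by `ζ - w` and integrate. This identity
drives the spectral separation: about points of winding number 0 it inverts `a - w` on the range of
the projection, about points of winding number 1 it does so, up to sign, on the kernel. -/
lemma sub_mul_rieszAux (hΓ : IsClosedContour Γ) (h : contourTrace Γ ⊆ resolventSet ℂ a) {w : ℂ}
    (hw : w ∉ contourTrace Γ) :
    (a - w • (1 : A)) * rieszAux Γ a w = rieszProj Γ a - windingNumber Γ w • (1 : A) := by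
  rw [rieszAux, mul_smul_comm,
    contourIntegral_mul_left hΓ _ (continuousOn_smul_inverse_sub h hw)]
  have h1 : EqOn (fun ζ : ℂ => (a - w • (1 : A)) * ((ζ - w)⁻¹ • Ring.inverse (a - ζ • (1 : A))))
      (fun ζ => Ring.inverse (a - ζ • (1 : A)) + (ζ - w)⁻¹ • (1 : A)) (contourTrace Γ) := by
    intro ζ hζ
    have hu := Ring.mul_inverse_cancel _ (mem_resolventSet_iff_isUnit_sub.1 (h hζ))
    have h0 : ζ - w ≠ 0 := fun h0 => hw (by rwa [← sub_eq_zero.1 h0])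
    have e : a - w • (1 : A) = (a - ζ • (1 : A)) + (ζ - w) • (1 : A) := by
      rw [sub_smul]; abel
    simp only
    rw [mul_smul_comm, e, add_mul, hu, smul_mul_assoc, one_mul, smul_add, smul_smul,
      inv_mul_cancel₀ h0, one_smul, add_comm]
  have hc : ContinuousOn (fun ζ : ℂ => (ζ - w)⁻¹ • (1 : A)) (contourTrace Γ) :=
    (continuousOn_inv_sub hw).smul continuousOn_const
  rw [contourIntegral_congr h1, hΓ.contourIntegral_add (continuousOn_inverse_sub h) hc, smul_add,
    contourIntegral_smul_const,
    ← smul_assoc, rieszProj, windingNumber, smul_eq_mul, neg_mul, neg_smul, neg_smul]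
  abel

/-- The same resolvent identity without the division; the leftover constant 1 integrates to zero
because the curve is closed. -/
lemma contourIntegral_weighted (hΓ : IsClosedContour Γ) (h : contourTrace Γ ⊆ resolventSet ℂ a)
    (w : ℂ) :
    (-(2 * Real.pi * Complex.I)⁻¹ : ℂ) • contourIntegral Γ
      (fun ζ => (ζ - w) • Ring.inverse (a - ζ • (1 : A))) = (a - w • (1 : A)) * rieszProj Γ a := by
  rw [rieszProj, mul_smul_comm, contourIntegral_mul_left hΓ _ (continuousOn_inverse_sub h)]
  have h1 : EqOn (fun ζ : ℂ => (a - w • (1 : A)) * Ring.inverse (a - ζ • (1 : A)))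
      (fun ζ => (ζ - w) • Ring.inverse (a - ζ • (1 : A)) + 1) (contourTrace Γ) := by
    intro ζ hζ
    have hu := Ring.mul_inverse_cancel _ (mem_resolventSet_iff_isUnit_sub.1 (h hζ))
    have e : a - w • (1 : A) = (a - ζ • (1 : A)) + (ζ - w) • (1 : A) := by
      rw [sub_smul]; abel
    simp only
    rw [e, add_mul, hu, smul_mul_assoc, one_mul, add_comm]
  have hc : ContinuousOn (fun ζ : ℂ => (ζ - w) • Ring.inverse (a - ζ • (1 : A)))
      (contourTrace Γ) := ContinuousOn.smul (by fun_prop) (continuousOn_inverse_sub h)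
  rw [contourIntegral_congr h1, hΓ.contourIntegral_add hc continuousOn_const,
    hΓ.contourIntegral_const, add_zero]

end Riesz

/-! ### Riesz projections of bounded operators: eigenvectors, separation of the spectrum,
compactness. -/

section RieszOperator

variable {Γ : ℝ → ℂ} {E : Type*} [NormedAddCommGroup E] [NormedSpace ℂ E] [CompleteSpace E]
  {L : E →L[ℂ] E}

/-- The two factors on the left of `sub_mul_rieszAux` commute, so `L - β` may act on `x` first and
gives zero; what remains is the right-hand side. -/
lemma rieszProj_apply_eigenvector (hΓ : IsClosedContour Γ)
    (h : contourTrace Γ ⊆ resolventSet ℂ L) {β : ℂ} (hβ : β ∉ contourTrace Γ) {x : E}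
    (hx : L x = β • x) : rieszProj Γ L x = windingNumber Γ β • x := by
  have h1 := sub_mul_rieszAux hΓ h hβ
  have hc : Commute (L - β • (1 : E →L[ℂ] E)) (rieszAux Γ L β) :=
    (commute_rieszAux hΓ h (Commute.refl L) hβ).sub_left
      ((Commute.one_left _).smul_left β)
  rw [hc.eq] at h1
  have h2 := congrArg (fun S : E →L[ℂ] E => S x) h1
  simp only [mul_apply_eq_comp, sub_apply,
    smul_apply, one_apply_eq_self, hx, sub_self, map_zero] at h2
  exact (sub_eq_zero.1 h2.symm)

lemma eigenvalue_notMem_trace (h : contourTrace Γ ⊆ resolventSet ℂ L) {β : ℂ} {x : E}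
    (hx0 : x ≠ 0) (hx : L x = β • x) : β ∉ contourTrace Γ := by
  intro hβ
  have hu := mem_resolventSet_iff_isUnit_sub.1 (h hβ)
  have := (ContinuousLinearMap.isUnit_iff_bijective.1 hu).1
  refine hx0 (this ?_)
  simp [hx]

/-- Spectral separation by a contour with idempotent Riesz projection. -/
lemma spectrumOn_rieszProj (hΓ : IsClosedContour Γ) (h : contourTrace Γ ⊆ resolventSet ℂ L)
    (hP : IsIdempotentElem (rieszProj Γ L)) :
    spectrumOn L (rieszProj Γ L).range = spectrum ℂ L ∩ contourInside Γ ∧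
    spectrumOn L (rieszProj Γ L).ker = spectrum ℂ L ∩ contourOutside Γ := by
  have hLP := commute_rieszProj hΓ h (Commute.refl L)
  have hS : ∀ w : ℂ, Commute (L - w • (1 : E →L[ℂ] E)) L := fun w =>
    (Commute.refl L).sub_left ((Commute.one_left _).smul_left w)
  have hSP : ∀ w : ℂ, Commute (L - w • (1 : E →L[ℂ] E)) (rieszProj Γ L) := fun w =>
    commute_rieszProj hΓ h (hS w)
  have hfun : ∀ w : ℂ, (fun x => L x - w • x) = ⇑(L - w • (1 : E →L[ℂ] E)) := by
    intro w; ext x; simp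
  -- regular points act bijectively on both subspaces
  have hreg : ∀ w : ℂ, w ∈ resolventSet ℂ L →
      w ∉ spectrumOn L (rieszProj Γ L).range ∧ w ∉ spectrumOn L (rieszProj Γ L).ker := by
    intro w hw
    have hu := mem_resolventSet_iff_isUnit_sub.1 hw
    have hc : Commute (Ring.inverse (L - w • (1 : E →L[ℂ] E))) (rieszProj Γ L) :=
      (commute_inverse (hSP w).symm).symm
    have e1 := Ring.mul_inverse_cancel _ hu
    have e2 := Ring.inverse_mul_cancel _ hu
    simp only [spectrumOn, mem_ofPred_eq, not_not, hfun]
    exact ⟨bijOn_of_inverse (range_invariant (hSP w)) (range_invariant hc)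
      (fun x _ => DFunLike.congr_fun e1 x) (fun x _ => DFunLike.congr_fun e2 x),
      bijOn_of_inverse (ker_invariant (hSP w)) (ker_invariant hc)
      (fun x _ => DFunLike.congr_fun e1 x) (fun x _ => DFunLike.congr_fun e2 x)⟩
  have hQ : ∀ w ∉ contourTrace Γ, ∀ x, (L - w • (1 : E →L[ℂ] E)) (rieszAux Γ L w x)
      = rieszProj Γ L x - windingNumber Γ w • x := fun w hw x => by
    simpa using DFunLike.congr_fun (sub_mul_rieszAux hΓ h hw) x
  have hQ' : ∀ w ∉ contourTrace Γ, ∀ x, rieszAux Γ L w ((L - w • (1 : E →L[ℂ] E)) x)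
      = rieszProj Γ L x - windingNumber Γ w • x := fun w hw x => by
    rw [← hQ w hw]
    exact (DFunLike.congr_fun (commute_rieszAux hΓ h (hS w) hw).eq x).symm
  have hQP : ∀ w ∉ contourTrace Γ, Commute (rieszAux Γ L w) (rieszProj Γ L) := fun w hw =>
    commute_rieszProj hΓ h (commute_rieszAux hΓ h (Commute.refl L) hw).symm
  -- On the range the projection is the identity, so with winding number 0 the identity `hQ` says
  -- that `rieszAux` inverts `L - w`.
  have hout : ∀ w ∈ contourOutside Γ, w ∉ spectrumOn L (rieszProj Γ L).range := by
    intro w hw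
    simp only [spectrumOn, mem_ofPred_eq, not_not, hfun]
    refine bijOn_of_inverse (range_invariant (hSP w)) (range_invariant (hQP w hw.1))
      (fun x hx => ?_) (fun x hx => ?_)
    · rw [hQ w hw.1, hw.2, zero_smul, sub_zero, apply_of_mem_range hP hx]
    · rw [hQ' w hw.1, hw.2, zero_smul, sub_zero, apply_of_mem_range hP hx]
  -- On the kernel the projection is zero, so with winding number 1 the right-hand side of `hQ` is
  -- `-x`; hence the sign in the inverse.
  have hin : ∀ w ∈ contourInside Γ, w ∉ spectrumOn L (rieszProj Γ L).ker := by
    intro w hw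
    simp only [spectrumOn, mem_ofPred_eq, not_not, hfun]
    refine bijOn_of_inverse (Q := -rieszAux Γ L w) (ker_invariant (hSP w))
      (ker_invariant (hQP w hw.1).neg_left) (fun x hx => ?_) (fun x hx => ?_)
    · have hx' : rieszProj Γ L x = 0 := hx
      rw [neg_apply, map_neg, hQ w hw.1, hw.2, hx', one_smul, zero_sub, neg_neg]
    · have hx' : rieszProj Γ L x = 0 := hx
      rw [neg_apply, hQ' w hw.1, hw.2, hx', one_smul, zero_sub, neg_neg]
  -- Since the projection is idempotent, every vector splits into a part in the range and a part in
  -- the kernel, and `L - w` respects the splitting.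
  have hboth : ∀ w : ℂ, w ∉ spectrumOn L (rieszProj Γ L).range →
      w ∉ spectrumOn L (rieszProj Γ L).ker → w ∉ spectrum ℂ L := by
    intro w h1 h2
    simp only [spectrumOn, mem_ofPred_eq, not_not, hfun] at h1 h2
    rw [spectrum, mem_compl_iff, not_not, mem_resolventSet_iff_isUnit_sub,
      ContinuousLinearMap.isUnit_iff_bijective]
    have hker : ∀ x : E, x - rieszProj Γ L x ∈ (rieszProj Γ L).ker := by
      intro x
      have := DFunLike.congr_fun hP.eq x
      simp only [mul_apply_eq_comp] at this
      change rieszProj Γ L (x - rieszProj Γ L x) = 0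
      rw [map_sub, this, sub_self]
    constructor
    · rw [injective_iff_map_eq_zero]
      intro x hx
      have hPx : rieszProj Γ L x = 0 := by
        refine h1.injOn ⟨x, rfl⟩ (zero_mem _) ?_
        have := DFunLike.congr_fun (hSP w).eq x
        simp only [mul_apply_eq_comp] at this
        exact this.trans (by rw [hx, map_zero, map_zero])
      exact h2.injOn hPx (zero_mem _) (by rw [hx, map_zero])
    · intro y
      obtain ⟨x₁, -, hx₁⟩ := h1.surjOn (show rieszProj Γ L y ∈ _ from ⟨y, rfl⟩)
      obtain ⟨x₂, -, hx₂⟩ := h2.surjOn (hker y)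
      exact ⟨x₁ + x₂, by rw [map_add, hx₁, hx₂]; abel⟩
  constructor
  · ext w
    constructor
    · intro hw
      have hsp : w ∈ spectrum ℂ L := fun hr => (hreg w hr).1 hw
      have hΓw : w ∉ contourTrace Γ := fun hh => hsp (h hh)
      refine ⟨hsp, hΓw, (hΓ.winding w hΓw).resolve_left fun h0 => hout w ⟨hΓw, h0⟩ hw⟩
    · rintro ⟨hsp, hw⟩
      by_contra hcon
      exact hboth w hcon (hin w hw) hsp
  · ext w
    constructor
    · intro hw
      have hsp : w ∈ spectrum ℂ L := fun hr => (hreg w hr).2 hw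
      have hΓw : w ∉ contourTrace Γ := fun hh => hsp (h hh)
      refine ⟨hsp, hΓw, (hΓ.winding w hΓw).resolve_right fun h0 => hin w ⟨hΓw, h0⟩ hw⟩
    · rintro ⟨hsp, hw⟩
      by_contra hcon
      exact hboth w (hout w hw) hcon hsp

/-- If the origin is outside the contour, the Riesz projection of a compact operator is compact. -/
theorem isCompactOperator_rieszProj (hΓ : IsClosedContour Γ) (h : contourTrace Γ ⊆ resolventSet ℂ L)
    (hL : IsCompactOperator L) (h0 : (0 : ℂ) ∈ contourOutside Γ) :
    IsCompactOperator (rieszProj Γ L : E →L[ℂ] E) := by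
  have h1 := sub_mul_rieszAux hΓ h h0.1
  rw [h0.2, zero_smul, sub_zero, sub_zero] at h1
  rw [← h1]
  exact hL.comp_clm (rieszAux Γ L 0)

end RieszOperator

/-! ### Riesz projections of compact self-adjoint operators. -/

section SelfAdjoint

variable {Γ : ℝ → ℂ} {E : Type*} [NormedAddCommGroup E] [InnerProductSpace ℂ E] [CompleteSpace E]
  {L : E →L[ℂ] E}

/-- Two bounded operators agreeing on all eigenvectors of a compact self-adjoint operator agree. -/
lemma eq_zero_of_apply_eigenvector (hL : IsCompactOperator L)
    (hs : (L : E →ₗ[ℂ] E).IsSymmetric) {S : E →L[ℂ] E}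
    (hS : ∀ (β : ℂ) (x : E), L x = β • x → S x = 0) : S = 0 := by
  -- By the spectral theorem no nonzero vector is orthogonal to all eigenspaces; the closed subspace
  -- `S.ker` contains them, so it is everything.
  have h1 := ContinuousLinearMap.orthogonalComplement_iSup_eigenspaces_eq_bot hL hs
  have h2 : (⨆ μ, Module.End.eigenspace (L : Module.End ℂ E) μ) ≤ S.ker := by
    refine iSup_le fun β x hx => ?_
    rw [Module.End.mem_eigenspace_iff] at hx
    exact hS β x hx
  have h3 : S.kerᗮ = ⊥ := by
    rw [eq_bot_iff, ← h1]
    exact Submodule.orthogonal_le h2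
  have : CompleteSpace S.ker := S.isClosed_ker.completeSpace_coe
  rw [Submodule.orthogonal_eq_bot_iff] at h3
  ext x
  have : x ∈ S.ker := h3 ▸ Submodule.mem_top
  exact this

/-- On an eigenvector the projection is multiplication by the winding number of the eigenvalue, and
0 and 1 are their own squares. The usual proof compares two nested contours; here one contour
suffices. -/
lemma isIdempotentElem_rieszProj_of_isSymmetric (hΓ : IsClosedContour Γ)
    (h : contourTrace Γ ⊆ resolventSet ℂ L) (hL : IsCompactOperator L)
    (hs : (L : E →ₗ[ℂ] E).IsSymmetric) : IsIdempotentElem (rieszProj Γ L) := by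
  rw [IsIdempotentElem, ← sub_eq_zero]
  refine eq_zero_of_apply_eigenvector hL hs fun β x hx => ?_
  by_cases hx0 : x = 0
  · simp [hx0]
  have hβ := eigenvalue_notMem_trace h hx0 hx
  have h1 := rieszProj_apply_eigenvector hΓ h hβ hx
  simp only [sub_apply, mul_apply_eq_comp, h1, map_smul]
  rcases hΓ.winding β hβ with h0 | h0 <;> simp [h0]

/-- If `β₀` is the only point of the spectrum inside the contour, the Riesz projection maps into
the eigenspace. -/
lemma sub_mul_rieszProj_eq_zero (hΓ : IsClosedContour Γ)
    (h : contourTrace Γ ⊆ resolventSet ℂ L) (hL : IsCompactOperator L)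
    (hs : (L : E →ₗ[ℂ] E).IsSymmetric) {β₀ : ℂ}
    (hout : ∀ β ∈ spectrum ℂ L, β ≠ β₀ → β ∈ contourOutside Γ) :
    (L - β₀ • (1 : E →L[ℂ] E)) * rieszProj Γ L = 0 := by
  refine eq_zero_of_apply_eigenvector hL hs fun β x hx => ?_
  by_cases hx0 : x = 0
  · simp [hx0]
  have hβ := eigenvalue_notMem_trace h hx0 hx
  have h1 := rieszProj_apply_eigenvector hΓ h hβ hx
  simp only [mul_apply_eq_comp, h1, map_smul]
  -- Eigenvectors for `β₀` are killed by the factor `L - β₀`, all others by the winding number 0.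
  by_cases hb : β = β₀
  · subst hb
    simp [hx]
  · have hsp : β ∈ spectrum ℂ L := by
      rw [spectrum, mem_compl_iff, mem_resolventSet_iff_isUnit_sub,
        ContinuousLinearMap.isUnit_iff_bijective]
      intro hbij
      exact hx0 (hbij.1 (by simp [hx]))
    rw [(hout β hsp hb).2, zero_smul]

end SelfAdjoint

/-! ### Perturbation of inverses -/

section Perturbation

variable {A : Type*} [NormedRing A] [CompleteSpace A] {x y : A} {q : ℝ}

/-- The factorisation behind the Neumann series: inverting `x + y` reduces to inverting `1 - t` with
`t = -(y x⁻¹)`. -/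
lemma add_eq_one_sub_mul {A : Type*} [Ring A] {x y : A} (hx : IsUnit x) :
    x + y = (1 - -(y * Ring.inverse x)) * x := by
  rw [sub_neg_eq_add, add_mul, one_mul, mul_assoc, Ring.inverse_mul_cancel _ hx, mul_one]

lemma isUnit_add_of_norm_lt (hx : IsUnit x) (h : ‖y * Ring.inverse x‖ < 1) : IsUnit (x + y) := by
  rw [add_eq_one_sub_mul hx]
  exact (isUnit_one_sub_of_norm_lt_one (by rwa [norm_neg])).mul hx

lemma inverse_add_eq (hx : IsUnit x) (h : ‖y * Ring.inverse x‖ < 1) :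
    Ring.inverse (x + y) = Ring.inverse x * Ring.inverse (1 - -(y * Ring.inverse x)) := by
  have hu : IsUnit (1 - -(y * Ring.inverse x)) :=
    isUnit_one_sub_of_norm_lt_one (by rwa [norm_neg])
  nth_rewrite 1 [add_eq_one_sub_mul hx]
  obtain ⟨u, hu⟩ := hu
  obtain ⟨v, rfl⟩ := hx
  rw [← hu, ← Units.val_mul, Ring.inverse_unit, Ring.inverse_unit, Ring.inverse_unit, mul_inv_rev,
    Units.val_mul]

variable [NormOneClass A]

lemma norm_inverse_one_sub_le {t : A} (ht : ‖t‖ ≤ q) (hq : q < 1) :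
    ‖Ring.inverse (1 - t)‖ ≤ (1 - q)⁻¹ := by
  rw [← geom_series_eq_inverse t (ht.trans_lt hq)]
  refine (tsum_geometric_le_of_norm_lt_one t (ht.trans_lt hq)).trans ?_
  rw [norm_one, sub_self, zero_add]
  gcongr

lemma norm_inverse_add_le (hx : IsUnit x) (h : ‖y * Ring.inverse x‖ ≤ q) (hq : q < 1) :
    ‖Ring.inverse (x + y)‖ ≤ ‖Ring.inverse x‖ * (1 - q)⁻¹ := by
  rw [inverse_add_eq hx (h.trans_lt hq)]
  refine (norm_mul_le _ _).trans ?_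
  gcongr
  exact norm_inverse_one_sub_le (by rwa [norm_neg]) hq

/-- The remainder of the geometric series is exactly `t ^ N (1 - t)⁻¹` with `t = -(y x⁻¹)`. This is
the quantitative form of the Neumann series that yields uniform convergence. -/
lemma norm_inverse_add_sub_sum_le (hx : IsUnit x) (h : ‖y * Ring.inverse x‖ ≤ q) (hq : q < 1)
    (N : ℕ) :
    ‖Ring.inverse (x + y) - ∑ n ∈ Finset.range N, Ring.inverse x * (-(y * Ring.inverse x)) ^ n‖
      ≤ ‖Ring.inverse x‖ * (q ^ N * (1 - q)⁻¹) := by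
  have hq' := h.trans_lt hq
  rw [inverse_add_eq hx hq', ← Finset.mul_sum, ← mul_sub]
  refine (norm_mul_le _ _).trans ?_
  gcongr
  have e := NormedRing.inverse_one_sub_nth_order' N (t := -(y * Ring.inverse x)) (by rwa [norm_neg])
  have e2 : Ring.inverse (1 - -(y * Ring.inverse x))
      - ∑ n ∈ Finset.range N, (-(y * Ring.inverse x)) ^ n
      = (-(y * Ring.inverse x)) ^ N * Ring.inverse (1 - -(y * Ring.inverse x)) := by
    nth_rewrite 1 [e]
    abel
  rw [e2]
  refine (norm_mul_le _ _).trans ?_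
  gcongr
  · exact pow_nonneg ((norm_nonneg _).trans h) N
  · refine (norm_pow_le _ _).trans ?_
    gcongr
    rwa [norm_neg]
  · exact norm_inverse_one_sub_le (by rwa [norm_neg]) hq

end Perturbation

/-! ### Resolvent bound through the continuous functional calculus. -/

section NormalResolvent

/-- The norm of the resolvent of a normal element. -/
lemma norm_inverse_sub_le_of_isStarNormal {A : Type*} [CStarAlgebra A] (a : A) [IsStarNormal a]
    {ζ : ℂ} (hζ : ζ ∈ resolventSet ℂ a) (hne : (spectrum ℂ a).Nonempty) :
    ‖Ring.inverse (a - ζ • (1 : A))‖ ≤ (Metric.infDist ζ (spectrum ℂ a))⁻¹ := by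
  have hpos : 0 < Metric.infDist ζ (spectrum ℂ a) :=
    ((spectrum.isClosed (𝕜 := ℂ) a).notMem_iff_infDist_pos hne).1 (fun h => h hζ)
  have hbd : ∀ w ∈ spectrum ℂ a, Metric.infDist ζ (spectrum ℂ a) ≤ ‖w - ζ‖ := by
    intro w hw
    rw [← dist_eq_norm, dist_comm]
    exact Metric.infDist_le_dist_of_mem hw
  have hne0 : ∀ w ∈ spectrum ℂ a, w - ζ ≠ 0 := fun w hw h0 => by
    have := hbd w hw
    rw [h0, norm_zero] at this
    linarith
  have hc : ContinuousOn (fun w : ℂ => (w - ζ)⁻¹) (spectrum ℂ a) :=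
    ContinuousOn.inv₀ (by fun_prop) hne0
  have e1 : cfc (fun w : ℂ => w - ζ) a = a - ζ • (1 : A) := by
    rw [cfc_sub (fun w : ℂ => w) (fun _ => ζ) a, cfc_id' ℂ a, cfc_const ζ a,
      Algebra.algebraMap_eq_smul_one]
  -- The resolvent is thereby identified with the function `w ↦ (w - ζ)⁻¹` of `a`, whose supremum
  -- over the spectrum bounds the norm.
  have e2 : cfc (fun w : ℂ => (w - ζ)⁻¹) a * (a - ζ • (1 : A)) = 1 := by
    rw [← e1, ← cfc_mul _ _ a hc (by fun_prop), ← cfc_one ℂ a]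
    exact cfc_congr fun w hw => inv_mul_cancel₀ (hne0 w hw)
  have e3 : Ring.inverse (a - ζ • (1 : A)) = cfc (fun w : ℂ => (w - ζ)⁻¹) a := by
    have hu := mem_resolventSet_iff_isUnit_sub.1 hζ
    calc Ring.inverse (a - ζ • (1 : A))
        = cfc (fun w : ℂ => (w - ζ)⁻¹) a * (a - ζ • (1 : A)) * Ring.inverse (a - ζ • (1 : A)) := by
          rw [e2, one_mul]
      _ = _ := by rw [mul_assoc, Ring.mul_inverse_cancel _ hu, mul_one]
  rw [e3]
  refine norm_cfc_le (by positivity) fun w hw => ?_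
  rw [norm_inv]
  gcongr
  exact hbd w hw

end NormalResolvent

/-! ### Differentiation of the Riesz projection under the integral sign. -/

section Holomorphy

variable {Γ : ℝ → ℂ} {A : Type*} [NormedRing A] [NormedAlgebra ℂ A] [CompleteSpace A]

/-- Riesz projections of a holomorphic family are holomorphic. -/
lemma differentiableOn_rieszProj (hΓ : IsClosedContour Γ) {a : ℂ → A} {U : Set ℂ} (hU : IsOpen U)
    (ha : DifferentiableOn ℂ a U) (hres : ∀ z ∈ U, contourTrace Γ ⊆ resolventSet ℂ (a z)) {C : ℝ}
    (hC : ∀ z ∈ U, ∀ ζ ∈ contourTrace Γ, ‖Ring.inverse (a z - ζ • (1 : A))‖ ≤ C) :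
    DifferentiableOn ℂ (fun z => rieszProj Γ (a z)) U := by
  intro z₀ hz₀
  refine DifferentiableAt.differentiableWithinAt ?_
  have hC0 : 0 ≤ C := (norm_nonneg _).trans (hC z₀ hz₀ _ (nonempty_contourTrace Γ).some_mem)
  have hda : ContinuousAt (deriv a) z₀ :=
    ((ha.deriv hU).differentiableAt (hU.mem_nhds hz₀)).continuousAt
  -- The derivative of a holomorphic family is continuous, so `B` bounds it near `z₀`. The
  -- derivative of the resolvent is `-(a - ζ)⁻¹ a' (a - ζ)⁻¹`, which gives the dominating factor `C
  -- * B * C`.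
  set B := ‖deriv a z₀‖ + 1 with hB
  have hev : ∀ᶠ z in 𝓝 z₀, z ∈ U ∧ ‖deriv a z‖ ≤ B := by
    filter_upwards [hU.mem_nhds hz₀,
      hda.norm.eventually_lt_const (show ‖deriv a z₀‖ < B by linarith)] with z hz hz'
    exact ⟨hz, hz'.le⟩
  set F' : ℂ → ℝ → A := fun z t => deriv Γ t • -(Ring.inverse (a z - Γ t • (1 : A)) * deriv a z *
    Ring.inverse (a z - Γ t • (1 : A)))
  have hderiv : ∀ z ∈ U, ∀ t ∈ Icc (0 : ℝ) 1,
      HasDerivAt (fun z => deriv Γ t • Ring.inverse (a z - Γ t • (1 : A))) (F' z t) z := by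
    intro z hz t ht
    obtain ⟨u, hu⟩ := mem_resolventSet_iff_isUnit_sub.1 (hres z hz (mem_contourTrace ht))
    have h1 := hasFDerivAt_ringInverse (𝕜 := ℂ) u
    have h2 : HasDerivAt (fun z => a z - Γ t • (1 : A)) (deriv a z) z :=
      ((ha.differentiableAt (hU.mem_nhds hz)).hasDerivAt).sub_const _
    rw [hu] at h1
    have h3 := h1.comp_hasDerivAt z h2
    have h4 := h3.const_smul (deriv Γ t)
    have e : (↑u⁻¹ : A) = Ring.inverse (a z - Γ t • (1 : A)) := by rw [← hu, Ring.inverse_unit]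
    rw [e] at h4
    exact h4
  have key := intervalIntegral.hasDerivAt_integral_of_dominated_loc_of_deriv_le
    (F := fun z t => deriv Γ t • Ring.inverse (a z - Γ t • (1 : A))) (F' := F') (x₀ := z₀)
    (μ := volume) (a := (0 : ℝ)) (b := 1) (s := {z | z ∈ U ∧ ‖deriv a z‖ ≤ B})
    (bound := fun t => ‖deriv Γ t‖ * (C * B * C)) hev ?_ ?_ ?_ ?_ ?_ ?_
  · exact (key.2.differentiableAt).const_smul (-(2 * Real.pi * Complex.I)⁻¹ : ℂ)
  · filter_upwards [hev] with z hz
    exact (hΓ.intervalIntegrable_smul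
      (continuousOn_inverse_sub (hres z hz.1))).aestronglyMeasurable_restrict_uIoc
  · exact hΓ.intervalIntegrable_smul (continuousOn_inverse_sub (hres z₀ hz₀))
  · have hc := continuousOn_inverse_sub (hres z₀ hz₀)
    exact (hΓ.intervalIntegrable_smul (F := fun ζ => -(Ring.inverse (a z₀ - ζ • (1 : A)) *
      deriv a z₀ * Ring.inverse (a z₀ - ζ • (1 : A))))
      ((hc.mul continuousOn_const).mul hc).neg).aestronglyMeasurable_restrict_uIoc
  · refine Eventually.of_forall fun t ht z hz => ?_
    rw [uIoc_of_le zero_le_one] at ht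
    have hn := hC z hz.1 _ (mem_contourTrace (Ioc_subset_Icc_self ht))
    simp only [F']
    rw [norm_smul, norm_neg]
    gcongr
    refine (norm_mul_le _ _).trans ?_
    gcongr
    refine (norm_mul_le _ _).trans ?_
    gcongr
    exact hz.2
  · exact hΓ.intervalIntegrable_deriv.norm.mul_const _
  · refine Eventually.of_forall fun t ht z hz => ?_
    rw [uIoc_of_le zero_le_one] at ht
    exact hderiv z hz.1 t (Ioc_subset_Icc_self ht)

end Holomorphy

/-! ### Stability of the rank of projections. -/

section FiniteRank

variable {E : Type*} [NormedAddCommGroup E] [NormedSpace ℂ E]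

/-- `P` is injective on the range of `Q`: if `P x = 0` and `Q x = x`, then `‖x‖ ≤ ‖P - Q‖ ‖x‖`,
which forces `x = 0`. -/
lemma finrank_range_le_of_norm_sub_lt_one {P Q : E →L[ℂ] E} (hQ : IsIdempotentElem Q)
    [FiniteDimensional ℂ P.range] (h : ‖P - Q‖ < 1) :
    Module.finrank ℂ Q.range ≤ Module.finrank ℂ P.range := by
  let f : Q.range →ₗ[ℂ] P.range :=
    ((P : E →ₗ[ℂ] E).rangeRestrict).comp (Q.range).subtype
  refine LinearMap.finrank_le_finrank_of_injective (f := f) ?_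
  rw [injective_iff_map_eq_zero]
  intro x hx
  have h1 : P x = 0 := congrArg Subtype.val hx
  have h2 : Q x = x := apply_of_mem_range hQ x.2
  by_contra hx0
  have hpos : 0 < ‖(x : E)‖ := norm_pos_iff.2 fun h0 => hx0 (Subtype.ext h0)
  have h3 := (P - Q).le_opNorm x
  rw [sub_apply, h1, h2, zero_sub, norm_neg] at h3
  nlinarith

/-- The rank of a continuous family of finite rank projections is constant. -/
lemma finrank_range_eq_of_continuousOn {X : Type*} [TopologicalSpace X] {U : Set X}
    (hU : IsPreconnected U) {P : X → E →L[ℂ] E} (hP : ContinuousOn P U)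
    (hi : ∀ z ∈ U, IsIdempotentElem (P z)) (hf : ∀ z ∈ U, FiniteDimensional ℂ (P z).range)
    {z w : X} (hz : z ∈ U) (hw : w ∈ U) :
    Module.finrank ℂ (P z).range = Module.finrank ℂ (P w).range := by
  -- Nearby projections differ by less than 1 in norm, so the comparison applies both ways and the
  -- integer-valued rank is locally constant.
  have hc : ContinuousOn (fun z => Module.finrank ℂ (P z).range) U := by
    intro z hz
    rw [ContinuousWithinAt, nhds_discrete, tendsto_pure]
    have h1 := (hP z hz).eventually (Metric.ball_mem_nhds _ zero_lt_one)
    filter_upwards [h1, self_mem_nhdsWithin] with w hw hwU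
    rw [dist_eq_norm] at hw
    have := hf z hz
    have := hf w hwU
    exact le_antisymm (finrank_range_le_of_norm_sub_lt_one (hi w hwU) (by rwa [norm_sub_rev]))
      (finrank_range_le_of_norm_sub_lt_one (hi z hz) hw)
  exact hU.constant hc hz hw

end FiniteRank

/-! ### Diagonal operators for orthogonal families of subspaces -/

section Diagonal

variable {H : Type*} [NormedAddCommGroup H] [InnerProductSpace ℂ H]
  {ι : Type*} {V : ι → Submodule ℂ H} [∀ i, (V i).HasOrthogonalProjection]

lemma starProjection_eq_zero_of_isOrtho {U W : Submodule ℂ H} [U.HasOrthogonalProjection]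
    (h : U ⟂ W) {x : H} (hx : x ∈ W) : U.starProjection x = 0 :=
  (Submodule.starProjection_apply_eq_zero_iff U).2 (h.symm hx)

lemma norm_sq_sum_smul_starProjection (hV : Pairwise fun i j => V i ⟂ V j) (c : ι → ℂ) (u : H)
    (s : Finset ι) :
    ‖∑ i ∈ s, c i • (V i).starProjection u‖ ^ 2
      = ∑ i ∈ s, (‖c i‖ * ‖(V i).starProjection u‖) ^ 2 := by
  have h := (OrthogonalFamily.of_pairwise hV).norm_sum
    (fun i => c i • (⟨(V i).starProjection u, Submodule.starProjection_apply_mem _ u⟩ : V i)) s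
  simpa only [Submodule.coe_smul, Submodule.coe_norm, norm_smul] using! h

/-- Bessel's inequality: the partial sum `y` satisfies `‖y‖² = re ⟪y, u⟫ ≤ ‖y‖ ‖u‖`. -/
lemma sum_norm_sq_starProjection_le (hV : Pairwise fun i j => V i ⟂ V j) (u : H) (s : Finset ι) :
    ∑ i ∈ s, ‖(V i).starProjection u‖ ^ 2 ≤ ‖u‖ ^ 2 := by
  set y := ∑ i ∈ s, (V i).starProjection u with hy
  have h1 : ‖y‖ ^ 2 = ∑ i ∈ s, ‖(V i).starProjection u‖ ^ 2 := by
    simpa using norm_sq_sum_smul_starProjection hV (fun _ => 1) u s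
  have h2 : RCLike.re ⟪y, u⟫_ℂ = ∑ i ∈ s, ‖(V i).starProjection u‖ ^ 2 := by
    rw [hy, sum_inner, map_sum]
    refine Finset.sum_congr rfl fun i _ => ?_
    rw [Submodule.re_inner_starProjection_eq_normSq]
    simp
  rw [← h1]
  have h3 : ‖y‖ ^ 2 ≤ ‖y‖ * ‖u‖ := by
    rw [h1, ← h2]
    exact re_inner_le_norm y u
  have h4 : ‖y‖ ≤ ‖u‖ := by
    rcases (norm_nonneg y).eq_or_lt with h0 | h0
    · rw [← h0]; exact norm_nonneg u
    · nlinarith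
  gcongr

lemma norm_sum_smul_starProjection_le (hV : Pairwise fun i j => V i ⟂ V j) {c : ι → ℂ} {C : ℝ}
    (hC0 : 0 ≤ C) (hc : ∀ i, ‖c i‖ ≤ C) (u : H) (s : Finset ι) :
    ‖∑ i ∈ s, c i • (V i).starProjection u‖ ≤ C * ‖u‖ := by
  refine le_of_sq_le_sq ?_ (by positivity)
  rw [norm_sq_sum_smul_starProjection hV, mul_pow]
  calc ∑ i ∈ s, (‖c i‖ * ‖(V i).starProjection u‖) ^ 2
      ≤ ∑ i ∈ s, C ^ 2 * ‖(V i).starProjection u‖ ^ 2 := by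
        refine Finset.sum_le_sum fun i _ => ?_
        rw [mul_pow]
        gcongr
        exact hc i
    _ = C ^ 2 * ∑ i ∈ s, ‖(V i).starProjection u‖ ^ 2 := by rw [Finset.mul_sum]
    _ ≤ _ := by
        gcongr
        exact sum_norm_sq_starProjection_le hV u s

/-- By Pythagoras, convergence of an orthogonal series amounts to summability of the squared norms,
which Bessel's inequality bounds. The sum converges strongly, and its norm is controlled by the
largest coefficient and not by the sum of the coefficients. -/
lemma exists_diagonal [CompleteSpace H] (hV : Pairwise fun i j => V i ⟂ V j) {c : ι → ℂ} {C : ℝ}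
    (hC0 : 0 ≤ C) (hc : ∀ i, ‖c i‖ ≤ C) :
    ∃ L : H →L[ℂ] H, (∀ u, HasSum (fun i => c i • (V i).starProjection u) (L u)) ∧ ‖L‖ ≤ C := by
  have hs : ∀ u, Summable fun i => c i • (V i).starProjection u := by
    intro u
    have h1 : Summable fun i => (‖c i‖ * ‖(V i).starProjection u‖) ^ 2 := by
      refine summable_of_sum_le (fun i => sq_nonneg _) (c := (C * ‖u‖) ^ 2) fun s => ?_
      rw [← norm_sq_sum_smul_starProjection hV]
      gcongr
      exact norm_sum_smul_starProjection_le hV hC0 hc u s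
    have h2 := ((OrthogonalFamily.of_pairwise hV).summable_iff_norm_sq_summable
      (fun i => c i • (⟨(V i).starProjection u, Submodule.starProjection_apply_mem _ u⟩ : V i))).2
      (by simpa only [Submodule.coe_norm, Submodule.coe_smul, norm_smul] using! h1)
    exact h2
  let L : H →ₗ[ℂ] H :=
    { toFun := fun u => ∑' i, c i • (V i).starProjection u
      map_add' := fun u v => by
        rw [← (hs u).tsum_add (hs v)]
        simp only [map_add, smul_add]
      map_smul' := fun a u => by
        rw [RingHom.id_apply, ← (hs u).tsum_const_smul a]
        simp only [map_smul, smul_comm a] }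
  have hL : ∀ u, ‖L u‖ ≤ C * ‖u‖ := fun u =>
    le_of_tendsto (hs u).hasSum.norm
      (Eventually.of_forall fun s => norm_sum_smul_starProjection_le hV hC0 hc u s)
  exact ⟨L.mkContinuous C hL, fun u => (hs u).hasSum, L.mkContinuous_norm_le hC0 hL⟩

end Diagonal

lemma strongSum_hasSum {ι E : Type*} [NormedAddCommGroup E] [NormedSpace ℂ E] {f : ι → E →L[ℂ] E}
    (h : ∃ L : E →L[ℂ] E, ∀ u, HasSum (fun i => f i u) (L u)) (u : E) :
    HasSum (fun i => f i u) (strongSum f u) := by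
  rw [strongSum, dif_pos h]
  exact h.choose_spec u

/-! ### The resonance spaces -/

section Resonance

open EnergySpace

variable {d : ℕ} {D : Set (Pt d)}

lemma isSelfAdjoint_energyOn (s : Set (Pt d)) : IsSelfAdjoint (energyOn s) := by
  rw [IsSelfAdjoint, ContinuousLinearMap.star_eq_adjoint, energyOn,
    ContinuousLinearMap.adjoint_comp, ContinuousLinearMap.adjoint_adjoint]

lemma isSymmetric_T : (T D : EnergySpace d →ₗ[ℂ] EnergySpace d).IsSymmetric := by
  have h : IsSelfAdjoint (T D) := by
    have h2 : IsSelfAdjoint (1 / 2 : ℂ) := by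
      rw [isSelfAdjoint_iff, RCLike.star_def]
      simp [Complex.conj_ofNat]
    exact (h2.smul (isSelfAdjoint_energyOn _)).sub (h2.smul (isSelfAdjoint_energyOn _))
  exact h.isSymmetric

lemma mem_resonanceSpace {μ : ℝ} {u : EnergySpace d} :
    u ∈ resonanceSpace D μ ↔ u ∈ W3 D ∧ T D u = (μ : ℂ) • u := by
  rw [resonanceSpace, Submodule.mem_inf]
  refine and_congr_right fun _ => ?_
  rw [LinearMap.mem_ker]
  simp [sub_eq_zero]

lemma isOrtho_resonanceSpace {μ ν : ℝ} (h : μ ≠ ν) : resonanceSpace D μ ⟂ resonanceSpace D ν := by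
  rw [Submodule.isOrtho_iff_inner_eq]
  intro u hu v hv
  have h1 := isSymmetric_T (D := D) u v
  rw [ContinuousLinearMap.coe_coe, (mem_resonanceSpace.1 hu).2, (mem_resonanceSpace.1 hv).2,
    inner_smul_left,
    inner_smul_right, Complex.conj_ofReal] at h1
  have h2 : ((μ : ℂ) - ν) * ⟪u, v⟫_ℂ = 0 := by rw [sub_mul, h1, sub_self]
  refine (mul_eq_zero.1 h2).resolve_left fun h0 => h ?_
  exact_mod_cast sub_eq_zero.1 h0

lemma isOrtho_W1_resonanceSpace (μ : ℝ) : W1 D ⟂ resonanceSpace D μ := by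
  rw [Submodule.isOrtho_comm]
  refine inf_le_left.trans ?_
  exact Submodule.orthogonal_le le_sup_left

lemma isOrtho_W2_resonanceSpace (μ : ℝ) : W2 D ⟂ resonanceSpace D μ := by
  rw [Submodule.isOrtho_comm]
  refine inf_le_left.trans ?_
  exact Submodule.orthogonal_le le_sup_right

variable (D) in
/-- The subspaces `W₁`, the resonance space of `1/2`, and the inner resonance spaces. -/
noncomputable def spectralFamily : Option (Option (innerResonances D)) → Submodule ℂ (EnergySpace d)
  | none => W1 D
  | some none => resonanceSpace D (1 / 2)
  | some (some μ) => resonanceSpace D μ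

instance (i : Option (Option (innerResonances D))) :
    (spectralFamily D i).HasOrthogonalProjection := by
  rcases i with _ | _ | μ
  · exact inferInstanceAs (W1 D).HasOrthogonalProjection
  · exact inferInstanceAs (resonanceSpace D (1 / 2)).HasOrthogonalProjection
  · exact inferInstanceAs (resonanceSpace D μ).HasOrthogonalProjection

lemma pairwise_spectralFamily :
    Pairwise fun i j => spectralFamily D i ⟂ spectralFamily D j := by
  rintro (_ | _ | μ) (_ | _ | ν) h
  · exact absurd rfl h
  · exact isOrtho_W1_resonanceSpace _
  · exact isOrtho_W1_resonanceSpace _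
  · exact (isOrtho_W1_resonanceSpace _).symm
  · exact absurd rfl h
  · exact isOrtho_resonanceSpace ν.2.2.2.ne'
  · exact (isOrtho_W1_resonanceSpace _).symm
  · exact isOrtho_resonanceSpace μ.2.2.2.ne
  · exact isOrtho_resonanceSpace fun h0 => h (by rw [Subtype.ext h0])

lemma pairwise_resonanceSpace :
    Pairwise fun μ ν : innerResonances D => resonanceSpace D μ ⟂ resonanceSpace D ν :=
  fun _ _ h => isOrtho_resonanceSpace fun h0 => h (Subtype.ext h0)

/-- The coefficient `[(1/2 + μ) + z (1/2 - μ)]⁻¹`. -/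
noncomputable def resCoeff (z : ℂ) (μ : ℝ) : ℂ := ((1 / 2 + μ : ℂ) + z * (1 / 2 - μ : ℂ))⁻¹

/-- With `a = 1/2 + μ` and `b = 1/2 - μ` this is `(a + z b)⁻¹ (1 + z b/a) = a⁻¹`. It moves the
dependence on `z` into the factor `1 + z b/a`, from which holomorphy of the resonance sum is read
off. -/
lemma resCoeff_mul {z : ℂ} {μ : ℝ} (h0 : (1 / 2 + μ : ℂ) + 0 * (1 / 2 - μ : ℂ) ≠ 0)
    (hz : (1 / 2 + μ : ℂ) + z * (1 / 2 - μ : ℂ) ≠ 0) :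
    resCoeff z μ * (1 + z * ((1 / 2 - μ : ℂ) * resCoeff 0 μ)) = resCoeff 0 μ := by
  rw [resCoeff, resCoeff]
  generalize (1 / 2 + μ : ℂ) = a at *
  generalize (1 / 2 - μ : ℂ) = b at *
  rw [zero_mul, add_zero] at *
  field_simp

/-- The bound for the coefficients of the resonance sum. -/
noncomputable def coeffBound (μs r : ℝ) : ℝ := ((1 / 2 - μs) * (|zStar μs| - r))⁻¹

variable {μs : ℝ}

lemma abs_zStar (hμs : -(1 / 2) < μs) (hμs' : μs < 1 / 2) :
    (1 / 2 - μs) * |zStar μs| = 1 / 2 + μs := by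
  rw [zStar, abs_div, abs_of_pos (by linarith), abs_of_neg (by linarith : μs - 1 / 2 < 0)]
  have h1 : -(μs - 1 / 2) = 1 / 2 - μs := by ring
  have h2 : 1 / 2 - μs ≠ 0 := by linarith
  rw [h1, mul_div_cancel₀ _ h2, add_comm]

/-- The reverse triangle inequality gives the lower bound `(1/2 + μ) - |z| (1/2 - μ)`, which
increases with `μ`; at the smallest value `μ = μs` it equals the left-hand side. -/
lemma norm_resCoeff_denominator_ge (hμs : -(1 / 2) < μs) (hμs' : μs < 1 / 2) {μ : ℝ}
    (h : μs ≤ μ) (h' : μ < 1 / 2) (z : ℂ) :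
    (1 / 2 - μs) * (|zStar μs| - ‖z‖) ≤ ‖(1 / 2 + μ : ℂ) + z * (1 / 2 - μ : ℂ)‖ := by
  have e1 : ‖(1 / 2 + μ : ℂ)‖ = 1 / 2 + μ := by
    have : (1 / 2 + μ : ℂ) = ((1 / 2 + μ : ℝ) : ℂ) := by push_cast; ring
    rw [this, Complex.norm_real, Real.norm_eq_abs, abs_of_pos (by linarith)]
  have e2 : ‖(1 / 2 - μ : ℂ)‖ = 1 / 2 - μ := by
    have : (1 / 2 - μ : ℂ) = ((1 / 2 - μ : ℝ) : ℂ) := by push_cast; ring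
    rw [this, Complex.norm_real, Real.norm_eq_abs, abs_of_pos (by linarith)]
  have h1 := norm_sub_norm_le (1 / 2 + μ : ℂ) (-(z * (1 / 2 - μ : ℂ)))
  rw [sub_neg_eq_add, norm_neg, norm_mul, e1, e2] at h1
  refine le_trans ?_ h1
  rw [mul_sub, abs_zStar hμs hμs']
  nlinarith [norm_nonneg z]

lemma coeffBound_pos (hμs' : μs < 1 / 2) {r : ℝ} (hr : r < |zStar μs|) :
    0 < coeffBound μs r :=
  inv_pos.2 (mul_pos (by linarith) (by linarith))

/-- The reciprocal is `(1/2 + μs) - r (1/2 - μs) ≤ 1`. This makes the bound also cover the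
coefficient 1 with which `P₁` enters. -/
lemma one_le_coeffBound (hμs : -(1 / 2) < μs) (hμs' : μs < 1 / 2) {r : ℝ} (hr0 : 0 ≤ r)
    (hr : r < |zStar μs|) : 1 ≤ coeffBound μs r := by
  have h1 := mul_pos (by linarith : 0 < 1 / 2 - μs) (by linarith : 0 < |zStar μs| - r)
  refine (one_le_inv₀ h1).2 ?_
  rw [mul_sub, abs_zStar hμs hμs']
  nlinarith

lemma norm_resCoeff_le (hμs : -(1 / 2) < μs) (hμs' : μs < 1 / 2) {μ : ℝ}
    (h : μs ≤ μ) (h' : μ < 1 / 2) {z : ℂ} (hz : ‖z‖ < |zStar μs|) :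
    ‖resCoeff z μ‖ ≤ coeffBound μs ‖z‖ := by
  rw [resCoeff, norm_inv, coeffBound]
  have : 0 < (1 / 2 - μs) * (|zStar μs| - ‖z‖) := mul_pos (by linarith) (by linarith)
  gcongr
  exact norm_resCoeff_denominator_ge hμs hμs' h h' z

lemma resCoeff_denominator_ne_zero (hμs : -(1 / 2) < μs) (hμs' : μs < 1 / 2) {μ : ℝ}
    (h : μs ≤ μ) (h' : μ < 1 / 2) {z : ℂ} (hz : ‖z‖ < |zStar μs|) :
    (1 / 2 + μ : ℂ) + z * (1 / 2 - μ : ℂ) ≠ 0 := by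
  have h1 := norm_resCoeff_denominator_ge hμs hμs' h h' z
  have : 0 < (1 / 2 - μs) * (|zStar μs| - ‖z‖) := mul_pos (by linarith) (by linarith)
  exact norm_pos_iff.1 (this.trans_le h1)

lemma hasSum_resonanceSum (hμs : -(1 / 2) < μs) (hμs' : μs < 1 / 2)
    (hres : ∀ μ ∈ resonances D, μs ≤ μ) {z : ℂ} (hz : ‖z‖ < |zStar μs|) (u : EnergySpace d) :
    HasSum (fun μ : innerResonances D => resCoeff z μ • (resonanceSpace D μ).starProjection u)
      (resonanceSum D z u) := by
  refine strongSum_hasSum (f := fun μ : innerResonances D =>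
    resCoeff z μ • (resonanceSpace D μ).starProjection) ?_ u
  obtain ⟨L, hL, -⟩ := exists_diagonal (V := fun μ : innerResonances D => resonanceSpace D μ)
    pairwise_resonanceSpace (c := fun μ => resCoeff z μ) (coeffBound_pos hμs' hz).le
    fun μ => norm_resCoeff_le hμs hμs' (hres μ μ.2.1) μ.2.2.2 hz
  exact ⟨L, hL⟩

/-- The operator `P₁ + ∑ [(1/2 + μ) + z (1/2 - μ)]⁻¹ P_μ`. -/
noncomputable def energyPart (D : Set (Pt d)) (z : ℂ) : EnergySpace d →L[ℂ] EnergySpace d :=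
  P1 D + resonanceSum D z

lemma tendsto_energyPart (hμs : -(1 / 2) < μs) (hμs' : μs < 1 / 2)
    (hres : ∀ μ ∈ resonances D, μs ≤ μ) {z : ℂ} (hz : ‖z‖ < |zStar μs|) (u : EnergySpace d) :
    Tendsto (fun s : Finset (innerResonances D) => P1 D u +
      ∑ μ ∈ s, resCoeff z μ • (resonanceSpace D μ).starProjection u) atTop
      (𝓝 (energyPart D z u)) :=
  (hasSum_resonanceSum hμs hμs' hres hz u).const_add _

lemma norm_energyPart_le (hμs : -(1 / 2) < μs) (hμs' : μs < 1 / 2)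
    (hres : ∀ μ ∈ resonances D, μs ≤ μ) {z : ℂ} (hz : ‖z‖ < |zStar μs|) :
    ‖energyPart D z‖ ≤ coeffBound μs ‖z‖ := by
  refine ContinuousLinearMap.opNorm_le_bound _ (coeffBound_pos hμs' hz).le fun u => ?_
  refine le_of_tendsto (tendsto_energyPart hμs hμs' hres hz u).norm
    (Eventually.of_forall fun s => ?_)
  -- The two projections in `P1` join the resonance projections as members of one orthogonal family,
  -- with coefficient 1. The bound for finite partial sums passes to the strong limit.
  let c : Option (Option (innerResonances D)) → ℂ
    | none => 1
    | some none => 1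
    | some (some μ) => resCoeff z μ
  have h1 := norm_sum_smul_starProjection_le pairwise_spectralFamily (c := c)
    (coeffBound_pos hμs' hz).le ?_ u (Finset.insertNone (Finset.insertNone s))
  · rw [Finset.sum_insertNone, Finset.sum_insertNone] at h1
    have e : P1 D u + ∑ μ ∈ s, resCoeff z μ • (resonanceSpace D μ).starProjection u =
        (1 : ℂ) • (W1 D).starProjection u + ((1 : ℂ) • (resonanceSpace D (1 / 2)).starProjection u +
          ∑ μ ∈ s, resCoeff z μ • (resonanceSpace D μ).starProjection u) := by
      rw [P1, add_apply, one_smul, one_smul, add_assoc]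
    rw [e]
    exact h1
  · rintro (_ | _ | μ)
    · simpa [c] using one_le_coeffBound hμs hμs' (norm_nonneg z) hz
    · simpa [c] using one_le_coeffBound hμs hμs' (norm_nonneg z) hz
    · exact norm_resCoeff_le hμs hμs' (hres μ μ.2.1) μ.2.2.2 hz

/-- `W₁` and all resonance spaces are orthogonal to `W₂`. Together with the product in the other
order, this allows `1 - P₂` to be inserted on both sides of `energyPart`, where the Poincaré
constant improves. -/
lemma W2_starProjection_energyPart (h12 : W1 D ⟂ W2 D) (hμs : -(1 / 2) < μs) (hμs' : μs < 1 / 2)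
    (hres : ∀ μ ∈ resonances D, μs ≤ μ) {z : ℂ} (hz : ‖z‖ < |zStar μs|) :
    P2 D * energyPart D z = 0 := by
  ext1 u
  have h1 := ((P2 D).continuous.tendsto _).comp (tendsto_energyPart hμs hμs' hres hz u)
  refine tendsto_nhds_unique h1 (tendsto_const_nhds.congr fun s => ?_)
  have hr : ∀ μ : ℝ, P2 D ((resonanceSpace D μ).starProjection u) = 0 := fun μ =>
    starProjection_eq_zero_of_isOrtho (isOrtho_W2_resonanceSpace μ)
      (Submodule.starProjection_apply_mem _ u)
  have hW : P2 D ((W1 D).starProjection u) = 0 :=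
    starProjection_eq_zero_of_isOrtho h12.symm (Submodule.starProjection_apply_mem _ u)
  simp [P1, hr, hW]

lemma energyPart_W2_starProjection (h12 : W1 D ⟂ W2 D) (hμs : -(1 / 2) < μs) (hμs' : μs < 1 / 2)
    (hres : ∀ μ ∈ resonances D, μs ≤ μ) {z : ℂ} (hz : ‖z‖ < |zStar μs|) :
    energyPart D z * P2 D = 0 := by
  ext1 u
  refine tendsto_nhds_unique (tendsto_energyPart hμs hμs' hres hz (P2 D u))
    (tendsto_const_nhds.congr fun s => ?_)
  have hu : P2 D u ∈ W2 D := Submodule.starProjection_apply_mem _ u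
  have hr : ∀ μ : ℝ, (resonanceSpace D μ).starProjection (P2 D u) = 0 := fun μ =>
    starProjection_eq_zero_of_isOrtho (isOrtho_W2_resonanceSpace μ).symm hu
  have hW : (W1 D).starProjection (P2 D u) = 0 := starProjection_eq_zero_of_isOrtho h12 hu
  simp [P1, hr, hW]

/-- For real `z` the coefficients are real, so the partial sums are symmetric, and symmetry passes
to the strong limit. -/
lemma isSelfAdjoint_energyPart (hμs : -(1 / 2) < μs) (hμs' : μs < 1 / 2)
    (hres : ∀ μ ∈ resonances D, μs ≤ μ) {z : ℝ} (hz : ‖(z : ℂ)‖ < |zStar μs|) :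
    IsSelfAdjoint (energyPart D z) := by
  rw [ContinuousLinearMap.isSelfAdjoint_iff_isSymmetric]
  intro u v
  have h1 := (tendsto_energyPart hμs hμs' hres hz u).inner (tendsto_const_nhds (x := v)) (𝕜 := ℂ)
  have h2 := (tendsto_const_nhds (x := u)).inner (tendsto_energyPart hμs hμs' hres hz v) (𝕜 := ℂ)
  refine tendsto_nhds_unique h1 (h2.congr fun s => ?_)
  have hc : ∀ μ : ℝ, (starRingEnd ℂ) (resCoeff z μ) = resCoeff z μ := fun μ => by
    simp [resCoeff, Complex.conj_ofNat]
  simp only [P1, add_apply, inner_add_left, inner_add_right, sum_inner, inner_sum, inner_smul_left,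
    inner_smul_right, hc, Submodule.inner_starProjection_left_eq_right]

/-- The resonance sum is holomorphic. -/
lemma differentiableOn_resonanceSum (hμs : -(1 / 2) < μs) (hμs' : μs < 1 / 2)
    (hres : ∀ μ ∈ resonances D, μs ≤ μ) :
    DifferentiableOn ℂ (resonanceSum D) (Metric.ball 0 |zStar μs|) := by
  have hz0 : 0 < |zStar μs| := by
    have := abs_zStar hμs hμs'
    by_contra h
    nlinarith
  -- The diagonal operator `G` with entries `(1/2 - μ) / (1/2 + μ)` has norm at most `1 / |z*|`, so
  -- `1 + z G` is invertible in the disc and the sum at `z` is the sum at 0 times `(1 + z G)⁻¹`.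
  -- Holomorphy in operator norm follows although the series is only known to converge strongly.
  let g : innerResonances D → ℂ := fun μ => (1 / 2 - (μ : ℝ) : ℂ) * resCoeff 0 μ
  have hg : ∀ μ, ‖g μ‖ ≤ |zStar μs|⁻¹ := by
    intro μ
    have h1 := norm_resCoeff_le hμs hμs' (hres μ μ.2.1) μ.2.2.2 (z := 0) (by simpa using hz0)
    have hμ := hres μ μ.2.1
    have e2 : ‖(1 / 2 - (μ : ℝ) : ℂ)‖ = 1 / 2 - (μ : ℝ) := by
      have : (1 / 2 - (μ : ℝ) : ℂ) = ((1 / 2 - (μ : ℝ) : ℝ) : ℂ) := by push_cast; ring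
      rw [this, Complex.norm_real, Real.norm_eq_abs, abs_of_pos (by linarith [μ.2.2.2])]
    rw [coeffBound, norm_zero, sub_zero, mul_inv] at h1
    simp only [g]
    rw [norm_mul, e2]
    calc (1 / 2 - (μ : ℝ)) * ‖resCoeff 0 μ‖
        ≤ (1 / 2 - μs) * ((1 / 2 - μs)⁻¹ * |zStar μs|⁻¹) := by
          gcongr
      _ = |zStar μs|⁻¹ := by
          rw [← mul_assoc, mul_inv_cancel₀ (by linarith), one_mul]
  obtain ⟨G, hG, hGn⟩ := exists_diagonal (V := fun μ : innerResonances D => resonanceSpace D μ)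
    pairwise_resonanceSpace (by positivity) hg
  have hPG : ∀ (μ : innerResonances D) (v : EnergySpace d),
      (resonanceSpace D μ).starProjection (G v) = g μ • (resonanceSpace D μ).starProjection v := by
    intro μ v
    have h1 := (hG v).mapL ((resonanceSpace D μ).starProjection)
    refine h1.unique ?_
    convert hasSum_single μ ?_ using 1
    · have := Submodule.starProjection_eq_self_iff.2
        (Submodule.starProjection_apply_mem (resonanceSpace D μ) v)
      rw [map_smul, this]
    · intro ν hν
      rw [map_smul, starProjection_eq_zero_of_isOrtho (pairwise_resonanceSpace hν.symm)
        (Submodule.starProjection_apply_mem _ v), smul_zero]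
  have hunit : ∀ z ∈ Metric.ball (0 : ℂ) |zStar μs|,
      IsUnit (1 + z • G : EnergySpace d →L[ℂ] EnergySpace d) := by
    intro z hz
    rw [mem_ball_zero_iff] at hz
    have : ‖-(z • G)‖ < 1 := by
      rw [norm_neg, norm_smul]
      calc ‖z‖ * ‖G‖ ≤ ‖z‖ * |zStar μs|⁻¹ := by gcongr
        _ < |zStar μs| * |zStar μs|⁻¹ := by gcongr
        _ = 1 := mul_inv_cancel₀ hz0.ne'
    simpa using isUnit_one_sub_of_norm_lt_one this
  have heq : EqOn (resonanceSum D) (fun z => resonanceSum D 0 * Ring.inverse (1 + z • G))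
      (Metric.ball 0 |zStar μs|) := by
    intro z hz
    ext1 u
    have hu := Ring.mul_inverse_cancel _ (hunit z hz)
    have hz' : ‖z‖ < |zStar μs| := by simpa using hz
    set v := Ring.inverse (1 + z • G) u with hv
    have huv : u = v + z • G v := by
      have := DFunLike.congr_fun hu u
      simpa using this.symm
    refine (hasSum_resonanceSum hμs hμs' hres hz' u).unique ?_
    have h0 := hasSum_resonanceSum hμs hμs' hres (z := 0) (by simpa using hz0) v
    refine HasSum.congr_fun h0 fun μ => ?_
    have hn0 := resCoeff_denominator_ne_zero hμs hμs' (hres μ μ.2.1) μ.2.2.2 (z := 0)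
      (by simpa using hz0)
    have hnz := resCoeff_denominator_ne_zero hμs hμs' (hres μ μ.2.1) μ.2.2.2 hz'
    rw [huv, map_add, map_smul, hPG, smul_smul,
      ← one_smul ℂ ((resonanceSpace D μ).starProjection v),
      smul_smul, smul_smul, ← add_smul, smul_smul]
    congr 1
    simp only [mul_one]
    exact resCoeff_mul hn0 hnz
  refine DifferentiableOn.congr (fun z hz => ?_) heq
  refine DifferentiableAt.differentiableWithinAt ?_
  have h1 : DifferentiableAt ℂ
      (fun z : ℂ => (1 + z • G : EnergySpace d →L[ℂ] EnergySpace d)) z := by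
    fun_prop
  exact ((differentiableAt_inverse (𝕜 := ℂ) (hunit z hz)).comp z h1).const_mul _

end Resonance

/-! ### Cosine coefficients and compactness of the embedding -/

section Embedding

open EnergySpace

variable {d : ℕ}

lemma hasSum_norm_sq_inner_cosL2 (v : L2 d) :
    HasSum (fun n : Fin d → ℕ => ‖⟪cosL2 n, v⟫_ℂ‖ ^ 2) (‖v‖ ^ 2) := by
  have hb : ⇑(cosBasis d) = cosL2 := HilbertBasis.coe_mkOfOrthogonalEqBot _ _
  rw [← Complex.hasSum_ofReal]
  have e2 : ((‖v‖ ^ 2 : ℝ) : ℂ) = ⟪v, v⟫_ℂ := by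
    rw [inner_self_eq_norm_sq_to_K]; norm_cast
  rw [e2]
  refine ((cosBasis d).hasSum_inner_mul_inner v v).congr_fun fun n => ?_
  rw [hb, ← inner_conj_symm v (cosL2 n), Complex.conj_mul']
  norm_cast

lemma eq_zero_of_inner_cosL2 {v : L2 d} (h : ∀ n : Fin d → ℕ, ⟪cosL2 n, v⟫_ℂ = 0) : v = 0 := by
  have h1 := hasSum_norm_sq_inner_cosL2 v
  simp only [h, norm_zero, zero_pow two_ne_zero] at h1
  have h2 := h1.unique hasSum_zero
  rwa [sq_eq_zero_iff, norm_eq_zero] at h2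

lemma inner_cosL2_zero (u : EnergySpace d) : ⟪cosL2 (0 : Fin d → ℕ), toL2 u⟫_ℂ = 0 := by
  rw [inner_cosL2]
  simpa [tensor, cosFam, cosN] using mem_meanZero.1 (toL2_mem u)

/-- Bessel's inequality for the gradient. -/
lemma sum_sq_mul_norm_inner_cosL2_le (u : EnergySpace d) (s : Finset (Fin d → ℕ)) :
    Real.pi ^ 2 * ∑ n ∈ s, (∑ j, (n j : ℝ) ^ 2) * ‖⟪cosL2 n, toL2 u⟫_ℂ‖ ^ 2 ≤ ‖u‖ ^ 2 := by
  -- Pairs with `n j = 0` are left out because their sine field is zero; the corresponding terms `(n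
  -- j)²` on the left vanish as well.
  have horth : Orthonormal ℂ fun p : {p : (Fin d → ℕ) × Fin d // p.1 p.2 ≠ 0} =>
      sinL2 p.1.2 p.1.1 := by
    rw [orthonormal_iff_ite]
    intro p q
    rw [inner_sinL2_sinL2 _ _ _ _ p.2]
    congr 1
    rw [eq_iff_iff, and_comm, ← Prod.ext_iff, Subtype.ext_iff]
  have h1 := horth.sum_inner_products_le (grad u)
    (s := (s ×ˢ Finset.univ).subtype fun p : (Fin d → ℕ) × Fin d => p.1 p.2 ≠ 0)
  rw [Finset.sum_subtype_eq_sum_filter (s := s ×ˢ Finset.univ)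
    (p := fun p : (Fin d → ℕ) × Fin d => p.1 p.2 ≠ 0)
    (f := fun p : (Fin d → ℕ) × Fin d => ‖⟪sinL2 p.2 p.1, grad u⟫_ℂ‖ ^ 2)] at h1
  refine le_trans (le_of_eq ?_) h1
  have hterm : ∀ p : (Fin d → ℕ) × Fin d, p.1 p.2 ≠ 0 → ‖⟪sinL2 p.2 p.1, grad u⟫_ℂ‖ ^ 2
      = Real.pi ^ 2 * ((p.1 p.2 : ℝ) ^ 2 * ‖⟪cosL2 p.1, toL2 u⟫_ℂ‖ ^ 2) := by
    intro p hp
    have e := congrArg norm ((isWeakGradient_grad u).inner_cos p.2 p.1)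
    rw [norm_neg, norm_mul, norm_mul, Complex.norm_natCast, Complex.norm_real, Real.norm_eq_abs,
      abs_of_pos Real.pi_pos] at e
    rw [← e]
    ring
  rw [Finset.sum_congr rfl fun p hp => hterm p (Finset.mem_filter.1 hp).2, Finset.sum_filter_of_ne,
    Finset.sum_product, Finset.mul_sum]
  · refine Finset.sum_congr rfl fun n _ => ?_
    rw [Finset.sum_mul, Finset.mul_sum]
  · intro p _ hp h0
    exact hp (by rw [h0]; simp)

/-- The embedding of the energy space into `L²(Y)`. -/
noncomputable def embL2 (d : ℕ) : EnergySpace d →L[ℂ] L2 d := (meanZero d).subtypeL ∘L toL20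

lemma embL2_apply (u : EnergySpace d) : embL2 d u = toL2 u := rfl

/-- Truncated cosine expansion. -/
noncomputable def cosTrunc (d N : ℕ) : EnergySpace d →L[ℂ] L2 d :=
  ∑ n ∈ Fintype.piFinset fun _ : Fin d => Finset.range N,
    ((innerSL ℂ (cosL2 n)) ∘L embL2 d).smulRight (cosL2 n)

lemma isCompactOperator_smulRight {E F : Type*} [NormedAddCommGroup E] [NormedSpace ℂ E]
    [NormedAddCommGroup F] [NormedSpace ℂ F] (f : E →L[ℂ] ℂ) (y : F) :
    IsCompactOperator (f.smulRight y) := by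
  have h : IsCompactOperator (f : E → ℂ) :=
    isCompactOperator_of_locallyCompactSpace_dom f
  exact h.clm_comp (ContinuousLinearMap.toSpanSingleton ℂ y)

lemma isCompactOperator_cosTrunc (N : ℕ) : IsCompactOperator (cosTrunc d N) := by
  rw [cosTrunc]
  exact Submodule.sum_mem (compactOperator (RingHom.id ℂ) (EnergySpace d) (L2 d))
    fun n _ => isCompactOperator_smulRight _ _

/-- Every discarded mode has some `n j ≥ N`, so its weight `∑ (n j)²` in the gradient Bessel
inequality is at least `N²`. The factor `π²` is not needed and is dropped through `1 ≤ π`. -/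
lemma norm_embL2_sub_cosTrunc_le {N : ℕ} (hN : 0 < N) : ‖embL2 d - cosTrunc d N‖ ≤ 1 / N := by
  refine ContinuousLinearMap.opNorm_le_bound _ (by positivity) fun u => ?_
  set v := (embL2 d - cosTrunc d N) u with hv
  have hN' : (0 : ℝ) < N := by exact_mod_cast hN
  have hpi : 1 ≤ Real.pi := by linarith [Real.pi_gt_three]
  have hcoef : ∀ n : Fin d → ℕ, ⟪cosL2 n, v⟫_ℂ =
      if n ∈ Fintype.piFinset fun _ : Fin d => Finset.range N then 0 else ⟪cosL2 n, toL2 u⟫_ℂ := by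
    intro n
    have horth := orthonormal_iff_ite.1 (orthonormal_cosL2 d)
    rw [hv, sub_apply, embL2_apply, cosTrunc, inner_sub_right, sum_apply, inner_sum]
    simp only [ContinuousLinearMap.smulRight_apply, ContinuousLinearMap.comp_apply,
      innerSL_apply_apply,
      embL2_apply, inner_smul_right, horth, mul_ite, mul_one, mul_zero, Finset.sum_ite_eq]
    split_ifs <;> simp
  have hterm : ∀ n : Fin d → ℕ, ‖⟪cosL2 n, v⟫_ℂ‖ ^ 2
      ≤ (1 / N : ℝ) ^ 2 * ((∑ j, (n j : ℝ) ^ 2) * ‖⟪cosL2 n, toL2 u⟫_ℂ‖ ^ 2) := by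
    intro n
    rw [hcoef]
    split_ifs with h
    · rw [norm_zero, zero_pow two_ne_zero]; positivity
    · rw [Fintype.mem_piFinset] at h
      push Not at h
      obtain ⟨j, hj⟩ := h
      rw [Finset.mem_range, not_lt] at hj
      have h1 : (N : ℝ) ^ 2 ≤ ∑ j, (n j : ℝ) ^ 2 :=
        le_trans (by gcongr) (Finset.single_le_sum (f := fun j => (n j : ℝ) ^ 2)
          (fun i _ => sq_nonneg _) (Finset.mem_univ j))
      rw [← mul_assoc]
      refine le_mul_of_one_le_left (sq_nonneg _) ?_
      rw [one_div, inv_pow, inv_mul_eq_div, one_le_div (by positivity)]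
      exact h1
  refine le_of_sq_le_sq (hasSum_le_of_sum_le (hasSum_norm_sq_inner_cosL2 v) fun s => ?_)
    (by positivity)
  have hb := sum_sq_mul_norm_inner_cosL2_le u s
  have hnn : 0 ≤ ∑ n ∈ s, (∑ j, (n j : ℝ) ^ 2) * ‖⟪cosL2 n, toL2 u⟫_ℂ‖ ^ 2 := by positivity
  calc ∑ n ∈ s, ‖⟪cosL2 n, v⟫_ℂ‖ ^ 2
      ≤ ∑ n ∈ s, (1 / N : ℝ) ^ 2 * ((∑ j, (n j : ℝ) ^ 2) * ‖⟪cosL2 n, toL2 u⟫_ℂ‖ ^ 2) :=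
        Finset.sum_le_sum fun n _ => hterm n
    _ = (1 / N : ℝ) ^ 2 * ∑ n ∈ s, (∑ j, (n j : ℝ) ^ 2) * ‖⟪cosL2 n, toL2 u⟫_ℂ‖ ^ 2 := by
        rw [Finset.mul_sum]
    _ ≤ (1 / N : ℝ) ^ 2 * ‖u‖ ^ 2 := by
        gcongr
        refine le_trans ?_ hb
        exact le_mul_of_one_le_left hnn (one_le_pow₀ hpi)
    _ = (1 / N * ‖u‖) ^ 2 := by ring

/-- Rellich's theorem on the unit cell. -/
theorem isCompactOperator_toL20 : IsCompactOperator (toL20 (d := d)) := by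
  have h1 : Tendsto (fun N : ℕ => cosTrunc d N) atTop (𝓝 (embL2 d)) := by
    refine (tendsto_iff_norm_sub_tendsto_zero (E := EnergySpace d →L[ℂ] L2 d)).2 ?_
    refine squeeze_zero' (Eventually.of_forall fun N => norm_nonneg (cosTrunc d N - embL2 d)) ?_
      tendsto_one_div_atTop_nhds_zero_nat
    filter_upwards [eventually_gt_atTop 0] with N hN
    exact (norm_sub_rev (cosTrunc d N) (embL2 d)).trans_le (norm_embL2_sub_cosTrunc_le hN)
  have h2 : IsCompactOperator (embL2 d) :=
    isCompactOperator_of_tendsto h1 (Eventually.of_forall isCompactOperator_cosTrunc)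
  exact h2.codRestrict (fun u => toL2_mem u) (isClosed_meanZero d)

lemma norm_toL20_le (u : EnergySpace d) : ‖toL20 u‖ ≤ Real.pi⁻¹ * ‖u‖ := norm_toL2_le u

lemma opNorm_toL20_le : ‖toL20 (d := d)‖ ≤ Real.pi⁻¹ :=
  ContinuousLinearMap.opNorm_le_bound _ (by positivity) norm_toL20_le

lemma toL20_injective : Function.Injective (toL20 (d := d)) := by
  intro u v h
  have h2 : (toL20 u : L2 d) = toL20 v := by rw [h]
  exact toL2_injective h2

/-- In the equality case of Poincaré's inequality only the first modes are present. -/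
lemma inner_cosL2_eq_zero_of_poincare_eq {u : EnergySpace d} (h : Real.pi⁻¹ * ‖u‖ ≤ ‖toL2 u‖)
    {n : Fin d → ℕ} (hn : ∀ j, n ≠ Pi.single j 1) : ⟪cosL2 n, toL2 u⟫_ℂ = 0 := by
  by_cases hn0 : n = 0
  · rw [hn0, inner_cosL2_zero]
  have hint : ∀ m : Fin d → ℕ, m ≠ 0 → 1 ≤ ∑ j, (m j) ^ 2 := by
    intro m hm
    obtain ⟨j, hj⟩ := Function.ne_iff.1 hm
    refine le_trans (Nat.one_le_iff_ne_zero.2 (pow_ne_zero 2 hj)) ?_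
    exact Finset.single_le_sum (f := fun j => (m j) ^ 2) (fun _ _ => Nat.zero_le _)
      (Finset.mem_univ j)
  have htwo : 2 ≤ ∑ j, (n j) ^ 2 := by
    obtain ⟨j, hj⟩ := Function.ne_iff.1 hn0
    obtain ⟨i, hi⟩ := Function.ne_iff.1 (hn j)
    have hj1 : 1 ≤ n j := Nat.one_le_iff_ne_zero.2 hj
    by_cases hij : i = j
    · subst hij
      rw [Pi.single_eq_same] at hi
      have : 2 ≤ n i := by omega
      refine le_trans ?_ (Finset.single_le_sum (f := fun j => (n j) ^ 2) (fun _ _ => Nat.zero_le _)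
        (Finset.mem_univ i))
      nlinarith
    · rw [Pi.single_eq_of_ne hij] at hi
      have hi1 : 1 ≤ n i := Nat.one_le_iff_ne_zero.2 hi
      refine le_trans ?_ (Finset.sum_le_sum_of_subset (f := fun j => (n j) ^ 2)
        (Finset.subset_univ {i, j}))
      rw [Finset.sum_pair hij]
      nlinarith
  -- In the equality case the sum of `|m|² |û(m)|²` is at most that of `|û(m)|²`. All weights of
  -- nonzero modes are at least 1 and that of `n` at least 2, so the mode `n` is counted once too
  -- often. The bound is read off on partial sums containing `n`.
  have key : ‖toL2 u‖ ^ 2 ≤ ‖toL2 u‖ ^ 2 - ‖⟪cosL2 n, toL2 u⟫_ℂ‖ ^ 2 := by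
    refine le_of_tendsto (hasSum_norm_sq_inner_cosL2 (toL2 u)) ?_
    filter_upwards [eventually_ge_atTop {n}] with s hs
    have hns : n ∈ s := hs (Finset.mem_singleton_self n)
    have hb := sum_sq_mul_norm_inner_cosL2_le u s
    have hpi := Real.pi_pos
    have hu : ‖u‖ ^ 2 ≤ Real.pi ^ 2 * ‖toL2 u‖ ^ 2 := by
      rw [← mul_pow]
      gcongr
      rwa [inv_mul_le_iff₀ hpi] at h
    have h3 : ∑ m ∈ s, (∑ j, (m j : ℝ) ^ 2) * ‖⟪cosL2 m, toL2 u⟫_ℂ‖ ^ 2 ≤ ‖toL2 u‖ ^ 2 :=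
      le_of_mul_le_mul_left (hb.trans hu) (by positivity)
    have h4 : ∑ m ∈ s, (‖⟪cosL2 m, toL2 u⟫_ℂ‖ ^ 2 +
        if m = n then ‖⟪cosL2 n, toL2 u⟫_ℂ‖ ^ 2 else 0)
        ≤ ∑ m ∈ s, (∑ j, (m j : ℝ) ^ 2) * ‖⟪cosL2 m, toL2 u⟫_ℂ‖ ^ 2 := by
      refine Finset.sum_le_sum fun m _ => ?_
      split_ifs with hmn
      · subst hmn
        have : (2 : ℝ) ≤ ∑ j, (m j : ℝ) ^ 2 := by exact_mod_cast htwo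
        nlinarith [sq_nonneg ‖⟪cosL2 m, toL2 u⟫_ℂ‖]
      · rw [add_zero]
        by_cases hm0 : m = 0
        · rw [hm0, inner_cosL2_zero]; simp
        · have : (1 : ℝ) ≤ ∑ j, (m j : ℝ) ^ 2 := by exact_mod_cast hint m hm0
          exact le_mul_of_one_le_left (sq_nonneg _) this
    rw [Finset.sum_add_distrib, Finset.sum_ite_eq' s n, if_pos hns] at h4
    linarith
  have h5 : ‖⟪cosL2 n, toL2 u⟫_ℂ‖ ^ 2 = 0 := le_antisymm (by linarith) (sq_nonneg _)
  rwa [sq_eq_zero_iff, norm_eq_zero] at h5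

lemma tensor_cosFam_single (j : Fin d) (x : Pt d) :
    tensor (cosFam (Pi.single j 1)) x = √2 * Real.cos (Real.pi * x j) := by
  rw [tensor, Finset.prod_eq_single j]
  · simp [cosFam, cosN]
  · intro i _ hi
    simp [cosFam, cosN, Pi.single_eq_of_ne hi]
  · simp

/-- A function realising equality in Poincaré's inequality which vanishes on an open subset of
the cell vanishes. -/
lemma eq_zero_of_poincare_eq {u : EnergySpace d} (h : Real.pi⁻¹ * ‖u‖ ≤ ‖toL2 u‖)
    {D : Set (Pt d)} (hDo : IsOpen D) (hDne : D.Nonempty) (hDc : D ⊆ cell d)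
    (hu : ∀ᵐ x ∂(cellMeasure d), x ∈ D → toL2 u x = 0) : u = 0 := by
  set c : Fin d → ℂ := fun j => ⟪cosL2 (Pi.single j 1), toL2 u⟫_ℂ with hc
  have hsingle : ∀ i j : Fin d, (Pi.single i 1 : Fin d → ℕ) = Pi.single j 1 ↔ i = j := by
    intro i j
    refine ⟨fun hij => ?_, fun hij => by rw [hij]⟩
    by_contra hne
    have := congrFun hij i
    rw [Pi.single_eq_same, Pi.single_eq_of_ne hne] at this
    exact one_ne_zero this
  have hexp : toL2 u = ∑ j, c j • cosL2 (Pi.single j 1) := by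
    rw [← sub_eq_zero]
    refine eq_zero_of_inner_cosL2 fun n => ?_
    have horth := orthonormal_iff_ite.1 (orthonormal_cosL2 d)
    rw [inner_sub_right, inner_sum]
    simp only [inner_smul_right, horth, mul_ite, mul_one, mul_zero]
    by_cases hn : ∃ j, n = Pi.single j 1
    · obtain ⟨j, rfl⟩ := hn
      simp only [hsingle, Finset.sum_ite_eq, Finset.mem_univ, if_true, hc, sub_self]
    · push Not at hn
      simp [inner_cosL2_eq_zero_of_poincare_eq h hn, hn]
  set f : Pt d → ℂ := fun x => ∑ j, c j * ((√2 * Real.cos (Real.pi * x j) : ℝ) : ℂ) with hf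
  have hfc : Continuous f := by rw [hf]; fun_prop
  have hfu : toL2 u =ᵐ[cellMeasure d] f := by
    have h1 : ∀ j : Fin d, ∀ᵐ x ∂(cellMeasure d), (c j • cosL2 (Pi.single j 1) : L2 d) x
        = c j * ((√2 * Real.cos (Real.pi * x j) : ℝ) : ℂ) := by
      intro j
      filter_upwards [Lp.coeFn_smul (c j) (cosL2 (Pi.single j 1)),
        (memLp_tensor fun i => (contDiff_cosFam (Pi.single j 1) i).continuous).coeFn_toLp]
        with x h2 h3
      rw [h2, Pi.smul_apply, cosL2, h3, smul_eq_mul, tensor_cosFam_single]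
    rw [hexp]
    filter_upwards [ae_all_iff.2 h1, Lp.coeFn_finsetSum Finset.univ
      fun j => c j • cosL2 (Pi.single j 1)] with x h2 h3
    rw [h3, Finset.sum_apply]
    simp only [h2, hf]
  -- The finite cosine sum is continuous, so vanishing almost everywhere on the open set `D` means
  -- vanishing at every point of it.
  have hf0 : ∀ x ∈ D, f x = 0 := by
    have h1 : f =ᵐ[volume.restrict D] fun _ => 0 := by
      have h2 : ∀ᵐ x ∂(cellMeasure d), x ∈ D → f x = 0 := by
        filter_upwards [hfu, hu] with x h3 h4 hx
        rw [← h3, h4 hx]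
      have h5 : ∀ᵐ x ∂((cellMeasure d).restrict D), f x = 0 :=
        (ae_restrict_iff' hDo.measurableSet).2 h2
      rwa [cellMeasure, Measure.restrict_restrict hDo.measurableSet, inter_eq_left.2 hDc] at h5
    exact Measure.eqOn_open_of_ae_eq h1 hDo hfc.continuousOn continuousOn_const
  -- Each summand of `f` depends on one coordinate only. Differentiating in direction `j` at a point
  -- of `D` leaves `-c_j √2 π sin (π x_j)`, and the sine is positive in the open cell.
  have hc0 : ∀ j, c j = 0 := by
    intro j
    obtain ⟨x, hx⟩ := hDne
    have hline : ∀ᶠ t : ℝ in 𝓝 0, f (x + t • EuclideanSpace.single j (1 : ℝ)) = 0 := by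
      have : Tendsto (fun t : ℝ => x + t • EuclideanSpace.single j (1 : ℝ)) (𝓝 0) (𝓝 x) := by
        have hcont : Continuous fun t : ℝ => x + t • EuclideanSpace.single j (1 : ℝ) := by fun_prop
        simpa using hcont.tendsto 0
      filter_upwards [this.eventually (hDo.mem_nhds hx)] with t ht using hf0 _ ht
    have hfl : ∀ t : ℝ, f (x + t • EuclideanSpace.single j (1 : ℝ))
        = c j * ((√2 * Real.cos (Real.pi * (x j + t)) : ℝ) : ℂ)
          + ∑ i ∈ Finset.univ.erase j, c i * ((√2 * Real.cos (Real.pi * x i) : ℝ) : ℂ) := by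
      intro t
      simp only [hf]
      rw [← Finset.add_sum_erase _ _ (Finset.mem_univ j)]
      congr 1
      · simp
      · refine Finset.sum_congr rfl fun i hi => ?_
        simp [Finset.ne_of_mem_erase hi]
    have hd : HasDerivAt (fun t : ℝ => f (x + t • EuclideanSpace.single j (1 : ℝ)))
        (c j * ((√2 * (-Real.sin (Real.pi * (x j + 0)) * (Real.pi * 1)) : ℝ) : ℂ)) 0 := by
      simp only [hfl]
      refine HasDerivAt.add_const _ (HasDerivAt.const_mul _ (HasDerivAt.ofReal_comp ?_))
      refine HasDerivAt.const_mul _ (HasDerivAt.cos ?_)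
      exact ((hasDerivAt_id (0 : ℝ)).const_add (x j)).const_mul Real.pi
    have hd0 : HasDerivAt (fun t : ℝ => f (x + t • EuclideanSpace.single j (1 : ℝ))) 0 0 :=
      (hasDerivAt_const (0 : ℝ) (0 : ℂ)).congr_of_eventuallyEq hline
    have h1 := hd.unique hd0
    refine (mul_eq_zero.1 h1).resolve_right fun h2 => ?_
    rw [Complex.ofReal_eq_zero, add_zero, mul_one] at h2
    have hxj := hDc hx j
    have hsin : 0 < Real.sin (Real.pi * x j) :=
      Real.sin_pos_of_pos_of_lt_pi (mul_pos Real.pi_pos hxj.1)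
        (by nlinarith [Real.pi_pos, hxj.2])
    have : 0 < √2 * (Real.sin (Real.pi * x j) * Real.pi) := by
      have := Real.pi_pos
      positivity
    linarith
  refine toL2_injective ?_
  rw [hexp, map_zero]
  simp [hc0]

end Embedding

/-! ### Test functions in the energy space -/

section TestFunctions

open EnergySpace

variable {d : ℕ} {D : Set (Pt d)}

lemma eq_zero_of_notMem_of_tsupport_subset {φ : Pt d → ℝ} {s : Set (Pt d)} (h : tsupport φ ⊆ s)
    {x : Pt d} (hx : x ∉ s) : φ x = 0 :=
  image_eq_zero_of_notMem_tsupport fun hx' => hx (h hx')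

lemma fderiv_eq_zero_of_notMem_of_tsupport_subset {φ : Pt d → ℝ} {s : Set (Pt d)}
    (h : tsupport φ ⊆ s) {x : Pt d} (hx : x ∉ s) : fderiv ℝ φ x = 0 := by
  by_contra h0
  exact hx (h (support_fderiv_subset ℝ h0))

lemma integral_fderiv_mul {ψ f : Pt d → ℝ} (hψ : ContDiff ℝ ∞ ψ) (hψc : HasCompactSupport ψ)
    (hf : ContDiff ℝ ∞ f) (v : Pt d) :
    ∫ x, fderiv ℝ ψ x v * f x = - ∫ x, ψ x * fderiv ℝ f x v := by
  have h1 := continuous_fderiv_apply hψ v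
  have h2 := continuous_fderiv_apply hf v
  have h3 : HasCompactSupport fun x => fderiv ℝ ψ x v := hψc.fderiv_apply (𝕜 := ℝ) v
  rw [integral_mul_fderiv_eq_neg_fderiv_mul_of_integrable, neg_neg]
  · exact (h1.mul hf.continuous).integrable_of_hasCompactSupport h3.mul_right
  · exact (hψ.continuous.mul h2).integrable_of_hasCompactSupport hψc.mul_right
  · exact (hψ.continuous.mul hf.continuous).integrable_of_hasCompactSupport hψc.mul_right
  · exact fun x _ => hψ.differentiable (by simp) x
  · exact fun x _ => hf.differentiable (by simp) x

lemma integral_fderiv_eq_zero {ψ : Pt d → ℝ} (hψ : ContDiff ℝ ∞ ψ) (hψc : HasCompactSupport ψ)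
    (v : Pt d) : ∫ x, fderiv ℝ ψ x v = 0 := by
  simpa using integral_fderiv_mul hψ hψc (contDiff_const (c := (1 : ℝ))) v

/-- The gradient of a real function as a complex vector field. -/
noncomputable def classicalGrad (φ : Pt d → ℝ) (x : Pt d) : EuclideanSpace ℂ (Fin d) :=
  WithLp.toLp 2 fun j => ((fderiv ℝ φ x (EuclideanSpace.single j 1) : ℝ) : ℂ)

lemma memLp_classicalGrad {φ : Pt d → ℝ} (hφ : ContDiff ℝ ∞ φ) (hφc : HasCompactSupport φ) :
    MemLp (classicalGrad φ) 2 (cellMeasure d) := by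
  have hc : Continuous (classicalGrad φ) := by
    refine (PiLp.continuous_toLp 2 _).comp (continuous_pi fun j => ?_)
    exact Complex.continuous_ofReal.comp (continuous_fderiv_apply hφ _)
  have hs : HasCompactSupport (classicalGrad φ) :=
    (hφc.fderiv (𝕜 := ℝ)).comp_left (g := fun ℓ : Pt d →L[ℝ] ℝ =>
      (WithLp.toLp 2 fun j => ((ℓ (EuclideanSpace.single j 1) : ℝ) : ℂ) :
        EuclideanSpace ℂ (Fin d))) (by ext j; simp)
  exact hc.memLp_of_hasCompactSupport hs

/-- Smooth functions with compact support in `D`, corrected by a constant, belong to the energy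
space. -/
lemma exists_testMinusMean (hDc : D ⊆ cell d) {φ : Pt d → ℝ}
    (hφ : ContDiff ℝ ∞ φ) (hφc : HasCompactSupport φ) (hφD : tsupport φ ⊆ D) :
    ∃ u ∈ testMinusMean D, ∃ c : ℂ, toL2 u =ᵐ[cellMeasure d] fun x => (φ x : ℂ) - c := by
  set c : ℝ := ∫ x, φ x with hc
  have hDint : ∫ y in D, (φ y : ℂ) = (c : ℂ) := by
    rw [hc, ← integral_complex_ofReal]
    exact setIntegral_eq_integral_of_forall_compl_eq_zero fun x hx => by
      rw [eq_zero_of_notMem_of_tsupport_subset hφD hx, Complex.ofReal_zero]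
  have hcell : ∫ x, (φ x : ℂ) ∂(cellMeasure d) = (c : ℂ) := by
    rw [hc, ← integral_complex_ofReal]
    exact setIntegral_eq_integral_of_forall_compl_eq_zero fun x hx => by
      rw [eq_zero_of_notMem_of_tsupport_subset (hφD.trans hDc) hx, Complex.ofReal_zero]
  set f : Pt d → ℝ := fun x => φ x - c with hf
  have hfs : ContDiff ℝ ∞ f := hφ.sub contDiff_const
  have hφint : Integrable (fun x => (φ x : ℂ)) (cellMeasure d) :=
    ((Complex.continuous_ofReal.comp hφ.continuous).integrable_of_hasCompactSupport
      (hφc.comp_left Complex.ofReal_zero)).integrableOn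
  have hfm : MemLp (fun x => (f x : ℂ)) 2 (cellMeasure d) := by
    obtain ⟨C, hC⟩ := hφc.exists_bound_of_continuous hφ.continuous
    refine memLp_of_bdd (Complex.continuous_ofReal.comp hfs.continuous) (C := C + ‖c‖) fun x _ => ?_
    rw [Complex.norm_real]
    exact (norm_sub_le _ _).trans (by gcongr; exact hC x)
  have hmean : hfm.toLp _ ∈ meanZero d := by
    rw [mem_meanZero, integral_congr_ae hfm.coeFn_toLp]
    simp only [hf, Complex.ofReal_sub]
    rw [integral_sub hφint (integrable_const _), hcell]
    simp
  have hgm := memLp_classicalGrad hφ hφc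
  -- The test function is supported in the cell, so both integrals extend to the whole space; its
  -- compact support makes the integration by parts free of boundary terms although `f` is constant
  -- at infinity.
  have hweak : IsWeakGradient (hfm.toLp _) (hgm.toLp _) := by
    intro ψ h1 h2 h3 j
    have e1 : ∫ x, (fderiv ℝ ψ x (EuclideanSpace.single j 1)) • (hfm.toLp _) x ∂(cellMeasure d)
        = ((∫ x, fderiv ℝ ψ x (EuclideanSpace.single j 1) * f x : ℝ) : ℂ) := by
      rw [← integral_complex_ofReal]
      refine (integral_congr_ae ?_).trans
        (setIntegral_eq_integral_of_forall_compl_eq_zero (μ := volume) (s := cell d) ?_)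
      · filter_upwards [hfm.coeFn_toLp] with x hx
        rw [hx, Complex.real_smul, Complex.ofReal_mul]
      · intro x hx
        rw [fderiv_eq_zero_of_notMem_of_tsupport_subset h3 hx]
        simp
    have e2 : ∫ x, ψ x • (hgm.toLp _) x j ∂(cellMeasure d)
        = ((∫ x, ψ x * fderiv ℝ f x (EuclideanSpace.single j 1) : ℝ) : ℂ) := by
      rw [← integral_complex_ofReal]
      refine (integral_congr_ae ?_).trans
        (setIntegral_eq_integral_of_forall_compl_eq_zero (μ := volume) (s := cell d) ?_)
      · filter_upwards [hgm.coeFn_toLp] with x hx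
        rw [hx, Complex.real_smul, Complex.ofReal_mul, hf, fderiv_sub_const]
        rfl
      · intro x hx
        rw [eq_zero_of_notMem_of_tsupport_subset h3 hx]
        simp
    rw [e1, e2, integral_fderiv_mul h1 h2 hfs, Complex.ofReal_neg]
  let u : EnergySpace d := ⟨hfm.toLp _, hmean, hgm.toLp _, hweak⟩
  have hu : toL2 u =ᵐ[cellMeasure d] fun x => (φ x : ℂ) - c := by
    filter_upwards [hfm.coeFn_toLp] with x hx
    have : toL2 u x = (hfm.toLp _) x := rfl
    rw [this, hx, hf, Complex.ofReal_sub]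
  refine ⟨u, ⟨fun x => (φ x : ℂ), ?_, ?_, ?_, ?_⟩, c, hu⟩
  · exact Complex.ofRealCLM.contDiff.comp hφ
  · exact hφc.comp_left Complex.ofReal_zero
  · exact (tsupport_comp_subset Complex.ofReal_zero φ).trans hφD
  · rw [hDint]
    exact hu

/-- The weak gradient vanishes where the function is locally constant. -/
lemma grad_eq_zero_of_ae_eq_const {u : EnergySpace d} {U : Set (Pt d)} (hU : IsOpen U) {c : ℂ}
    (hu : ∀ᵐ x ∂(cellMeasure d), x ∈ U → toL2 u x = c) :
    ∀ᵐ x ∂(cellMeasure d), x ∈ U → grad u x = 0 := by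
  have hj : ∀ j : Fin d, ∀ᵐ x ∂(volume : Measure (Pt d)), x ∈ U ∩ cell d → grad u x j = 0 := by
    intro j
    have hgi := integrable_L2Vec_coord (grad u) j
    refine (hU.inter (isOpen_cell d)).ae_eq_zero_of_integral_contDiff_smul_eq_zero ?_ ?_
    · have h1 : IntegrableOn (fun x => grad u x j) (cell d) volume := hgi
      exact (h1.mono_set inter_subset_right).locallyIntegrableOn
    · intro φ h1 h2 h3
      have hcell := h3.trans inter_subset_right
      rw [← setIntegral_eq_integral_of_forall_compl_eq_zero
        (fun x hx => by rw [eq_zero_of_notMem_of_tsupport_subset hcell hx, zero_smul])]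
      change ∫ x, φ x • grad u x j ∂(cellMeasure d) = 0
      -- After integrating by parts the function may be replaced by the constant `c` on the support
      -- of `φ`, and a derivative of a test function has integral zero.
      rw [← neg_eq_zero, ← isWeakGradient_grad u φ h1 h2 hcell j]
      have e1 : ∫ x, (fderiv ℝ φ x (EuclideanSpace.single j 1)) • toL2 u x ∂(cellMeasure d)
          = ∫ x, (fderiv ℝ φ x (EuclideanSpace.single j 1)) • c ∂(cellMeasure d) := by
        refine integral_congr_ae ?_
        filter_upwards [hu] with x hx
        by_cases hxU : x ∈ U
        · simp only [hx hxU]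
        · rw [fderiv_eq_zero_of_notMem_of_tsupport_subset (h3.trans inter_subset_left) hxU]
          simp
      rw [e1, integral_smul_const]
      have e2 : ∫ x, fderiv ℝ φ x (EuclideanSpace.single j 1) ∂(cellMeasure d) = 0 := by
        rw [← integral_fderiv_eq_zero h1 h2 (EuclideanSpace.single j 1)]
        refine setIntegral_eq_integral_of_forall_compl_eq_zero fun x hx => ?_
        rw [fderiv_eq_zero_of_notMem_of_tsupport_subset hcell hx]
        simp
      rw [e2, zero_smul]
  refine (ae_restrict_iff' (measurableSet_cell d)).2 ?_
  filter_upwards [ae_all_iff.2 hj] with x hx hxc hxU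
  ext j
  exact hx j ⟨hxU, hxc⟩

/-- `W₁` and `W₂` are orthogonal. -/
lemma isOrtho_W1_W2 : W1 D ⟂ W2 D := by
  -- The gradients have disjoint supports: one function vanishes near the closure of `D`, the other
  -- is constant off a subset of `D`.
  have h1 : awayFrom D ≤ (testMinusMean D)ᗮ := by
    rintro u ⟨U, hU, hDU, hu⟩
    rw [Submodule.mem_orthogonal]
    rintro w ⟨φ, -, -, h3, h4⟩
    have hw : ∀ᵐ x ∂(cellMeasure d), x ∈ (tsupport φ)ᶜ → grad w x = 0 := by
      refine grad_eq_zero_of_ae_eq_const (isClosed_tsupport φ).isOpen_compl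
        (c := - ∫ y in D, φ y) ?_
      filter_upwards [h4] with x hx hxs
      rw [hx, image_eq_zero_of_notMem_tsupport hxs, zero_sub]
    have hu' := grad_eq_zero_of_ae_eq_const hU hu
    rw [inner_def, L2.inner_def]
    refine integral_eq_zero_of_ae ?_
    filter_upwards [hw, hu'] with x e1 e2
    by_cases hx : x ∈ tsupport φ
    · rw [e2 (hDU (subset_closure (h3 hx)))]
      simp
    · rw [e1 hx]
      simp
  have h2 : W1 D ≤ (testMinusMean D)ᗮ :=
    Submodule.topologicalClosure_minimal _ h1 (Submodule.isClosed_orthogonal _)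
  have h3 : W2 D ≤ (W1 D)ᗮ := by
    refine Submodule.topologicalClosure_minimal _ ?_ (Submodule.isClosed_orthogonal _)
    exact (Submodule.le_orthogonal_orthogonal _).trans (Submodule.orthogonal_le h2)
  exact (show W2 D ⟂ W1 D from h3).symm

/-- `W₂` is infinite dimensional. -/
lemma not_finiteDimensional_W2 (hd : 0 < d) (hDo : IsOpen D) (hDne : D.Nonempty)
    (hDc : D ⊆ cell d) : ¬ FiniteDimensional ℂ (W2 D) := by
  intro hfin
  obtain ⟨x₀, hx₀⟩ := hDne
  obtain ⟨φ, hφD, hφc, hφ, -, hφ1⟩ :=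
    exists_contDiff_tsupport_subset (n := ⊤) (hDo.mem_nhds hx₀)
  -- The powers of a single bump function are independent modulo constants. Exponents start at 1, so
  -- that the powers still vanish outside `D` and no degree collides with the constant term.
  have hpow : ∀ k : ℕ, ∃ u ∈ testMinusMean D, ∃ c : ℂ,
      toL2 u =ᵐ[cellMeasure d] fun x => ((φ x ^ (k + 1) : ℝ) : ℂ) - c := by
    intro k
    have hsub : tsupport (fun x => φ x ^ (k + 1)) ⊆ tsupport φ :=
      tsupport_comp_subset (g := fun t : ℝ => t ^ (k + 1)) (by simp) φ
    exact exists_testMinusMean hDc (hφ.pow _)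
      (hφc.comp_left (g := fun t : ℝ => t ^ (k + 1)) (by simp)) (hsub.trans hφD)
  choose w hw c hc using hpow
  have hli : LinearIndependent ℂ fun k =>
      (⟨w k, Submodule.le_topologicalClosure _ (hw k)⟩ : W2 D) := by
    rw [linearIndependent_iff']
    intro s a ha k hk
    have ha' : ∑ i ∈ s, a i • toL2 (w i) = 0 := by
      have := congrArg (fun v : W2 D => toL2 (v : EnergySpace d)) ha
      simpa using this
    have hae : (fun x => ∑ i ∈ s, a i * (((φ x ^ (i + 1) : ℝ) : ℂ) - c i)) =ᵐ[cellMeasure d]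
        fun _ => 0 := by
      have h1 : ∀ i, ∀ᵐ x ∂(cellMeasure d), (a i • toL2 (w i) : L2 d) x
          = a i * (((φ x ^ (i + 1) : ℝ) : ℂ) - c i) := by
        intro i
        filter_upwards [hc i, Lp.coeFn_smul (a i) (toL2 (w i))] with x e1 e2
        rw [e2, Pi.smul_apply, e1, smul_eq_mul]
      filter_upwards [ae_all_iff.2 h1, Lp.coeFn_finsetSum s fun i => a i • toL2 (w i),
        Lp.coeFn_zero ℂ 2 (cellMeasure d)] with x e1 e2 e3
      rw [ha', e3, Pi.zero_apply, Finset.sum_apply] at e2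
      rw [e2]
      exact Finset.sum_congr rfl fun i _ => (e1 i).symm
    have hφcont := hφ.continuous
    have heq := Measure.eqOn_open_of_ae_eq hae (isOpen_cell d)
      (Continuous.continuousOn (by fun_prop)) continuousOn_const
    set p : Polynomial ℂ := ∑ i ∈ s,
      Polynomial.C (a i) * (Polynomial.X ^ (i + 1) - Polynomial.C (c i))
      with hp
    have hroot : ∀ t ∈ Ioc (0 : ℝ) 1, p.IsRoot (t : ℂ) := by
      intro t ht
      -- The origin is not in the open cell because `d > 0`. Between it and `x₀`, where `φ = 1`, the
      -- bump takes every value in `(0, 1]`, so the relation makes `p` vanish on an infinite set.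
      have h0 : φ 0 = 0 := eq_zero_of_notMem_of_tsupport_subset (hφD.trans hDc) fun h => by
        have := (h ⟨0, hd⟩).1
        simp at this
      obtain ⟨x, hx⟩ : ∃ x, φ x = t :=
        mem_range_of_exists_le_of_exists_ge hφcont ⟨0, h0.trans_le ht.1.le⟩
          ⟨x₀, ht.2.trans_eq hφ1.symm⟩
      have hxc : x ∈ cell d := by
        by_contra hx'
        rw [eq_zero_of_notMem_of_tsupport_subset (hφD.trans hDc) hx'] at hx
        exact ht.1.ne hx
      have := heq hxc
      simp only [hx] at this
      simpa [hp, Polynomial.IsRoot, Polynomial.eval_finsetSum] using this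
    have hp0 : p = 0 := by
      refine Polynomial.eq_zero_of_infinite_isRoot p ?_
      refine Set.Infinite.mono (s := Complex.ofReal '' Ioc (0 : ℝ) 1) ?_ ?_
      · rintro _ ⟨t, ht, rfl⟩
        exact hroot t ht
      · exact (Ioc_infinite zero_lt_one).image Complex.ofReal_injective.injOn
    -- In degree `k + 1 ≥ 1` the unknown constants `c i` do not contribute.
    have hcoef := congrArg (fun q : Polynomial ℂ => q.coeff (k + 1)) hp0
    simp only [hp, Polynomial.finsetSum_coeff, Polynomial.coeff_C_mul, Polynomial.coeff_sub,
      Polynomial.coeff_X_pow, Polynomial.coeff_C, Polynomial.coeff_zero] at hcoef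
    simpa [hk] using hcoef
  have := hli.finite
  exact not_finite ℕ

/-- Functions orthogonal to the test functions of `D` vanish on `D`. -/
lemma ae_eq_zero_of_orthogonal_testMinusMean (hDo : IsOpen D) (hDc : D ⊆ cell d) {f : L20 d}
    (hf : ∀ w ∈ testMinusMean D, ⟪toL20 w, f⟫_ℂ = 0) :
    ∀ᵐ x ∂(cellMeasure d), x ∈ D → (f : L2 d) x = 0 := by
  have hfi := integrable_L2 (f : L2 d)
  have h1 : ∀ᵐ x ∂(volume : Measure (Pt d)), x ∈ D → (f : L2 d) x = 0 := by
    refine hDo.ae_eq_zero_of_integral_contDiff_smul_eq_zero ?_ ?_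
    · have h1 : IntegrableOn (fun x => (f : L2 d) x) (cell d) volume := hfi
      exact (h1.mono_set hDc).locallyIntegrableOn
    · intro φ h1 h2 h3
      obtain ⟨w, hw, c, hwc⟩ := exists_testMinusMean hDc h1 h2 h3
      rw [← setIntegral_eq_integral_of_forall_compl_eq_zero
        (fun x hx => by rw [eq_zero_of_notMem_of_tsupport_subset (h3.trans hDc) hx, zero_smul])]
      have e1 : ⟪toL20 w, f⟫_ℂ = ∫ x, (φ x • (f : L2 d) x - starRingEnd ℂ c * (f : L2 d) x)
          ∂(cellMeasure d) := by
        have : ⟪toL20 w, f⟫_ℂ = ⟪toL2 w, (f : L2 d)⟫_ℂ := rfl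
        rw [this, L2.inner_def]
        refine integral_congr_ae ?_
        filter_upwards [hwc] with x hx
        rw [hx, RCLike.inner_apply, map_sub, Complex.conj_ofReal, Complex.real_smul]
        ring
      have e2 := hf w hw
      -- The correcting constant drops out because `f` has mean zero.
      rw [e1, integral_sub (integrable_smul_of_test h1.continuous h2 hfi) (hfi.const_mul _),
        integral_const_mul, mem_meanZero.1 f.2, mul_zero, sub_zero] at e2
      exact e2
  exact ae_restrict_of_ae h1

end TestFunctions

/-! ### Operators of the form `i S i†` -/

lemma differentiableOn_const_add_smul {X : Type*} [NormedAddCommGroup X] [NormedSpace ℂ X] {a : X}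
    {f : ℂ → X} {s : Set ℂ} (hf : DifferentiableOn ℂ f s) :
    DifferentiableOn ℂ (fun z => a + z • f z) s :=
  (differentiableOn_const a).add (differentiableOn_id.smul hf)

section Conjugation

variable {E F : Type*} [NormedAddCommGroup E] [InnerProductSpace ℂ E]
    [CompleteSpace E] [NormedAddCommGroup F] [InnerProductSpace ℂ F] [CompleteSpace F]

/-- The self-adjoint operator `B†B` has a spectral value of modulus `‖B‖²`. Being nonzero, it is an
eigenvalue by compactness, and its eigenvector attains the norm. -/
lemma exists_norm_apply_eq_opNorm_mul [Nontrivial E] (B : E →L[ℂ] F)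
    (hc : IsCompactOperator (ContinuousLinearMap.adjoint B ∘L B)) :
    ∃ f : E, f ≠ 0 ∧ ‖B f‖ = ‖B‖ * ‖f‖ := by
  by_cases hB : B = 0
  · obtain ⟨f, hf⟩ := exists_ne (0 : E)
    exact ⟨f, hf, by simp [hB]⟩
  set S : E →L[ℂ] E := ContinuousLinearMap.adjoint B ∘L B with hS
  have hsa : IsSelfAdjoint S := by
    rw [IsSelfAdjoint, ContinuousLinearMap.star_eq_adjoint, hS,
      ContinuousLinearMap.adjoint_comp, ContinuousLinearMap.adjoint_adjoint]
  have hnorm : ‖S‖ = ‖B‖ * ‖B‖ := ContinuousLinearMap.norm_adjoint_comp_self B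
  obtain ⟨k, hk, hk'⟩ := spectrum.exists_nnnorm_eq_spectralRadius S
  rw [hsa.spectralRadius_eq_nnnorm] at hk'
  have hk2 : ‖k‖ = ‖B‖ * ‖B‖ := by
    rw [← hnorm]
    exact congrArg NNReal.toReal (ENNReal.coe_injective hk')
  have hk0 : k ≠ 0 := by
    rw [← norm_ne_zero_iff, hk2]
    simp [hB]
  obtain ⟨f, hf⟩ :=
    ((IsCompactOperator.hasEigenvalue_iff_mem_spectrum hc hk0).2 hk).exists_hasEigenvector
  refine ⟨f, hf.2, ?_⟩
  have h1 : S f = k • f := hf.apply_eq_smul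
  have h2 : ⟪f, S f⟫_ℂ = ((‖B f‖ ^ 2 : ℝ) : ℂ) := by
    rw [hS, ContinuousLinearMap.comp_apply, ContinuousLinearMap.adjoint_inner_right,
      inner_self_eq_norm_sq_to_K]
    norm_cast
  rw [h1, inner_smul_right, inner_self_eq_norm_sq_to_K] at h2
  have h3 := congrArg norm h2
  rw [norm_mul, hk2, Complex.norm_real, norm_pow] at h3
  simp only [Complex.coe_algebraMap, Complex.norm_real, norm_norm, norm_pow] at h3
  have h4 : (‖B‖ * ‖f‖) ^ 2 = ‖B f‖ ^ 2 := by rw [← h3]; ring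
  exact ((pow_left_inj₀ (by positivity) (by positivity) two_ne_zero).1 h4).symm

variable (i : F →L[ℂ] E) (W : Submodule ℂ F) [W.HasOrthogonalProjection]

lemma adjoint_compl_comp_adjoint :
    ContinuousLinearMap.adjoint ((1 - W.starProjection) ∘L ContinuousLinearMap.adjoint i)
      = i ∘L (1 - W.starProjection) := by
  have h : ContinuousLinearMap.adjoint (1 - W.starProjection) = 1 - W.starProjection :=
    ((IsSelfAdjoint.one _).sub (isSelfAdjoint_starProjection W) :
      IsSelfAdjoint (1 - W.starProjection))
  rw [ContinuousLinearMap.adjoint_comp, h, ContinuousLinearMap.adjoint_adjoint]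

variable {i W}

lemma isSelfAdjoint_conj {S : F →L[ℂ] F} (hS : IsSelfAdjoint S) :
    IsSelfAdjoint (i ∘L S ∘L ContinuousLinearMap.adjoint i) := by
  rw [IsSelfAdjoint, ContinuousLinearMap.star_eq_adjoint, ContinuousLinearMap.adjoint_comp,
    ContinuousLinearMap.adjoint_comp, ContinuousLinearMap.adjoint_adjoint,
    ← ContinuousLinearMap.star_eq_adjoint, hS.star_eq]
  rfl

lemma isSelfAdjoint_add_real_smul {A V : E →L[ℂ] E} (hA : IsSelfAdjoint A)
    (hV : IsSelfAdjoint V) (t : ℝ) : IsSelfAdjoint (A + (t : ℂ) • V) := by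
  have ht : IsSelfAdjoint (t : ℂ) := Complex.conj_ofReal t
  exact hA.add (ht.smul hV)

/-- The hypotheses give `S = (1 - P) S (1 - P)` with `P` the projection onto `W`, so the operator is
`B† S B` with `B = (1 - P) i†`. -/
lemma norm_conj_le {S : F →L[ℂ] F} (h1 : W.starProjection * S = 0)
    (h2 : S * W.starProjection = 0) :
    ‖i ∘L S ∘L ContinuousLinearMap.adjoint i‖
      ≤ ‖(1 - W.starProjection) ∘L ContinuousLinearMap.adjoint i‖ ^ 2 * ‖S‖ := by
  set B := (1 - W.starProjection) ∘L ContinuousLinearMap.adjoint i with hB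
  have h3 : (1 - W.starProjection) * S * (1 - W.starProjection) = S := by
    rw [sub_mul, h1, one_mul, sub_zero, mul_sub, h2, mul_one, sub_zero]
  have h4 : i ∘L S ∘L ContinuousLinearMap.adjoint i = ContinuousLinearMap.adjoint B ∘L S ∘L B := by
    rw [hB, adjoint_compl_comp_adjoint]
    conv_lhs => rw [← h3]
    rfl
  rw [h4]
  refine (ContinuousLinearMap.opNorm_comp_le _ _).trans ?_
  rw [LinearIsometryEquiv.norm_map]
  refine (mul_le_mul_of_nonneg_left (ContinuousLinearMap.opNorm_comp_le _ _)
    (norm_nonneg _)).trans_eq ?_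
  ring

/-- The equality case in `‖(1 - P_W) i† f‖ ≤ c ‖f‖` for `‖i‖ ≤ c`. -/
lemma equality_of_le_norm_compl {c : ℝ} (hc : ‖i‖ ≤ c) {f : E} (hf : f ≠ 0)
    (h : c * ‖f‖ ≤ ‖((1 - W.starProjection) ∘L ContinuousLinearMap.adjoint i) f‖) :
    W.starProjection (ContinuousLinearMap.adjoint i f) = 0 ∧
      ‖ContinuousLinearMap.adjoint i f‖ = c * ‖f‖ ∧
      c * ‖ContinuousLinearMap.adjoint i f‖ ≤ ‖i (ContinuousLinearMap.adjoint i f)‖ ∧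
      i (ContinuousLinearMap.adjoint i f) = ((c ^ 2 : ℝ) : ℂ) • f := by
  have hc0 : 0 ≤ c := (norm_nonneg _).trans hc
  have hfpos : 0 < ‖f‖ := norm_pos_iff.2 hf
  set u := ContinuousLinearMap.adjoint i f with hu
  have hBf : c * ‖f‖ ≤ ‖u - W.starProjection u‖ := h
  have hule : ‖u‖ ≤ c * ‖f‖ := by
    refine ((ContinuousLinearMap.adjoint i).le_opNorm f).trans ?_
    rw [LinearIsometryEquiv.norm_map]
    gcongr
  -- The chain `c ‖f‖ ≤ ‖u - P_W u‖ ≤ ‖u‖ ≤ c ‖f‖` consists of equalities, so Pythagoras removes the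
  -- component in `W`.
  have hpy : ‖u‖ ^ 2 = ‖W.starProjection u‖ ^ 2 + ‖u - W.starProjection u‖ ^ 2 := by
    have := Submodule.norm_sq_eq_add_norm_sq_starProjection u W
    rwa [Submodule.starProjection_orthogonal'] at this
  have hP2 : W.starProjection u = 0 := by
    have h1 : ‖u‖ ^ 2 ≤ ‖u - W.starProjection u‖ ^ 2 := by
      gcongr
      exact hule.trans hBf
    have h2 : ‖W.starProjection u‖ ^ 2 ≤ 0 := by linarith
    rw [← norm_eq_zero]
    nlinarith [norm_nonneg (W.starProjection u)]
  have hunorm : ‖u‖ = c * ‖f‖ := by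
    refine le_antisymm hule ?_
    rwa [hP2, sub_zero] at hBf
  have hsq : ((‖u‖ ^ 2 : ℝ) : ℂ) = ⟪i u, f⟫_ℂ := by
    rw [← ContinuousLinearMap.adjoint_inner_right, ← hu, inner_self_eq_norm_sq_to_K]
    norm_cast
  have hre : RCLike.re ⟪i u, f⟫_ℂ = ‖u‖ ^ 2 := by rw [← hsq]; exact Complex.ofReal_re _
  refine ⟨hP2, hunorm, ?_, ?_⟩
  · have h1 : ‖u‖ ^ 2 ≤ ‖i u‖ * ‖f‖ := hre ▸ re_inner_le_norm _ _
    refine le_of_mul_le_mul_right (a := ‖f‖) ?_ hfpos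
    calc c * ‖u‖ * ‖f‖ = ‖u‖ ^ 2 := by rw [hunorm]; ring
      _ ≤ _ := h1
  · rw [← sub_eq_zero, ← norm_eq_zero]
    -- Expanding the square gives at most `c² ‖u‖² - 2 c² ‖u‖² + c⁴ ‖f‖²`, which is zero because
    -- `‖u‖ = c ‖f‖`.
    have h1 : ‖i u - ((c ^ 2 : ℝ) : ℂ) • f‖ ^ 2 ≤ 0 := by
      have h2 : ‖i u‖ ^ 2 ≤ (c * ‖u‖) ^ 2 := by
        gcongr
        exact (i.le_opNorm u).trans (by gcongr)
      have h3 : RCLike.re ⟪i u, ((c ^ 2 : ℝ) : ℂ) • f⟫_ℂ = c ^ 2 * ‖u‖ ^ 2 := by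
        rw [inner_smul_right, ← hsq, ← Complex.ofReal_mul]
        exact Complex.ofReal_re _
      rw [@norm_sub_sq ℂ, h3, norm_smul, Complex.norm_real, Real.norm_of_nonneg (by positivity)]
      rw [hunorm] at h2 ⊢
      nlinarith
    nlinarith [norm_nonneg (i u - ((c ^ 2 : ℝ) : ℂ) • f)]

/-- A finite dimensional range would be closed, and its orthogonal complement lies in the kernel of
the self-adjoint operator. As `i` is injective, that kernel consists of vectors orthogonal to
`i(W)`, so the range would contain `i(W)`. -/
lemma not_finiteDimensional_range_conj (hi : Function.Injective i)
    (hW : ¬ FiniteDimensional ℂ W) :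
    ¬ FiniteDimensional ℂ (i ∘L W.starProjection ∘L ContinuousLinearMap.adjoint i).range := by
  intro hfin
  set A := i ∘L W.starProjection ∘L ContinuousLinearMap.adjoint i with hA
  have hsa : IsSelfAdjoint A := isSelfAdjoint_conj (isSelfAdjoint_starProjection W)
  have hle : W.map (i : F →ₗ[ℂ] E) ≤ A.range := by
    have h1 : (A.range)ᗮ ≤ (W.map (i : F →ₗ[ℂ] E))ᗮ := by
      intro f hf
      have hAf : A f = 0 := by
        rw [← inner_self_eq_zero (𝕜 := ℂ)]
        have h2 := hsa.isSymmetric (A f) f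
        simp only [ContinuousLinearMap.coe_coe] at h2
        rw [← h2]
        exact (Submodule.mem_orthogonal _ _).1 hf _ ⟨A f, rfl⟩
      have hP : W.starProjection (ContinuousLinearMap.adjoint i f) = 0 :=
        hi (hAf.trans (map_zero i).symm)
      rw [Submodule.mem_orthogonal]
      rintro _ ⟨w, hw, rfl⟩
      rw [ContinuousLinearMap.coe_coe, ← ContinuousLinearMap.adjoint_inner_right]
      exact (Submodule.mem_orthogonal _ _).1
        ((Submodule.starProjection_apply_eq_zero_iff _).1 hP) w hw
    have h3 := Submodule.orthogonal_le h1
    rw [Submodule.orthogonal_orthogonal A.range] at h3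
    exact (Submodule.le_orthogonal_orthogonal _).trans h3
  refine hW ?_
  have : FiniteDimensional ℂ (W.map (i : F →ₗ[ℂ] E)) := Submodule.finiteDimensional_of_le hle
  exact Module.Finite.equiv (Submodule.equivMapOfInjective (i : F →ₗ[ℂ] E) hi W).symm

end Conjugation

/-! ### The strict Poincaré bound off `W₂` and the perturbation `V(z)`. -/

section Strict

variable {d : ℕ} {D : Set (Pt d)}

open EnergySpace

/-- The part of the solution operator orthogonal to `W₂`. -/
noncomputable def offW2 (D : Set (Pt d)) : L20 d →L[ℂ] EnergySpace d :=
  (1 - (W2 D).starProjection) ∘L ContinuousLinearMap.adjoint toL20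

lemma isCompactOperator_adjoint_offW2_comp :
    IsCompactOperator (ContinuousLinearMap.adjoint (offW2 D) ∘L offW2 D) := by
  have h : ContinuousLinearMap.adjoint (offW2 D) = toL20 ∘L (1 - (W2 D).starProjection) :=
    adjoint_compl_comp_adjoint toL20 (W2 D)
  rw [h]
  exact isCompactOperator_toL20.comp_clm ((1 - (W2 D).starProjection) ∘L offW2 D)

/-- Outside `W₂` the Poincaré constant is not attained. -/
lemma norm_offW2_lt [Nontrivial (L20 d)] (hDo : IsOpen D) (hDne : D.Nonempty) (hDc : D ⊆ cell d) :
    ‖offW2 D‖ < Real.pi⁻¹ := by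
  obtain ⟨f, hf0, hf⟩ := exists_norm_apply_eq_opNorm_mul (offW2 D)
    isCompactOperator_adjoint_offW2_comp
  by_contra hlt
  have hle : Real.pi⁻¹ * ‖f‖ ≤ ‖offW2 D f‖ :=
    (mul_le_mul_of_nonneg_right (not_lt.1 hlt) (norm_nonneg _)).trans_eq hf.symm
  obtain ⟨hP2, hunorm, hge, heq⟩ := equality_of_le_norm_compl opNorm_toL20_le hf0 hle
  -- No component of `(-Δ_N)⁻¹ f` in `W₂` means that `f` is orthogonal in `L²` to all test functions
  -- of `D`.
  have hfD := ae_eq_zero_of_orthogonal_testMinusMean hDo hDc (f := f) fun w hw =>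
    (inner_invNegLaplacian f w).symm.trans
      ((Submodule.mem_orthogonal _ _).1 ((Submodule.starProjection_apply_eq_zero_iff _).1 hP2) w
      (Submodule.le_topologicalClosure _ hw))
  have hu0 : ContinuousLinearMap.adjoint toL20 f = 0 := by
    -- The solution is extremal in Poincaré's inequality, and as a multiple of `f` it vanishes on
    -- `D` too.
    refine eq_zero_of_poincare_eq hge hDo hDne hDc ?_
    have h1 : toL2 (ContinuousLinearMap.adjoint toL20 f)
        = ((Real.pi⁻¹ ^ 2 : ℝ) : ℂ) • (f : L2 d) := congrArg Subtype.val heq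
    rw [h1]
    filter_upwards [hfD, Lp.coeFn_smul ((Real.pi⁻¹ ^ 2 : ℝ) : ℂ) (f : L2 d)] with x e1 e2 hx
    rw [e2, Pi.smul_apply, e1 hx, smul_zero]
  rw [hu0, norm_zero] at hunorm
  exact (mul_pos (inv_pos.2 Real.pi_pos) (norm_pos_iff.2 hf0)).ne hunorm

/-- The operator `(P₁ + ∑ [(1/2 + μ) + z (1/2 - μ)]⁻¹ P_μ) (-Δ_N)⁻¹` on `L²₀(Y)`. -/
noncomputable def opV (D : Set (Pt d)) (z : ℂ) : L20 d →L[ℂ] L20 d :=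
  toL20 ∘L energyPart D z ∘L invNegLaplacian d

variable {μs : ℝ}

/-- Keeping `‖offW2 D‖²` in place of `π⁻²` is what later leaves a margin uniform in `z`. -/
lemma norm_opV_le (hμs : -(1 / 2) < μs) (hμs' : μs < 1 / 2)
    (hres : ∀ μ ∈ resonances D, μs ≤ μ) {z : ℂ} (hz : ‖z‖ < |zStar μs|) :
    ‖opV D z‖ ≤ ‖offW2 D‖ ^ 2 * coeffBound μs ‖z‖ :=
  (norm_conj_le (W2_starProjection_energyPart isOrtho_W1_W2 hμs hμs' hres hz)
    (energyPart_W2_starProjection isOrtho_W1_W2 hμs hμs' hres hz)).trans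
    (mul_le_mul_of_nonneg_left (norm_energyPart_le hμs hμs' hres hz) (sq_nonneg _))

lemma opA_zero : opA D 0 = toL20 ∘L P2 D ∘L invNegLaplacian d := by
  ext1 f
  simp only [opA, ContinuousLinearMap.comp_apply, add_apply, smul_apply, zero_smul,
    zero_add, add_zero]

lemma opA_eq (z : ℂ) : opA D z = opA D 0 + z • opV D z := by
  rw [opA_zero, opV, opA, energyPart]
  ext1 f
  simp only [ContinuousLinearMap.comp_apply, add_apply, smul_apply, map_add, map_smul, smul_add]
  abel

lemma isCompactOperator_opA (z : ℂ) : IsCompactOperator (opA D z) :=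
  isCompactOperator_toL20.comp_clm
    ((z • P1 D + P2 D + z • resonanceSum D z) ∘L invNegLaplacian d)

lemma isSelfAdjoint_opA_zero : IsSelfAdjoint (opA D 0) :=
  opA_zero (D := D) ▸ isSelfAdjoint_conj (isSelfAdjoint_starProjection (W2 D))

lemma isSelfAdjoint_opA (hμs : -(1 / 2) < μs) (hμs' : μs < 1 / 2)
    (hres : ∀ μ ∈ resonances D, μs ≤ μ) {z : ℝ} (hz : ‖(z : ℂ)‖ < |zStar μs|) :
    IsSelfAdjoint (opA D z) := by
  rw [opA_eq]
  have hV : IsSelfAdjoint (opV D z) :=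
    isSelfAdjoint_conj (isSelfAdjoint_energyPart hμs hμs' hres hz)
  exact isSelfAdjoint_add_real_smul isSelfAdjoint_opA_zero hV z

lemma differentiableOn_opV (hμs : -(1 / 2) < μs) (hμs' : μs < 1 / 2)
    (hres : ∀ μ ∈ resonances D, μs ≤ μ) :
    DifferentiableOn ℂ (opV D) (Metric.ball 0 |zStar μs|) := by
  have h1 : DifferentiableOn ℂ (energyPart D) (Metric.ball 0 |zStar μs|) :=
    (differentiableOn_const (P1 D)).add (differentiableOn_resonanceSum hμs hμs' hres)
  exact (differentiableOn_const (toL20 (d := d))).clm_comp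
    (h1.clm_comp (differentiableOn_const (invNegLaplacian d)))

/-- `A(0)` has infinite rank. -/
lemma not_finiteDimensional_range_opA_zero (hd : 0 < d) (hDo : IsOpen D) (hDne : D.Nonempty)
    (hDc : D ⊆ cell d) : ¬ FiniteDimensional ℂ (opA D 0).range := by
  rw [opA_zero]
  exact not_finiteDimensional_range_conj toL20_injective
    (not_finiteDimensional_W2 hd hDo hDne hDc)

end Strict

/-! ### Perturbation of an isolated eigenvalue -/

section InfiniteRank

lemma finiteDimensional_range_mul {E : Type*} [NormedAddCommGroup E] [NormedSpace ℂ E]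
    {S P : E →L[ℂ] E} [FiniteDimensional ℂ P.range] : FiniteDimensional ℂ (S * P).range := by
  have : (S * P).range = P.range.map (S : E →ₗ[ℂ] E) := LinearMap.range_comp _ _
  rw [this]
  infer_instance

variable {E : Type*} [NormedAddCommGroup E] [InnerProductSpace ℂ E] [CompleteSpace E]

/-- The origin is in the spectrum, since otherwise the identity would be compact and the space
finite dimensional. It cannot be `β₀`: then `L P = 0`, while winding number 1 gives `1 - P = -L ·
rieszAux`, a compact projection and hence of finite rank, so `L = L (1 - P)` would have finite rank.
-/
lemma zero_mem_contourOutside_of_infinite_rank {Γ : ℝ → ℂ} {L : E →L[ℂ] E} {β₀ : ℂ}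
    (hΓ : IsClosedContour Γ) (h : contourTrace Γ ⊆ resolventSet ℂ L) (hL : IsCompactOperator L)
    (hs : (L : E →ₗ[ℂ] E).IsSymmetric) (hin : β₀ ∈ contourInside Γ)
    (hout : ∀ β ∈ spectrum ℂ L, β ≠ β₀ → β ∈ contourOutside Γ)
    (hinf : ¬ FiniteDimensional ℂ L.range) : (0 : ℂ) ∈ contourOutside Γ := by
  have h0 : (0 : ℂ) ∈ spectrum ℂ L := by
    by_contra h0
    rw [spectrum.zero_notMem_iff] at h0
    have hc : IsCompactOperator (1 : E →L[ℂ] E) := by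
      rw [← Ring.mul_inverse_cancel L h0]
      exact hL.comp_clm (Ring.inverse L)
    have := finiteDimensional_range_of_isCompactOperator IsIdempotentElem.one hc
    refine hinf ?_
    rw [← mul_one L]
    exact finiteDimensional_range_mul
  refine hout 0 h0 fun hβ => hinf ?_
  rw [← hβ] at hin hout
  set P := rieszProj Γ L with hP
  have e1 : L * P = 0 := by
    simpa using sub_mul_rieszProj_eq_zero hΓ h hL hs hout
  have e2 : 1 - P = L * -rieszAux Γ L 0 := by
    have := sub_mul_rieszAux hΓ h hin.1
    rw [hin.2, one_smul, zero_smul, sub_zero] at this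
    rw [mul_neg, this, neg_sub]
  have hc : IsCompactOperator (1 - P : E →L[ℂ] E) := by
    rw [e2]
    exact hL.comp_clm (-rieszAux Γ L 0)
  have := finiteDimensional_range_of_isCompactOperator
    (isIdempotentElem_rieszProj_of_isSymmetric hΓ h hL hs).one_sub hc
  have e3 : L = L * (1 - P) := by rw [mul_sub, mul_one, e1, sub_zero]
  rw [e3]
  exact finiteDimensional_range_mul

end InfiniteRank

/-! ### Abstract perturbation theory for a family with a uniform Neumann bound on the contour. -/

section Perturbed

variable {E : Type*} [NormedAddCommGroup E] [InnerProductSpace ℂ E]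

/-- A holomorphic family `A(z) = A(0) + z V(z)` of compact operators, symmetric for real `z`, whose
perturbation is small compared with the distance `δ` of the contour `Γ` to the spectrum
of `A(0)`. -/
structure IsSmallPerturbation (Γ : ℝ → ℂ) (A V : ℂ → E →L[ℂ] E) (r δ q : ℝ) : Prop where
  contour : IsClosedContour Γ
  eq_add : ∀ z, A z = A 0 + z • V z
  compact : ∀ z, IsCompactOperator (A z)
  symmetric : ∀ t : ℝ, ‖(t : ℂ)‖ < r → (A t : E →ₗ[ℂ] E).IsSymmetric
  differentiable : DifferentiableOn ℂ V (Metric.ball 0 r)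
  radius_pos : 0 < r
  gap_pos : 0 < δ
  gap : ∀ ζ ∈ contourTrace Γ, δ ≤ Metric.infDist ζ (spectrum ℂ (A 0))
  norm_le : ∀ z, ‖z‖ < r → ‖z • V z‖ ≤ q * δ
  lt_one : q < 1
  zero_outside : (0 : ℂ) ∈ contourOutside Γ

namespace IsSmallPerturbation

variable {Γ : ℝ → ℂ} {A V : ℂ → E →L[ℂ] E} {r δ q : ℝ}

lemma nonneg (h : IsSmallPerturbation Γ A V r δ q) : 0 ≤ q := by
  have h1 := (norm_nonneg _).trans (h.norm_le 0 (by simpa using h.radius_pos))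
  exact nonneg_of_mul_nonneg_left h1 h.gap_pos

lemma symmetric_zero (h : IsSmallPerturbation Γ A V r δ q) :
    (A 0 : E →ₗ[ℂ] E).IsSymmetric := by
  have := h.symmetric 0 (by simpa using h.radius_pos)
  rwa [Complex.ofReal_zero] at this

lemma trace_subset_zero (h : IsSmallPerturbation Γ A V r δ q) :
    contourTrace Γ ⊆ resolventSet ℂ (A 0) := by
  intro ζ hζ
  by_contra hσ
  have h1 := h.gap ζ hζ
  rw [Metric.infDist_zero_of_mem (s := spectrum ℂ (A 0)) hσ] at h1
  exact h1.not_gt h.gap_pos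

lemma sub_eq_add (h : IsSmallPerturbation Γ A V r δ q) (z ζ : ℂ) :
    A z - ζ • (1 : E →L[ℂ] E) = (A 0 - ζ • (1 : E →L[ℂ] E)) + z • V z := by
  rw [h.eq_add z]
  abel

variable [CompleteSpace E]

/-- The origin is outside the contour, so a spectral point inside is nonzero and therefore an
eigenvalue of the compact operator. -/
lemma exists_eigenvector (h : IsSmallPerturbation Γ A V r δ q) {z β : ℂ}
    (hβ : β ∈ spectrum ℂ (A z) ∩ contourInside Γ) : ∃ u : E, u ≠ 0 ∧ A z u = β • u := by
  have hβ0 : β ≠ 0 := by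
    rintro rfl
    exact zero_ne_one (h.zero_outside.2.symm.trans hβ.2.2)
  obtain ⟨u, hu⟩ :=
    (((h.compact z).hasEigenvalue_iff_mem_spectrum hβ0).2 hβ.1).exists_hasEigenvector
  exact ⟨u, hu.2, hu.apply_eq_smul⟩

lemma isUnit_zero (h : IsSmallPerturbation Γ A V r δ q) {ζ : ℂ} (hζ : ζ ∈ contourTrace Γ) :
    IsUnit (A 0 - ζ • (1 : E →L[ℂ] E)) :=
  mem_resolventSet_iff_isUnit_sub.1 (h.trace_subset_zero hζ)

variable [Nontrivial E]

lemma norm_inverse_le_infDist (h : IsSmallPerturbation Γ A V r δ q) {ζ : ℂ}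
    (hζ : ζ ∈ resolventSet ℂ (A 0)) :
    ‖Ring.inverse (A 0 - ζ • (1 : E →L[ℂ] E))‖ ≤ (Metric.infDist ζ (spectrum ℂ (A 0)))⁻¹ := by
  have hsa : IsSelfAdjoint (A 0) :=
    ContinuousLinearMap.isSelfAdjoint_iff_isSymmetric.2 h.symmetric_zero
  have := hsa.isStarNormal
  exact norm_inverse_sub_le_of_isStarNormal (A 0) hζ (spectrum.nonempty _)

lemma norm_inverse_zero_le (h : IsSmallPerturbation Γ A V r δ q) {ζ : ℂ}
    (hζ : ζ ∈ contourTrace Γ) : ‖Ring.inverse (A 0 - ζ • (1 : E →L[ℂ] E))‖ ≤ δ⁻¹ :=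
  (h.norm_inverse_le_infDist (h.trace_subset_zero hζ)).trans
    (inv_anti₀ h.gap_pos (h.gap ζ hζ))

lemma norm_mul_inverse_le (h : IsSmallPerturbation Γ A V r δ q) {z ζ : ℂ} (hz : ‖z‖ < r)
    (hζ : ζ ∈ contourTrace Γ) :
    ‖z • V z * Ring.inverse (A 0 - ζ • (1 : E →L[ℂ] E))‖ ≤ q := by
  refine (norm_mul_le _ _).trans ?_
  calc ‖z • V z‖ * ‖Ring.inverse (A 0 - ζ • (1 : E →L[ℂ] E))‖ ≤ q * δ * δ⁻¹ :=
        mul_le_mul (h.norm_le z hz) (h.norm_inverse_zero_le hζ) (norm_nonneg _)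
          (mul_nonneg h.nonneg h.gap_pos.le)
    _ = q := mul_inv_cancel_right₀ h.gap_pos.ne' q

lemma trace_subset (h : IsSmallPerturbation Γ A V r δ q) {z : ℂ} (hz : ‖z‖ < r) :
    contourTrace Γ ⊆ resolventSet ℂ (A z) := by
  intro ζ hζ
  rw [mem_resolventSet_iff_isUnit_sub, h.sub_eq_add]
  exact isUnit_add_of_norm_lt (h.isUnit_zero hζ) ((h.norm_mul_inverse_le hz hζ).trans_lt h.lt_one)

lemma norm_inverse_le (h : IsSmallPerturbation Γ A V r δ q) {z : ℂ} (hz : ‖z‖ < r) {ζ : ℂ}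
    (hζ : ζ ∈ contourTrace Γ) :
    ‖Ring.inverse (A z - ζ • (1 : E →L[ℂ] E))‖ ≤ δ⁻¹ * (1 - q)⁻¹ := by
  have hq := h.lt_one
  rw [h.sub_eq_add]
  refine (norm_inverse_add_le (h.isUnit_zero hζ) (h.norm_mul_inverse_le hz hζ) h.lt_one).trans ?_
  have : 0 ≤ (1 - q)⁻¹ := inv_nonneg.2 (by linarith)
  exact mul_le_mul_of_nonneg_right (h.norm_inverse_zero_le hζ) this

lemma differentiableOn (h : IsSmallPerturbation Γ A V r δ q) :
    DifferentiableOn ℂ (fun z => rieszProj Γ (A z)) (Metric.ball 0 r) := by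
  have hA : DifferentiableOn ℂ A (Metric.ball 0 r) :=
    (differentiableOn_const_add_smul h.differentiable).congr fun z _ => h.eq_add z
  refine differentiableOn_rieszProj h.contour Metric.isOpen_ball hA (C := δ⁻¹ * (1 - q)⁻¹) ?_ ?_
  · exact fun z hz => h.trace_subset (mem_ball_zero_iff.1 hz)
  · exact fun z hz ζ hζ => h.norm_inverse_le (mem_ball_zero_iff.1 hz) hζ

/-- `P(z)² - P(z)` is holomorphic in the disc and vanishes for real `z`, where the operator is
self-adjoint; real points accumulate at 0, so the identity theorem finishes. -/
lemma isIdempotentElem (h : IsSmallPerturbation Γ A V r δ q) {z : ℂ} (hz : ‖z‖ < r) :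
    IsIdempotentElem (rieszProj Γ (A z)) := by
  have han : AnalyticOnNhd ℂ
      (fun z => rieszProj Γ (A z) * rieszProj Γ (A z) - rieszProj Γ (A z)) (Metric.ball 0 r) :=
    ((h.differentiableOn.mul h.differentiableOn).sub h.differentiableOn).analyticOnNhd
      Metric.isOpen_ball
  have hreal : ∀ t : ℝ, ‖(t : ℂ)‖ < r → IsIdempotentElem (rieszProj Γ (A t)) := fun t ht =>
    isIdempotentElem_rieszProj_of_isSymmetric h.contour (h.trace_subset ht) (h.compact t)
      (h.symmetric t ht)
  have hcoe : Tendsto Complex.ofReal (𝓝[≠] 0) (𝓝[≠] 0) := by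
    refine tendsto_nhdsWithin_iff.2 ⟨?_, ?_⟩
    · exact (Complex.continuous_ofReal.tendsto' 0 0 Complex.ofReal_zero).mono_left
        nhdsWithin_le_nhds
    · filter_upwards [self_mem_nhdsWithin] with t ht
      exact fun h0 => ht (Complex.ofReal_eq_zero.1 h0)
  have hfr : ∃ᶠ z in 𝓝[≠] (0 : ℂ),
      rieszProj Γ (A z) * rieszProj Γ (A z) - rieszProj Γ (A z) = 0 := by
    refine hcoe.frequently (Eventually.frequently ?_)
    have h1 : ∀ᶠ t : ℝ in 𝓝 0, ‖(t : ℂ)‖ < r := by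
      refine ContinuousAt.eventually_lt (by fun_prop) continuousAt_const ?_
      simpa using h.radius_pos
    filter_upwards [nhdsWithin_le_nhds h1] with t ht
    exact sub_eq_zero.2 (hreal t ht)
  exact sub_eq_zero.1 (han.eqOn_zero_of_preconnected_of_frequently_eq_zero
    (convex_ball 0 r).isPreconnected (Metric.mem_ball_self h.radius_pos) hfr
    (mem_ball_zero_iff.2 hz))

lemma finiteDimensional_range (h : IsSmallPerturbation Γ A V r δ q) {z : ℂ} (hz : ‖z‖ < r) :
    FiniteDimensional ℂ (rieszProj Γ (A z)).range :=
  finiteDimensional_range_of_isCompactOperator (h.isIdempotentElem hz)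
    (isCompactOperator_rieszProj h.contour (h.trace_subset hz) (h.compact z) h.zero_outside)

lemma exists_equiv (h : IsSmallPerturbation Γ A V r δ q) {z : ℂ} (hz : ‖z‖ < r) :
    Nonempty ((rieszProj Γ (A z)).range ≃L[ℂ] (rieszProj Γ (A 0)).range) := by
  have h0 : ‖(0 : ℂ)‖ < r := by simpa using h.radius_pos
  have := h.finiteDimensional_range hz
  have := h.finiteDimensional_range h0
  refine FiniteDimensional.nonempty_continuousLinearEquiv_of_finrank_eq ?_
  exact finrank_range_eq_of_continuousOn (convex_ball (0 : ℂ) r).isPreconnected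
    h.differentiableOn.continuousOn (fun w hw => h.isIdempotentElem (mem_ball_zero_iff.1 hw))
    (fun w hw => h.finiteDimensional_range (mem_ball_zero_iff.1 hw))
    (mem_ball_zero_iff.2 hz) (mem_ball_zero_iff.2 h0)

lemma spectrum_eq (h : IsSmallPerturbation Γ A V r δ q) {z : ℂ} (hz : ‖z‖ < r) :
    spectrum ℂ (A z)
      = spectrum ℂ (A z) ∩ contourInside Γ ∪ spectrum ℂ (A z) ∩ contourOutside Γ := by
  rw [← inter_union_distrib_left, eq_comm, inter_eq_left]
  intro β hβ
  have hβΓ : β ∉ contourTrace Γ := fun hβ' => hβ (h.trace_subset hz hβ')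
  exact (h.contour.winding β hβΓ).symm.imp (fun h1 => ⟨hβΓ, h1⟩) fun h1 => ⟨hβΓ, h1⟩

lemma apply_eigenvector (h : IsSmallPerturbation Γ A V r δ q) {z β : ℂ} (hz : ‖z‖ < r)
    (hβ : β ∈ contourInside Γ) {u : E} (hu : A z u = β • u) : rieszProj Γ (A z) u = u := by
  rw [rieszProj_apply_eigenvector h.contour (h.trace_subset hz) hβ.1 hu, hβ.2, one_smul]

/-- The eigenvectors belonging to these points lie in the finite dimensional range of the
projection, so the points are eigenvalues of the restriction of `A z` to it. -/
lemma finite_inside (h : IsSmallPerturbation Γ A V r δ q) {z : ℂ} (hz : ‖z‖ < r) :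
    (spectrum ℂ (A z) ∩ contourInside Γ).Finite := by
  have := h.finiteDimensional_range hz
  set P := rieszProj Γ (A z) with hP
  have hcomm : Commute (A z) P :=
    commute_rieszProj h.contour (h.trace_subset hz) (Commute.refl _)
  let g : Module.End ℂ P.range := (A z : E →ₗ[ℂ] E).restrict (range_invariant hcomm)
  refine (Module.End.finite_spectrum g).subset fun β hβ => ?_
  obtain ⟨u, hu0, hu⟩ := h.exists_eigenvector hβ
  have hu' : u ∈ P.range := ⟨u, h.apply_eigenvector hz hβ.2 hu⟩
  refine Module.End.HasEigenvalue.mem_spectrum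
    (Module.End.hasEigenvalue_of_hasEigenvector (x := ⟨u, hu'⟩)
      ⟨Module.End.mem_eigenspace_iff.2 (Subtype.ext hu), fun h0 => hu0 (congrArg Subtype.val h0)⟩)

/-- The resolvent bound puts `β` within `‖z V(z)‖` of some `w` in the spectrum of `A 0`. If `w` were
not `β₀`, the segment from `β` to `w` would cross the contour, whose points are at distance at least
`δ > ‖z V(z)‖` from `w`. -/
lemma norm_sub_le_of_mem_inside (h : IsSmallPerturbation Γ A V r δ q) {β₀ : ℂ}
    (hout : ∀ β ∈ spectrum ℂ (A 0), β ≠ β₀ → β ∈ contourOutside Γ) {z : ℂ} (hz : ‖z • V z‖ < δ)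
    {β : ℂ} (hβ : β ∈ spectrum ℂ (A z) ∩ contourInside Γ) : ‖β - β₀‖ ≤ ‖z • V z‖ := by
  have hd : Metric.infDist β (spectrum ℂ (A 0)) ≤ ‖z • V z‖ := by
    by_contra hlt
    rw [not_le] at hlt
    have hpos := (norm_nonneg _).trans_lt hlt
    have hres : β ∈ resolventSet ℂ (A 0) := by
      by_contra hσ
      rw [Metric.infDist_zero_of_mem (s := spectrum ℂ (A 0)) hσ] at hpos
      exact hpos.false
    refine hβ.1 ?_
    rw [mem_resolventSet_iff_isUnit_sub, h.sub_eq_add]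
    refine isUnit_add_of_norm_lt (mem_resolventSet_iff_isUnit_sub.1 hres) ?_
    refine ((norm_mul_le _ _).trans (mul_le_mul_of_nonneg_left
      (h.norm_inverse_le_infDist hres) (norm_nonneg _))).trans_lt ?_
    rw [← div_eq_mul_inv]
    exact (div_lt_one hpos).2 hlt
  obtain ⟨w, hw, hwd⟩ :=
    (spectrum.isCompact (𝕜 := ℂ) (A 0)).exists_infDist_eq_dist (spectrum.nonempty (A 0)) β
  rw [hwd] at hd
  by_cases hw0 : w = β₀
  · rwa [← hw0, ← dist_eq_norm]
  · obtain ⟨ζ, hζ, hζs⟩ := h.contour.exists_mem_segment hβ.2 (hout w hw hw0)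
    have h1 : dist ζ w ≤ dist β w := by
      rw [dist_eq_norm, dist_eq_norm]
      exact norm_sub_le_of_mem_segment (segment_symm ℝ β w ▸ hζs)
    have h2 := (h.gap ζ hζ).trans (Metric.infDist_le_dist_of_mem hw)
    linarith

lemma tendsto_inside (h : IsSmallPerturbation Γ A V r δ q) {β₀ : ℂ}
    (hout : ∀ β ∈ spectrum ℂ (A 0), β ≠ β₀ → β ∈ contourOutside Γ) {ε : ℝ} (hε : 0 < ε) :
    ∃ η > 0, ∀ z : ℂ, ‖z‖ < η → ∀ β ∈ spectrum ℂ (A z) ∩ contourInside Γ, ‖β - β₀‖ < ε := by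
  have hc : ContinuousAt (fun z => z • V z) 0 :=
    continuousAt_id.smul (h.differentiable.continuousOn.continuousAt
      (Metric.ball_mem_nhds 0 h.radius_pos))
  have h1 : ∀ᶠ z in 𝓝 (0 : ℂ), ‖z • V z‖ < min ε δ := by
    refine hc.norm.eventually_lt continuousAt_const ?_
    simpa using lt_min hε h.gap_pos
  obtain ⟨η, hη, hη'⟩ := Metric.eventually_nhds_iff.1 h1
  refine ⟨η, hη, fun z hz β hβ => ?_⟩
  have h2 := lt_min_iff.1 (hη' (by rwa [dist_zero_right]))
  exact (h.norm_sub_le_of_mem_inside hout h2.2 hβ).trans_lt h2.1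

/-- Integrating `(ζ - β₀)` against the Neumann series expands `(A(z) - β₀) P(z)`, whose diagonal
entry at a unit eigenvector is `β - β₀`. The constant `K` precedes `z`, `β`, `φ` and `N`, which is
what makes the convergence uniform. -/
lemma exists_norm_series_sub_le (h : IsSmallPerturbation Γ A V r δ q) {β₀ : ℂ}
    (hout : ∀ β ∈ spectrum ℂ (A 0), β ≠ β₀ → β ∈ contourOutside Γ) :
    ∃ K : ℝ, ∀ (z : ℂ) (β : ℂ) (φ : E) (N : ℕ), ‖z‖ < r → β ∈ contourInside Γ → ‖φ‖ = 1 →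
      A z φ = β • φ →
      ‖β - (β₀ + ∑ n ∈ Finset.Icc 1 N, z ^ n * (-(2 * Real.pi * Complex.I)⁻¹ *
        ⟪φ, (contourIntegral Γ fun ζ => (ζ - β₀) • (Ring.inverse (A 0 - ζ • (1 : E →L[ℂ] E)) *
          (-(V z * Ring.inverse (A 0 - ζ • (1 : E →L[ℂ] E)))) ^ n)) φ⟫_ℂ))‖ ≤ K * q ^ (N + 1) := by
  obtain ⟨B, hB⟩ := h.contour.isCompact_trace.exists_bound_of_continuousOn
    (f := fun ζ : ℂ => ζ - β₀) (by fun_prop)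
  have hB0 : 0 ≤ B := by
    obtain ⟨ζ, hζ⟩ := nonempty_contourTrace Γ
    exact (norm_nonneg _).trans (hB ζ hζ)
  set ℓ := ∫ t in (0 : ℝ)..1, ‖deriv Γ t‖ with hℓ
  set c : ℂ := -(2 * Real.pi * Complex.I)⁻¹ with hc
  -- The factors are the prefactor `1/(2π)`, the length of the contour, a bound for `|ζ - β₀|` on
  -- it, and the bound `δ⁻¹` for the unperturbed resolvent times the geometric factor.
  refine ⟨‖c‖ * (ℓ * (B * (δ⁻¹ * (1 - q)⁻¹))), fun z β φ N hz hβ hφ hAφ => ?_⟩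
  set R : ℂ → E →L[ℂ] E := fun ζ => Ring.inverse (A 0 - ζ • (1 : E →L[ℂ] E)) with hR
  have hRc : ContinuousOn R (contourTrace Γ) := continuousOn_inverse_sub h.trace_subset_zero
  set F : ℕ → ℂ → E →L[ℂ] E := fun n ζ => (ζ - β₀) • (R ζ * (-(V z * R ζ)) ^ n) with hF
  have hid : ContinuousOn (fun ζ : ℂ => ζ - β₀) (contourTrace Γ) := by fun_prop
  have hFc : ∀ n, ContinuousOn (F n) (contourTrace Γ) := fun n =>
    hid.smul (hRc.mul ((continuousOn_const.mul hRc).neg.pow n))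
  set G : ℂ → E →L[ℂ] E := fun ζ => (ζ - β₀) • Ring.inverse (A z - ζ • (1 : E →L[ℂ] E)) with hG
  have hGc : ContinuousOn G (contourTrace Γ) :=
    hid.smul (continuousOn_inverse_sub (h.trace_subset hz))
  have hcF : ∀ n, ContinuousOn (fun ζ => z ^ n • F n ζ) (contourTrace Γ) := fun n =>
    (hFc n).const_smul (z ^ n)
  set Q : E →L[ℂ] E := c • (contourIntegral Γ G -
    ∑ n ∈ Finset.range (N + 1), z ^ n • contourIntegral Γ (F n)) with hQ
  have hQnorm : ‖Q‖ ≤ ‖c‖ * (ℓ * (B * (δ⁻¹ * (1 - q)⁻¹))) * q ^ (N + 1) := by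
    have e1 : contourIntegral Γ G - ∑ n ∈ Finset.range (N + 1), z ^ n • contourIntegral Γ (F n)
        = contourIntegral Γ fun ζ =>
          G ζ + (-1 : ℂ) • ∑ n ∈ Finset.range (N + 1), z ^ n • F n ζ := by
      have hSc : ContinuousOn (fun ζ => (-1 : ℂ) • ∑ n ∈ Finset.range (N + 1), z ^ n • F n ζ)
          (contourTrace Γ) := (continuousOn_finsetSum _ fun n _ => hcF n).const_smul (-1 : ℂ)
      rw [h.contour.contourIntegral_add hGc hSc, contourIntegral_smul,
        h.contour.contourIntegral_sum _ fun n _ => hcF n]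
      simp only [contourIntegral_smul]
      rw [neg_one_smul, ← sub_eq_add_neg]
    rw [hQ, e1, norm_smul]
    rw [mul_assoc, mul_assoc ℓ]
    refine mul_le_mul_of_nonneg_left (h.contour.norm_contourIntegral_le fun ζ hζ => ?_)
      (norm_nonneg _)
    have e2 : G ζ + (-1 : ℂ) • ∑ n ∈ Finset.range (N + 1), z ^ n • F n ζ
        = (ζ - β₀) • (Ring.inverse ((A 0 - ζ • (1 : E →L[ℂ] E)) + z • V z) -
          ∑ n ∈ Finset.range (N + 1), R ζ * (-(z • V z * R ζ)) ^ n) := by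
      rw [neg_one_smul, ← sub_eq_add_neg, ← h.sub_eq_add, smul_sub, Finset.smul_sum]
      congr 1
      refine Finset.sum_congr rfl fun n _ => ?_
      rw [smul_mul_assoc, ← smul_neg, smul_pow, mul_smul_comm, smul_comm]
    rw [e2, norm_smul, mul_assoc B]
    refine mul_le_mul (hB ζ hζ) ?_ (norm_nonneg _) hB0
    have hq1 : 0 ≤ (1 - q)⁻¹ := inv_nonneg.2 (by linarith [h.lt_one])
    have hq2 : 0 ≤ q ^ (N + 1) * (1 - q)⁻¹ := mul_nonneg (pow_nonneg h.nonneg _) hq1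
    refine (norm_inverse_add_sub_sum_le (h.isUnit_zero hζ) (h.norm_mul_inverse_le hz hζ) h.lt_one
      (N + 1)).trans ?_
    calc ‖R ζ‖ * (q ^ (N + 1) * (1 - q)⁻¹) ≤ δ⁻¹ * (q ^ (N + 1) * (1 - q)⁻¹) :=
          mul_le_mul_of_nonneg_right (h.norm_inverse_zero_le hζ) hq2
      _ = _ := by ring
  have hφφ : ⟪φ, φ⟫_ℂ = 1 := by
    rw [inner_self_eq_norm_sq_to_K, hφ]
    norm_num
  have hGφ : ⟪φ, (c • contourIntegral Γ G) φ⟫_ℂ = β - β₀ := by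
    rw [hc, hG, contourIntegral_weighted h.contour (h.trace_subset hz), mul_apply_eq_comp,
      h.apply_eigenvector hz hβ hAφ, sub_apply, hAφ, smul_apply, one_apply_eq_self, ← sub_smul,
      inner_smul_right, hφφ, mul_one]
  -- The term of order zero is `(A 0 - β₀)` times the unperturbed projection, which vanishes as `β₀`
  -- is the only spectral point inside; so the series starts at `n = 1`.
  have hF0 : c • contourIntegral Γ (F 0) = 0 := by
    have e : F 0 = fun ζ => (ζ - β₀) • Ring.inverse (A 0 - ζ • (1 : E →L[ℂ] E)) := by
      funext ζ
      simp only [hF, hR, pow_zero, mul_one]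
    rw [e, hc, contourIntegral_weighted h.contour h.trace_subset_zero,
      sub_mul_rieszProj_eq_zero h.contour h.trace_subset_zero (h.compact 0) h.symmetric_zero hout]
  have hsum : β - (β₀ + ∑ n ∈ Finset.Icc 1 N,
      z ^ n * (c * ⟪φ, contourIntegral Γ (F n) φ⟫_ℂ)) = ⟪φ, Q φ⟫_ℂ := by
    have e1 : Q = c • contourIntegral Γ G -
        ∑ n ∈ Finset.Icc 1 N, z ^ n • c • contourIntegral Γ (F n) := by
      have e2 : ∑ n ∈ Finset.range (N + 1), z ^ n • c • contourIntegral Γ (F n)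
          = ∑ n ∈ Finset.Icc 1 N, z ^ n • c • contourIntegral Γ (F n) := by
        rw [Finset.range_eq_Ico, Finset.sum_eq_sum_Ico_succ_bot (Nat.succ_pos N), hF0, smul_zero,
          zero_add]
        rfl
      rw [hQ, smul_sub, Finset.smul_sum, ← e2]
      congr 1
      exact Finset.sum_congr rfl fun n _ => smul_comm _ _ _
    rw [e1, sub_apply, inner_sub_right, hGφ, sum_apply, inner_sum, sub_sub]
    congr 2
    refine Finset.sum_congr rfl fun n _ => ?_
    rw [smul_apply, smul_apply, inner_smul_right, inner_smul_right]
  rw [hsum]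
  refine (norm_inner_le_norm _ _).trans ?_
  rw [hφ, one_mul]
  refine (Q.le_opNorm φ).trans ?_
  rwa [hφ, mul_one]

end IsSmallPerturbation

end Perturbed

/-! ### The family `A(z)` -/

section Main

variable {d : ℕ} {D : Set (Pt d)} {μs : ℝ} {Γ : ℝ → ℂ} {β₀ : ℂ}

lemma nontrivial_L20 (hd : 0 < d) (hDo : IsOpen D) (hDne : D.Nonempty) (hDc : D ⊆ cell d) :
    Nontrivial (L20 d) := by
  by_contra h
  rw [not_nontrivial_iff_subsingleton] at h
  refine not_finiteDimensional_range_opA_zero hd hDo hDne hDc ?_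
  have : Subsingleton (opA D 0).range := inferInstance
  infer_instance

lemma trace_subset_resolventSet_opA_zero (hin : β₀ ∈ contourInside Γ)
    (hout : ∀ β ∈ spectrum ℂ (opA D 0), β ≠ β₀ → β ∈ contourOutside Γ) :
    contourTrace Γ ⊆ resolventSet ℂ (opA D 0) := by
  intro ζ hζ
  by_contra hσ
  by_cases h : ζ = β₀
  · exact hin.1 (h ▸ hζ)
  · exact (hout ζ hσ h).1 hζ

lemma dHat_le {ζ : ℂ} (hζ : ζ ∈ contourTrace Γ) :
    dHat D Γ ≤ Metric.infDist ζ (spectrum ℂ (opA D 0)) := by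
  refine csInf_le ⟨0, ?_⟩ ⟨ζ, hζ, rfl⟩
  rintro _ ⟨w, -, rfl⟩
  exact Metric.infDist_nonneg

lemma dHat_pos [Nontrivial (L20 d)] (hΓ : IsClosedContour Γ)
    (h : contourTrace Γ ⊆ resolventSet ℂ (opA D 0)) : 0 < dHat D Γ := by
  have hc : IsCompact ((fun ζ => Metric.infDist ζ (spectrum ℂ (opA D 0))) '' contourTrace Γ) :=
    hΓ.isCompact_trace.image (Metric.continuous_infDist_pt _)
  obtain ⟨ζ, hζ, hζ'⟩ := hc.sInf_mem ((nonempty_contourTrace Γ).image _)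
  rw [dHat, ← hζ']
  refine ((spectrum.isClosed (𝕜 := ℂ) (opA D 0)).notMem_iff_infDist_pos (spectrum.nonempty _)).1 ?_
  exact fun hσ => hσ (h hζ)

lemma zStar_abs_pos (hμs : -(1 / 2) < μs) (hμs' : μs < 1 / 2) : 0 < |zStar μs| := by
  have h1 := abs_zStar hμs hμs'
  refine pos_of_mul_pos_right (a := 1 / 2 - μs) ?_ (by linarith)
  rw [h1]
  linarith

lemma rStar_pos (hμs : -(1 / 2) < μs) (hμs' : μs < 1 / 2) (hd : 0 < dHat D Γ) :
    0 < rStar D Γ μs := by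
  have h1 := zStar_abs_pos hμs hμs'
  have h2 : 0 < 1 / 2 - μs := by linarith
  rw [rStar]
  positivity

lemma rStar_lt (hμs : -(1 / 2) < μs) (hμs' : μs < 1 / 2) (hd : 0 < dHat D Γ) :
    rStar D Γ μs < |zStar μs| := by
  have h1 := zStar_abs_pos hμs hμs'
  have h2 : 0 < 1 / (1 / 2 - μs) := one_div_pos.2 (by linarith)
  have h3 : 0 < Real.pi ^ 2 * dHat D Γ := by positivity
  rw [rStar, div_lt_iff₀ (by positivity)]
  nlinarith

/-- `r*` is the solution `s` of `s = (1/2 - μs) π² d̂ (|z*| - s)`, the equality case of this bound.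
-/
lemma mul_coeffBound_le (hμs : -(1 / 2) < μs) (hμs' : μs < 1 / 2) (hd : 0 < dHat D Γ) {s : ℝ}
    (hs : s < rStar D Γ μs) : s * coeffBound μs s ≤ Real.pi ^ 2 * dHat D Γ := by
  have hsZ := hs.trans (rStar_lt hμs hμs' hd)
  have hm : 0 < 1 / 2 - μs := by linarith
  have h3 : 0 < Real.pi ^ 2 * dHat D Γ := by positivity
  rw [rStar, lt_div_iff₀ (by positivity)] at hs
  rw [coeffBound, ← div_eq_mul_inv, div_le_iff₀ (mul_pos hm (by linarith))]
  generalize Real.pi ^ 2 * dHat D Γ = b at *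
  have e : s = (1 / 2 - μs) * (s * (1 / (1 / 2 - μs))) := by
    rw [mul_comm s, ← mul_assoc, mul_one_div_cancel hm.ne', one_mul]
  have h4 : s * (1 / (1 / 2 - μs)) ≤ b * (|zStar μs| - s) := by linarith
  calc s = (1 / 2 - μs) * (s * (1 / (1 / 2 - μs))) := e
    _ ≤ (1 / 2 - μs) * (b * (|zStar μs| - s)) := mul_le_mul_of_nonneg_left h4 hm.le
    _ = _ := by ring

/-- The ratio is `q = ‖offW2 D‖² π²`: the definition of `r*` absorbs `|z|` and the resonance
coefficients into `π² d̂`, and the strict Poincaré bound gives `q < 1` independently of `z`. -/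
theorem isSmallPerturbation_opA (hd : 0 < d) (hDo : IsOpen D) (hDne : D.Nonempty)
    (hDc : D ⊆ cell d) (hμs : -(1 / 2) < μs) (hμs' : μs < 1 / 2)
    (hres : ∀ μ ∈ resonances D, μs ≤ μ) (hΓ : IsClosedContour Γ) (hin : β₀ ∈ contourInside Γ)
    (hout : ∀ β ∈ spectrum ℂ (opA D 0), β ≠ β₀ → β ∈ contourOutside Γ) :
    IsSmallPerturbation Γ (opA D) (opV D) (rStar D Γ μs) (dHat D Γ)
      (‖offW2 D‖ ^ 2 * Real.pi ^ 2) := by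
  have := nontrivial_L20 hd hDo hDne hDc
  have htr := trace_subset_resolventSet_opA_zero hin hout
  have hgap := dHat_pos hΓ htr
  have hrZ := rStar_lt hμs hμs' hgap
  refine
    { contour := hΓ
      eq_add := opA_eq
      compact := isCompactOperator_opA
      symmetric := fun t ht => (isSelfAdjoint_opA hμs hμs' hres (ht.trans hrZ)).isSymmetric
      differentiable := (differentiableOn_opV hμs hμs' hres).mono (Metric.ball_subset_ball hrZ.le)
      radius_pos := rStar_pos hμs hμs' hgap
      gap_pos := hgap
      gap := fun ζ hζ => dHat_le hζ
      norm_le := fun z hz => ?_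
      lt_one := ?_
      zero_outside := zero_mem_contourOutside_of_infinite_rank hΓ htr (isCompactOperator_opA 0)
        isSelfAdjoint_opA_zero.isSymmetric hin hout
        (not_finiteDimensional_range_opA_zero hd hDo hDne hDc) }
  · refine (ContinuousLinearMap.opNorm_smul_le z (opV D z)).trans ?_
    calc ‖z‖ * ‖opV D z‖ ≤ ‖z‖ * (‖offW2 D‖ ^ 2 * coeffBound μs ‖z‖) :=
          mul_le_mul_of_nonneg_left (norm_opV_le hμs hμs' hres (hz.trans hrZ)) (norm_nonneg _)
      _ = ‖offW2 D‖ ^ 2 * (‖z‖ * coeffBound μs ‖z‖) := by ring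
      _ ≤ ‖offW2 D‖ ^ 2 * (Real.pi ^ 2 * dHat D Γ) :=
          mul_le_mul_of_nonneg_left (mul_coeffBound_le hμs hμs' hgap hz) (sq_nonneg _)
      _ = _ := by ring
  · have h1 : ‖offW2 D‖ ^ 2 < Real.pi⁻¹ ^ 2 :=
      pow_lt_pow_left₀ (norm_offW2_lt hDo hDne hDc) (ContinuousLinearMap.opNorm_nonneg _)
        two_ne_zero
    have h2 : 0 < Real.pi ^ 2 := by positivity
    calc ‖offW2 D‖ ^ 2 * Real.pi ^ 2 < Real.pi⁻¹ ^ 2 * Real.pi ^ 2 :=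
          mul_lt_mul_of_pos_right h1 h2
      _ = 1 := by rw [← mul_pow, inv_mul_cancel₀ Real.pi_ne_zero, one_pow]

end Main

end NeumannCrystal

/-! ### The main theorem. -/

theorem mainTheorem6 {d : ℕ} (hd : d = 2 ∨ d = 3) {D : Set (Pt d)} (hD : IsInclusionDomain D)
    {μs : ℝ} (hμs : -(1 / 2) < μs) (hμs' : μs < 1 / 2) (hres : ∀ μ ∈ resonances D, μs ≤ μ)
    {Γ : ℝ → ℂ} (hΓ : IsClosedContour Γ) {β₀ : ℂ} (hβ₀ : β₀ ∈ spectrum ℂ (opA D 0))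
    (hin : β₀ ∈ contourInside Γ)
    (hout : ∀ β ∈ spectrum ℂ (opA D 0), β ≠ β₀ → β ∈ contourOutside Γ) :
    -- separation of the spectrum by the contour
    (∀ z : ℂ, ‖z‖ < rStar D Γ μs →
      contourTrace Γ ⊆ resolventSet ℂ (opA D 0) ∧
      contourTrace Γ ⊆ resolventSet ℂ (opA D z) ∧
      spectrum ℂ (opA D z) = sigmaIn D Γ z ∪ sigmaOut D Γ z ∧
      IsIdempotentElem (specProj D Γ z) ∧
      Commute (opA D z) (specProj D Γ z) ∧
      spectrumOn (opA D z) (specSpace D Γ z) = sigmaIn D Γ z ∧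
      spectrumOn (opA D z) (specProj D Γ z).ker = sigmaOut D Γ z ∧
      (sigmaIn D Γ z).Finite ∧
      FiniteDimensional ℂ (specSpace D Γ z) ∧
      ∀ β ∈ sigmaIn D Γ z, ∃ u : L20 d, u ≠ 0 ∧ opA D z u = β • u) ∧
    -- the eigenvalues inside the contour form the eigenvalue group of `β₀`
    (∀ ε > 0, ∃ δ > 0, ∀ z : ℂ, ‖z‖ < δ → ‖z‖ < rStar D Γ μs →
      ∀ β ∈ sigmaIn D Γ z, ‖β - β₀‖ < ε) ∧
    -- holomorphy of the spectral projection
    DifferentiableOn ℂ (specProj D Γ) (Metric.ball 0 (rStar D Γ μs)) ∧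
    -- the ranges are isomorphic
    (∀ z : ℂ, ‖z‖ < rStar D Γ μs → Nonempty (specSpace D Γ z ≃L[ℂ] specSpace D Γ 0)) ∧
    -- uniform convergence of the eigenvalue series
    (∀ (β : ℝ → ℂ) (φ : ℝ → L20 d),
      (∀ z : ℝ, |z| < rStar D Γ μs →
        β z ∈ contourInside Γ ∧ ‖φ z‖ = 1 ∧ opA D z (φ z) = β z • φ z) →
      TendstoUniformlyOn
        (fun (N : ℕ) (z : ℝ) =>
          β₀ + ∑ n ∈ Finset.Icc 1 N, (z : ℂ) ^ n * seriesCoeff D Γ β₀ n z (φ z))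
        β atTop {z : ℝ | |z| < rStar D Γ μs}) := by
  have hd0 : 0 < d := by omega
  have hDc : D ⊆ cell d := subset_closure.trans hD.closure_subset
  have := nontrivial_L20 hd0 hD.isOpen hD.nonempty hDc
  have h := isSmallPerturbation_opA hd0 hD.isOpen hD.nonempty hDc hμs hμs' hres hΓ hin hout
  refine ⟨fun z hz => ?_, fun ε hε => ?_, h.differentiableOn, fun z hz => h.exists_equiv hz,
    fun β φ hβφ => ?_⟩
  · have hs := spectrumOn_rieszProj hΓ (h.trace_subset hz) (h.isIdempotentElem hz)
    exact ⟨h.trace_subset_zero, h.trace_subset hz, h.spectrum_eq hz, h.isIdempotentElem hz,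
      commute_rieszProj hΓ (h.trace_subset hz) (Commute.refl _), hs.1, hs.2, h.finite_inside hz,
      h.finiteDimensional_range hz, fun β hβ => h.exists_eigenvector hβ⟩
  · obtain ⟨η, hη, hη'⟩ := h.tendsto_inside hout hε
    exact ⟨η, hη, fun z hz _ => hη' z hz⟩
  · obtain ⟨K, hK⟩ := h.exists_norm_series_sub_le hout
    -- The geometric bound does not involve `z`, so its decay is the uniform convergence up to the
    -- boundary of the interval.
    have hlim : Tendsto (fun N : ℕ => K * (‖offW2 D‖ ^ 2 * Real.pi ^ 2) ^ (N + 1)) atTop (𝓝 0) := by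
      have := ((tendsto_pow_atTop_nhds_zero_of_lt_one h.nonneg h.lt_one).comp
        (tendsto_add_atTop_nat 1)).const_mul K
      simpa using this
    rw [Metric.tendstoUniformlyOn_iff]
    intro ε hε
    filter_upwards [hlim.eventually_lt_const hε] with N hN z hz
    obtain ⟨h1, h2, h3⟩ := hβφ z hz
    rw [dist_eq_norm]
    exact (hK z (β z) (φ z) N (by rwa [Complex.norm_real]) h1 h2 h3).trans_lt hN
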